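/- Let $(M,g)$ be an oriented smooth Riemannian 4-manifold. Assume that $g$ is Einstein with nonzero cosmological constant, i.e. $\mathrm{Ric}(g)=6\Lambda g$ with a constant $\Lambda\neq 0$ (so the scalar curvature is $R=24\Lambda$), and anti-self-dual, i.e. the self-dual part of its Weyl tensor vanishes. For an open set $V\subseteq M$ we say that * $g$ is conformal to a Kähler metric on $V$ if there are a smooth function $\Omega>0$ on $V$ and a smooth endomorphism field $J$ of $TV$ with $J^2=-1$ that is orthogonal and parallel for the metric $\hat g=\Omega^2 g$ and its Levi-Civita connection, and whose Kähler form $\hat\Sigma=\hat g(J\cdot,\cdot)$ is self-dual (equivalently, $\hat\Sigma\wedge\hat\Sigma$ induces the given orientation); * $g$ admits a Killing vector on $V$ if there is a smooth vector field $X$ on $V$, not identically zero, with $\mathcal L_X g=0$. Then $g$ is locally conformal to a Kähler metric if and only if it locally admits a Killing vector. Precisely, for every nonempty connected open set $U\subseteq M$: 1. $g$ is conformal to a Kähler metric on some nonempty open subset of $U$ if and only if $g$ admits a Killing vector on some nonempty open subset of $U$; 2. if $g$ is conformal to a Kähler metric on $U$, then $g$ admits a Killing vector on $U$; 3. if $g$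 admits a Killing vector on $U$, then $g$ is conformal to a Kähler metric on an open dense subset of $U$. -/

import Mathlib

open scoped Manifold ContDiff

noncomputable section

namespace ConfKahler

/-- The model space of four-manifolds. -/
abbrev E4 : Type := EuclideanSpace ℝ (Fin 4)

/-- The matrix of components of a tensor of rank two. -/
abbrev Mat4 : Type := Matrix (Fin 4) (Fin 4) ℝ

/-! ### Riemannian geometry in a coordinate domain

`G : E4 → Mat4` is the matrix `g_{ij}` of a metric, as a function of the coordinates. -/

/-- The partial derivative `∂_k f`. -/
def pd (k : Fin 4) (f : E4 → ℝ) (y : E4) : ℝ :=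
  fderiv ℝ f y (EuclideanSpace.single k 1)

/-- The Christoffel symbol `Γ^k_{ij} = ½ g^{kl} (∂_i g_{jl} + ∂_j g_{il} - ∂_l g_{ij})`. -/
def christoffel (G : E4 → Mat4) (y : E4) (k i j : Fin 4) : ℝ :=
  (1 / 2) * ∑ l, (G y)⁻¹ k l *
    (pd i (fun z => G z j l) y + pd j (fun z => G z i l) y - pd l (fun z => G z i j) y)

/-- The curvature components `R^a_{bcd}`, where `R(∂_c, ∂_d) ∂_b = R^a_{bcd} ∂_a` and
`R(X, Y) = [∇_X, ∇_Y] - ∇_{[X, Y]}`. -/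
def curvature (G : E4 → Mat4) (y : E4) (a b c d : Fin 4) : ℝ :=
  pd c (fun z => christoffel G z a d b) y - pd d (fun z => christoffel G z a c b) y
    + ∑ m, (christoffel G y a c m * christoffel G y m d b
      - christoffel G y a d m * christoffel G y m c b)

/-- The Riemann tensor `R_{abcd} = g_{am} R^m_{bcd}`. -/
def riemann (G : E4 → Mat4) (y : E4) (a b c d : Fin 4) : ℝ :=
  ∑ m, G y a m * curvature G y m b c d

/-- The Ricci tensor `R_{bd} = R^a_{bad}` (positive definite on round spheres). -/
def ricci (G : E4 → Mat4) (y : E4) (b d : Fin 4) : ℝ :=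
  ∑ a, curvature G y a b a d

/-- The scalar curvature `R = g^{bd} R_{bd}`. -/
def scalarCurvature (G : E4 → Mat4) (y : E4) : ℝ :=
  ∑ b, ∑ d, (G y)⁻¹ b d * ricci G y b d

/-- The Weyl tensor `C_{abcd}` in dimension four. -/
def weyl (G : E4 → Mat4) (y : E4) (a b c d : Fin 4) : ℝ :=
  riemann G y a b c d
    - (1 / 2) * (G y a c * ricci G y b d - G y a d * ricci G y b c
      - G y b c * ricci G y a d + G y b d * ricci G y a c)
    + scalarCurvature G y / 6 * (G y a c * G y b d - G y a d * G y b c)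

/-- The Levi-Civita permutation symbol `[abcd]`, with `[0123] = 1`. -/
def leviCivitaSymbol (a b c d : Fin 4) : ℝ :=
  Matrix.det (Matrix.of ![Pi.single a 1, Pi.single b 1, Pi.single c 1, Pi.single d 1] : Mat4)

/-- The Hodge star `(∗F)_{ab} = ½ √(det g) [abcd] g^{ce} g^{df} F_{ef}` of a two-form `F` at a
point, for the inner product with matrix `g` and the orientation of the coordinates. -/
def hodgeStar (g F : Mat4) : Mat4 :=
  Matrix.of fun a b => (1 / 2) * ∑ c, ∑ d, Real.sqrt g.det * leviCivitaSymbol a b c d *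
    (∑ e, ∑ f, g⁻¹ c e * g⁻¹ d f * F e f)

/-- The covariant derivative `∇_k J^i_j` of an endomorphism field of the tangent bundle, for the
Levi-Civita connection of `G`. -/
def covDerivEndo (G J : E4 → Mat4) (y : E4) (k i j : Fin 4) : ℝ :=
  pd k (fun z => J z i j) y
    + ∑ l, (christoffel G y i k l * J y l j - christoffel G y l k j * J y i l)

/-- The Lie derivative `(L_X g)_{ij} = X^k ∂_k g_{ij} + g_{kj} ∂_i X^k + g_{ik} ∂_j X^k`. -/
def lieDerivMetric (G : E4 → Mat4) (X : E4 → Fin 4 → ℝ) (y : E4) (i j : Fin 4) : ℝ :=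
  ∑ k, (X y k * pd k (fun z => G z i j) y + G y k j * pd i (fun z => X z k) y
    + G y i k * pd j (fun z => X z k) y)

/-! ### Tensor fields on a four-manifold and their components in a chart -/

section Manifold

variable {M : Type*} [TopologicalSpace M] [ChartedSpace E4 M]

/-- A vector field. -/
abbrev VField (M : Type*) [TopologicalSpace M] [ChartedSpace E4 M] : Type _ :=
  (x : M) → TangentSpace (𝓡 4) x

/-- A field of endomorphisms of the tangent spaces. -/
abbrev EndoField (M : Type*) [TopologicalSpace M] [ChartedSpace E4 M] : Type _ :=
  (x : M) → TangentSpace (𝓡 4) x →L[ℝ] TangentSpace (𝓡 4) x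

/-- A field of bilinear forms on the tangent spaces. -/
abbrev BilinField (M : Type*) [TopologicalSpace M] [ChartedSpace E4 M] : Type _ :=
  (x : M) → TangentSpace (𝓡 4) x →L[ℝ] TangentSpace (𝓡 4) x →L[ℝ] ℝ

/-- A smooth Riemannian metric. -/
abbrev Metric4 (M : Type*) [TopologicalSpace M] [ChartedSpace E4 M]
    [IsManifold (𝓡 4) ∞ M] : Type _ :=
  Bundle.ContMDiffRiemannianMetric (𝓡 4) ∞ E4 (fun x : M => TangentSpace (𝓡 4) x)

/-- The `i`-th coordinate vector field `∂_i` of the chart `e`, at the point with coordinates `y`. -/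
def coordFrame (e : OpenPartialHomeomorph M E4) (y : E4) (i : Fin 4) :
    TangentSpace (𝓡 4) (e.symm y) :=
  mfderiv (𝓡 4) (𝓡 4) e.symm y (EuclideanSpace.single i (1 : ℝ) : E4)

/-- The `i`-th component, in the chart `e`, of a tangent vector at the point with
coordinates `y`. -/
def coordComp (e : OpenPartialHomeomorph M E4) (y : E4) (v : TangentSpace (𝓡 4) (e.symm y))
    (i : Fin 4) : ℝ :=
  (show E4 from mfderiv (𝓡 4) (𝓡 4) e (e.symm y) v) i

/-- The components `h_{ij} = h(∂_i, ∂_j)` in the chart `e`. -/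
def bilinComp (h : BilinField M) (e : OpenPartialHomeomorph M E4) (y : E4) : Mat4 :=
  Matrix.of fun i j => h (e.symm y) (coordFrame e y i) (coordFrame e y j)

/-- The components `X^i` in the chart `e`. -/
def vecComp (X : VField M) (e : OpenPartialHomeomorph M E4) (y : E4) (i : Fin 4) : ℝ :=
  coordComp e y (X (e.symm y)) i

/-- The components `J^i_j`, where `J ∂_j = J^i_j ∂_i`, in the chart `e`. -/
def endoComp (J : EndoField M) (e : OpenPartialHomeomorph M E4) (y : E4) : Mat4 :=
  Matrix.of fun i j => coordComp e y (J (e.symm y) (coordFrame e y j)) i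

/-- The coordinate domain of the part of the chart `e` that lies over `U`. -/
def chartDomain (e : OpenPartialHomeomorph M E4) (U : Set M) : Set E4 :=
  e.target ∩ e.symm ⁻¹' U

variable (M) in
/-- The atlas of `M` is oriented: all changes of charts have positive Jacobian determinant.
An oriented manifold is a manifold with an oriented atlas; its orientation is the one of the
coordinates of any chart in the atlas. -/
def IsOrientedAtlas : Prop :=
  ∀ e ∈ atlas E4 M, ∀ e' ∈ atlas E4 M, ∀ y ∈ (e.symm.trans e').source,
    0 < (fderiv ℝ (e.symm.trans e') y).det

/-- `h` is an Einstein metric with cosmological constant `Λ`, in the normalization `R = 24 Λ` of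
the scalar curvature: the trace-free Ricci tensor vanishes, so `R_{ij} = (R / 4) h_{ij}`. -/
def IsEinstein (h : BilinField M) (Λ : ℝ) : Prop :=
  ∀ e ∈ atlas E4 M, ∀ y ∈ e.target, ∀ i j,
    ricci (bilinComp h e) y i j = 6 * Λ * bilinComp h e y i j

/-- `h` is anti-self-dual: the self-dual part of its Weyl tensor vanishes, that is, the two-forms
`C_{··cd}` satisfy `∗ C_{··cd} = - C_{··cd}`, with respect to the orientation of the atlas. -/
def IsAntiSelfDual (h : BilinField M) : Prop :=
  ∀ e ∈ atlas E4 M, ∀ y ∈ e.target, ∀ c d,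
    hodgeStar (bilinComp h e y) (Matrix.of fun a b => weyl (bilinComp h e) y a b c d)
      = - (Matrix.of fun a b => weyl (bilinComp h e) y a b c d)

/-- `X` is a (smooth) Killing vector field of `h` on the open set `U`. -/
def IsKillingOn [IsManifold (𝓡 4) ∞ M] (h : BilinField M) (X : VField M) (U : Set M) : Prop :=
  ContMDiffOn (𝓡 4) (𝓡 4).tangent ∞ (fun x => (⟨x, X x⟩ : TangentBundle (𝓡 4) M)) U ∧
  ∀ e ∈ atlas E4 M, ∀ y ∈ chartDomain e U, ∀ i j,
    lieDerivMetric (bilinComp h e) (vecComp X e) y i j = 0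

/-- `h` admits a Killing vector field on `U` (one that is not identically zero there). -/
def AdmitsKilling [IsManifold (𝓡 4) ∞ M] (h : BilinField M) (U : Set M) : Prop :=
  ∃ X : VField M, IsKillingOn h X U ∧ ∃ x ∈ U, X x ≠ 0

/-- On the open set `U`, the metric `h` is Kähler with complex structure `J`: the smooth almost
complex structure `J` is `h`-orthogonal and parallel for the Levi-Civita connection of `h`.
The orientation of the atlas is the one induced by the Kähler form `Σ = h(J·, ·)`
(equivalently, `Σ` is self-dual). -/
structure IsKahlerOn (h : BilinField M) (J : EndoField M) (U : Set M) : Prop where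
  smooth : ∀ e ∈ atlas E4 M, ∀ i j, ContDiffOn ℝ ∞ (fun y => endoComp J e y i j) (chartDomain e U)
  square : ∀ x ∈ U, ∀ v, J x (J x v) = -v
  orthogonal : ∀ x ∈ U, ∀ v w, h x (J x v) (J x w) = h x v w
  parallel : ∀ e ∈ atlas E4 M, ∀ y ∈ chartDomain e U, ∀ k i j,
    covDerivEndo (bilinComp h e) (endoComp J e) y k i j = 0
  selfDual : ∀ e ∈ atlas E4 M, ∀ y ∈ chartDomain e U,
    hodgeStar (bilinComp h e y) (bilinComp (fun x => (h x).comp (J x)) e y)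
      = bilinComp (fun x => (h x).comp (J x)) e y

/-- On the open set `U`, the metric `h` is conformal to a Kähler metric: for some smooth positive
function `Ω` on `U`, the metric `Ω² h` is Kähler. -/
def IsConformalToKahlerOn (h : BilinField M) (U : Set M) : Prop :=
  ∃ (Ω : M → ℝ) (J : EndoField M), ContMDiffOn (𝓡 4) 𝓘(ℝ, ℝ) ∞ Ω U ∧ (∀ x ∈ U, 0 < Ω x) ∧
    IsKahlerOn (fun x => (Ω x) ^ 2 • h x) J U

end Manifold

end ConfKahler

end

open scoped Manifold ContDiff

noncomputable section

namespace ConfKahler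

open Matrix

/-! Both directions go through one object: a self-dual endomorphism field Φ whose derivative is `∇_k
Φ = c (e_k ∧ X)⁺` for a vector field X and a constant c (the twistor equation).

From Killing to Kähler. For a Killing field X, the second derivative `∇_k ∇X` is the curvature
`R(e_k, X)` (`cov_nablaV_of_killing`). If g is anti-self-dual and Einstein, the self-dual part of
`R_kl` is `2Λ (e_k ∧ e_l)⁺` (`sdPart_curvM`), so Φ = (∇X)⁺ satisfies the twistor equation with c =
2Λ. Being self-dual, Φ satisfies Φ² = -s with s ≥ 0. Where s > 0, put ρ = s^(-1/2) and J = ρΦ, so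
that J² = -1. Passing from g to ρ²g changes `∇_k J` by the commutator of `e_k ∧ grad log ρ` with J.
By `wedge_commutator` and `sd_wedge_identity` this commutator is again a self-dual wedge plus a
multiple of J. Differentiating s gives grad log ρ = -Λρ²ΦX, and all terms cancel
(`kahler_of_killing`). The set where s ≠ 0 is dense: on an open set where Φ = 0, the twistor
equation and Λ ≠ 0 force X = 0 (`killing_eq_zero_of_sdNabla`), and a Killing field that vanishes on
a nonempty open subset of a connected open set vanishes throughout it (`IsKillingOn.eq_zero`).

From Kähler to Killing. If J is parallel for ρ²g, the same conformal formula shows that Φ = J/ρ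
satisfies the twistor equation with c = 2 and X = ρ⁻¹ J grad log ρ (`cov_inv_smul`). Differentiating
once more and skew-symmetrizing brings in the commutator of the curvature with Φ. The anti-self-dual
Weyl part commutes with Φ, and only `2Λ [e_k ∧ e_l, Φ]` remains (`sdPart_wedge_nablaV`). This is a
linear condition on ∇X; it forces ∇X to be skew, so X is Killing, and it excludes ∇X = 0 when Λ ≠ 0
and Φ ≠ 0 (`skew_of_sdPart_wedge`).

The computations are done with matrices in one chart. Pointwise identities are verified in an
oriented orthonormal frame (`exists_frame`). The passage to the manifold needs (∇X)⁺ to be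
independent of the chart (`sdNabla_trans`). -/

/-! ### Linear algebra of the Hodge star on two-forms and on endomorphisms -/

/-- The dual `½ [abcd] N^{cd}` of a bivector. -/
def dualForm (N : Mat4) : Mat4 :=
  !![0, (N 2 3 - N 3 2) / 2, (N 3 1 - N 1 3) / 2, (N 1 2 - N 2 1) / 2;
    -((N 2 3 - N 3 2) / 2), 0, (N 0 3 - N 3 0) / 2, (N 2 0 - N 0 2) / 2;
    -((N 3 1 - N 1 3) / 2), -((N 0 3 - N 3 0) / 2), 0, (N 0 1 - N 1 0) / 2;
    -((N 1 2 - N 2 1) / 2), -((N 2 0 - N 0 2) / 2), -((N 0 1 - N 1 0) / 2), 0]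

/-- The sign of a permutation of 0, 1, 2, 3 is a normalized Vandermonde product; its value at the
identity is 1·2·3·1·2·1 = 12. -/
theorem leviCivitaSymbol_eq (a b c d : Fin 4) :
    leviCivitaSymbol a b c d =
      ((b : ℝ) - a) * (c - a) * (d - a) * (c - b) * (d - b) * (d - c) / 12 := by
  unfold leviCivitaSymbol
  rw [det_succ_row_zero]
  simp only [Fin.sum_univ_four, det_fin_three, submatrix_apply, of_apply, cons_val',
    cons_val_zero, cons_val_one, Fin.succ_zero_eq_one]
  fin_cases a <;> fin_cases b <;> simp [Fin.succAbove, Pi.single_apply] <;> fin_cases c <;>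
    fin_cases d <;> simp <;> norm_num

theorem dualForm_apply (N : Mat4) (a b : Fin 4) :
    dualForm N a b = (1 / 2) * ∑ c, ∑ d, leviCivitaSymbol a b c d * N c d := by
  simp only [leviCivitaSymbol_eq, Fin.sum_univ_four, dualForm]
  fin_cases a <;> fin_cases b <;> simp <;> ring

theorem hodgeStar_eq (g F : Mat4) :
    hodgeStar g F = Real.sqrt g.det • dualForm (g⁻¹ * F * (g⁻¹)ᵀ) := by
  ext a b
  simp only [hodgeStar, of_apply, Matrix.smul_apply, dualForm_apply, smul_eq_mul, Finset.mul_sum]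
  refine Finset.sum_congr rfl fun c _ => Finset.sum_congr rfl fun d _ => ?_
  have : ∑ e, ∑ f, g⁻¹ c e * g⁻¹ d f * F e f = (g⁻¹ * F * (g⁻¹)ᵀ) c d := by
    simp only [mul_apply, transpose_apply, Finset.sum_mul]
    rw [Finset.sum_comm]
    exact Finset.sum_congr rfl fun _ _ => Finset.sum_congr rfl fun _ _ => by ring
  rw [← this]
  simp only [Finset.mul_sum]
  exact Finset.sum_congr rfl fun _ _ => Finset.sum_congr rfl fun _ _ => by ring

theorem dualForm_add (M N : Mat4) : dualForm (M + N) = dualForm M + dualForm N := by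
  ext a b
  simp [dualForm_apply, mul_add, Finset.sum_add_distrib]

theorem dualForm_smul (r : ℝ) (N : Mat4) : dualForm (r • N) = r • dualForm N := by
  ext a b
  simp only [dualForm_apply, Matrix.smul_apply, smul_eq_mul, Finset.mul_sum]
  exact Finset.sum_congr rfl fun _ _ => Finset.sum_congr rfl fun _ _ => by ring

theorem dualForm_sub (M N : Mat4) : dualForm (M - N) = dualForm M - dualForm N := by
  rw [sub_eq_add_neg, dualForm_add, ← neg_one_smul ℝ N, dualForm_smul, neg_one_smul,
    ← sub_eq_add_neg]

theorem dualForm_transpose (N : Mat4) : (dualForm N)ᵀ = -dualForm N := by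
  ext a b
  fin_cases a <;> fin_cases b <;> simp [dualForm]

-- The permutation symbol is a tensor density: contracting its four indices with A multiplies it by
-- det A. This is the only determinant expansion behind the covariance of the Hodge star.
set_option maxHeartbeats 2000000 in
theorem dualForm_conj (A N : Mat4) : Aᵀ * dualForm (A * N * Aᵀ) * A = A.det • dualForm N := by
  have key : ∀ p q : Fin 4 → ℝ, ∀ N : Mat4, p ⬝ᵥ (dualForm N *ᵥ q) = 
    ((p 0 * q 1 - p 1 * q 0) * (N 2 3 - N 3 2) + (p 0 * q 2 - p 2 * q 0) * (N 3 1 - N 1 3)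
     + (p 0 * q 3 - p 3 * q 0) * (N 1 2 - N 2 1)+ (p 1 * q 2 - p 2 * q 1) * (N 0 3 - N 3 0)
     + (p 1 * q 3 - p 3 * q 1) * (N 2 0 - N 0 2) + (p 2 * q 3 - p 3 * q 2) * (N 0 1 - N 1 0)) / 2 := by
    intro p q N
    simp [dualForm, dotProduct, mulVec, Fin.sum_univ_four]
    ring
  ext a b
  have h : (Aᵀ * dualForm (A * N * Aᵀ) * A) a b = (fun i => A i a) ⬝ᵥ (dualForm (A * N * Aᵀ) *ᵥ (fun i => A i b)) := by
    simp only [mul_apply, transpose_apply, dotProduct, mulVec, Finset.sum_mul, Finset.mul_sum]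
    rw [Finset.sum_comm]
    exact Finset.sum_congr rfl fun _ _ => Finset.sum_congr rfl fun _ _ => by ring
  have hN : ∀ i j, (A * N * Aᵀ) i j - (A * N * Aᵀ) j i = 
     (A i 0 * A j 1 - A j 0 * A i 1) * (N 0 1 - N 1 0) + (A i 0 * A j 2 - A j 0 * A i 2) * (N 0 2 - N 2 0)
     + (A i 0 * A j 3 - A j 0 * A i 3) * (N 0 3 - N 3 0)+ (A i 1 * A j 2 - A j 1 * A i 2) * (N 1 2 - N 2 1)
     + (A i 1 * A j 3 - A j 1 * A i 3) * (N 1 3 - N 3 1) + (A i 2 * A j 3 - A j 2 * A i 3) * (N 2 3 - N 3 2) := by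
    intro i j
    simp only [mul_apply, transpose_apply, Fin.sum_univ_four]
    ring
  rw [h, key]
  simp only [hN, Matrix.smul_apply, smul_eq_mul]
  rw [det_succ_row_zero]
  simp only [Fin.sum_univ_four, det_fin_three, submatrix_apply]
  fin_cases a <;> fin_cases b <;> simp [dualForm, Fin.succAbove] <;> ring

/-- The Hodge star acting on endomorphisms, by lowering and raising the first index. -/
def hodgeEndo (G T : Mat4) : Mat4 := G⁻¹ * hodgeStar G (G * T)

/-- The self-dual part of an endomorphism. -/
def sdPart (G T : Mat4) : Mat4 := (1 / 2 : ℝ) • (T + hodgeEndo G T)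

/-- The endomorphism `a ⊗ b♭ - b ⊗ a♭`. -/
def wedge (G : Mat4) (a b : Fin 4 → ℝ) : Mat4 := vecMulVec a (G *ᵥ b) - vecMulVec b (G *ᵥ a)

section
variable {G : Mat4}

theorem isUnit_det_of_posDef (hG : G.PosDef) : IsUnit G.det := hG.det_pos.ne'.isUnit

theorem transpose_eq_of_posDef (hG : G.PosDef) : Gᵀ = G := by
  simpa using hG.isHermitian.eq

theorem transpose_inv_of_posDef (hG : G.PosDef) : (G⁻¹)ᵀ = G⁻¹ := by
  rw [transpose_nonsing_inv, transpose_eq_of_posDef hG]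

theorem hodgeEndo_eq (hG : G.PosDef) (T : Mat4) :
    hodgeEndo G T = Real.sqrt G.det • (G⁻¹ * dualForm (T * G⁻¹)) := by
  rw [hodgeEndo, hodgeStar_eq, transpose_inv_of_posDef hG,
    nonsing_inv_mul_cancel_left _ _ (isUnit_det_of_posDef hG), Matrix.mul_smul]

theorem mul_hodgeEndo (hG : G.PosDef) (T : Mat4) :
    G * hodgeEndo G T = hodgeStar G (G * T) := by
  rw [hodgeEndo, mul_nonsing_inv_cancel_left _ _ (isUnit_det_of_posDef hG)]

theorem hodgeEndo_one (T : Mat4) : hodgeEndo 1 T = dualForm T := by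
  rw [hodgeEndo_eq Matrix.PosDef.one]
  simp

theorem hodgeStar_add (g A B : Mat4) : hodgeStar g (A + B) = hodgeStar g A + hodgeStar g B := by
  simp only [hodgeStar_eq, mul_add, add_mul, dualForm_add, smul_add]

theorem hodgeStar_smul (g : Mat4) (r : ℝ) (A : Mat4) :
    hodgeStar g (r • A) = r • hodgeStar g A := by
  simp only [hodgeStar_eq, Matrix.mul_smul, Matrix.smul_mul, dualForm_smul]
  rw [smul_comm]

theorem hodgeEndo_add (g A B : Mat4) : hodgeEndo g (A + B) = hodgeEndo g A + hodgeEndo g B := by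
  simp only [hodgeEndo, mul_add, hodgeStar_add]

theorem hodgeEndo_smul (g : Mat4) (r : ℝ) (A : Mat4) :
    hodgeEndo g (r • A) = r • hodgeEndo g A := by
  simp only [hodgeEndo, Matrix.mul_smul, hodgeStar_smul]

theorem hodgeEndo_neg (g A : Mat4) : hodgeEndo g (-A) = -hodgeEndo g A := by
  simpa using hodgeEndo_smul g (-1) A

theorem hodgeEndo_sub (g A B : Mat4) : hodgeEndo g (A - B) = hodgeEndo g A - hodgeEndo g B := by
  simp only [sub_eq_add_neg, hodgeEndo_add, hodgeEndo_neg]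

theorem sdPart_add (g A B : Mat4) : sdPart g (A + B) = sdPart g A + sdPart g B := by
  simp only [sdPart, hodgeEndo_add]
  module

theorem sdPart_smul (g : Mat4) (r : ℝ) (A : Mat4) : sdPart g (r • A) = r • sdPart g A := by
  simp only [sdPart, hodgeEndo_smul]
  module

theorem sdPart_sub (g A B : Mat4) : sdPart g (A - B) = sdPart g A - sdPart g B := by
  simp only [sdPart, hodgeEndo_sub]
  module

theorem sdPart_sum {ι : Type*} (g : Mat4) (s : Finset ι) (A : ι → Mat4) :
    sdPart g (∑ i ∈ s, A i) = ∑ i ∈ s, sdPart g (A i) :=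
  map_sum (AddMonoidHom.mk' (sdPart g) (sdPart_add g)) A s

theorem hodgeStar_transpose (g F : Mat4) : (hodgeStar g F)ᵀ = -hodgeStar g F := by
  rw [hodgeStar_eq, transpose_smul, dualForm_transpose, smul_neg]

/-- The Hodge star commutes with orientation-preserving changes of basis. -/
theorem hodgeStar_conj (g F P : Mat4) (hP : 0 < P.det) :
    hodgeStar (Pᵀ * g * P) (Pᵀ * F * P) = Pᵀ * hodgeStar g F * P := by
  have hu : IsUnit P.det := hP.ne'.isUnit
  have hu' : IsUnit Pᵀ.det := by rwa [det_transpose]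
  -- The volume density acquires the factor det P, which cancels the factor (det P)⁻¹ from
  -- `dualForm_conj`. Positivity of det P is what prevents an absolute value here.
  have h1 : Real.sqrt (Pᵀ * g * P).det = P.det * Real.sqrt g.det := by
    rw [det_mul, det_mul, det_transpose, show P.det * g.det * P.det = P.det ^ 2 * g.det by ring,
      Real.sqrt_mul (sq_nonneg _), Real.sqrt_sq hP.le]
  have h2 : (Pᵀ * g * P)⁻¹ * (Pᵀ * F * P) * ((Pᵀ * g * P)⁻¹)ᵀ
      = P⁻¹ * (g⁻¹ * F * (g⁻¹)ᵀ) * (P⁻¹)ᵀ := by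
    have h3 : (Pᵀ)⁻¹ * (Pᵀ * F * P) * ((Pᵀ)⁻¹)ᵀ = F := by
      rw [← transpose_nonsing_inv, transpose_transpose]
      simp only [Matrix.mul_assoc]
      rw [mul_nonsing_inv _ hu, Matrix.mul_one, transpose_nonsing_inv,
        nonsing_inv_mul_cancel_left _ _ hu']
    calc _ = P⁻¹ * (g⁻¹ * ((Pᵀ)⁻¹ * (Pᵀ * F * P) * ((Pᵀ)⁻¹)ᵀ) * (g⁻¹)ᵀ) * (P⁻¹)ᵀ := by
          simp only [Matrix.mul_inv_rev, transpose_mul, Matrix.mul_assoc]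
      _ = _ := by rw [h3]
  have h4 := dualForm_conj P⁻¹ (g⁻¹ * F * (g⁻¹)ᵀ)
  have h5 : dualForm (P⁻¹ * (g⁻¹ * F * (g⁻¹)ᵀ) * (P⁻¹)ᵀ)
      = (P.det)⁻¹ • (Pᵀ * dualForm (g⁻¹ * F * (g⁻¹)ᵀ) * P) := by
    have h6 := congrArg (fun Z => Pᵀ * Z * P) h4
    simp only [Matrix.mul_smul, Matrix.smul_mul] at h6
    rw [det_nonsing_inv, Ring.inverse_eq_inv'] at h6
    rw [← h6]
    generalize dualForm (P⁻¹ * (g⁻¹ * F * (g⁻¹)ᵀ) * (P⁻¹)ᵀ) = Z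
    simp only [Matrix.mul_assoc]
    rw [nonsing_inv_mul _ hu, Matrix.mul_one, ← Matrix.mul_assoc, ← transpose_mul,
      nonsing_inv_mul _ hu, transpose_one, Matrix.one_mul]
  rw [hodgeStar_eq, hodgeStar_eq, h1, h2, h5, smul_smul, Matrix.mul_smul, Matrix.smul_mul]
  congr 1
  field_simp

/-- The Hodge star on two-forms is conformally invariant in dimension four. -/
theorem hodgeStar_smul_metric (g F : Mat4) {r : ℝ} (hr : 0 < r) :
    hodgeStar (r • g) F = hodgeStar g F := by
  by_cases hg : IsUnit g.det
  · have h1 : (r • g)⁻¹ = r⁻¹ • g⁻¹ := by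
      apply inv_eq_left_inv
      rw [Matrix.mul_smul, Matrix.smul_mul, nonsing_inv_mul _ hg, smul_smul,
        mul_inv_cancel₀ hr.ne', one_smul]
    rw [hodgeStar_eq, hodgeStar_eq, h1, det_smul, Fintype.card_fin,
      Real.sqrt_mul (by positivity), show r ^ 4 = (r ^ 2) ^ 2 by ring, Real.sqrt_sq (by positivity),
      transpose_smul, Matrix.mul_smul, Matrix.smul_mul, Matrix.smul_mul, smul_smul, dualForm_smul,
      smul_smul]
    congr 1
    field_simp
  -- For a degenerate matrix both stars vanish, because the volume factor is √0.
  · have h0 : g.det = 0 := by simpa using hg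
    rw [hodgeStar_eq, hodgeStar_eq, det_smul, h0]
    simp

theorem mul_conj_inv (P T : Mat4) (hP : IsUnit P.det) (g : Mat4) :
    Pᵀ * g * P * (P⁻¹ * T * P) = Pᵀ * (g * T) * P := by
  simp only [Matrix.mul_assoc]
  rw [mul_nonsing_inv_cancel_left _ _ hP]

theorem hodgeEndo_conj (g T P : Mat4) (hP : 0 < P.det) :
    hodgeEndo (Pᵀ * g * P) (P⁻¹ * T * P) = P⁻¹ * hodgeEndo g T * P := by
  have hu : IsUnit P.det := hP.ne'.isUnit
  rw [hodgeEndo, mul_conj_inv _ _ hu, hodgeStar_conj _ _ _ hP, hodgeEndo, Matrix.mul_inv_rev,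
    Matrix.mul_inv_rev]
  simp only [Matrix.mul_assoc]
  rw [nonsing_inv_mul_cancel_left _ _ (by rwa [det_transpose])]

theorem sdPart_conj (g T P : Mat4) (hP : 0 < P.det) :
    sdPart (Pᵀ * g * P) (P⁻¹ * T * P) = P⁻¹ * sdPart g T * P := by
  rw [sdPart, sdPart, hodgeEndo_conj _ _ _ hP]
  simp only [Matrix.mul_smul, Matrix.smul_mul, mul_add, add_mul]

theorem wedge_conj (g P : Mat4) (hP : IsUnit P.det) (a b : Fin 4 → ℝ) :
    wedge (Pᵀ * g * P) (P⁻¹ *ᵥ a) (P⁻¹ *ᵥ b) = P⁻¹ * wedge g a b * P := by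
  have h : ∀ a b, P⁻¹ * vecMulVec a (g *ᵥ b) * P
      = vecMulVec (P⁻¹ *ᵥ a) ((Pᵀ * g * P) *ᵥ (P⁻¹ *ᵥ b)) := by
    intro a b
    rw [mul_vecMulVec, vecMulVec_mul, mulVec_mulVec, Matrix.mul_assoc, mul_nonsing_inv _ hP,
      Matrix.mul_one, ← mulVec_transpose, mulVec_mulVec]
  rw [wedge, wedge, mul_sub, sub_mul, h, h]

-- Factor G = BᵀB, so that B⁻¹ is an orthonormal frame, and reverse one vector if its orientation is
-- negative. Every pointwise identity below can then be checked for G = 1, where self-duality is a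
-- condition on explicit entries.
open scoped MatrixOrder Matrix.Norms.L2Operator in
theorem exists_frame (hG : G.PosDef) : ∃ P : Mat4, Pᵀ * G * P = 1 ∧ 0 < P.det := by
  obtain ⟨B, hB⟩ := CStarAlgebra.nonneg_iff_eq_star_mul_self.mp hG.posSemidef.nonneg
  rw [star_eq_conjTranspose, conjTranspose_eq_transpose_of_trivial] at hB
  have hd := hG.det_pos
  have hBd : IsUnit B.det := by
    rw [hB, det_mul, det_transpose] at hd
    exact (by rintro h; simp [h] at hd : B.det ≠ 0).isUnit
  have hBt : IsUnit Bᵀ.det := by rwa [det_transpose]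
  have h1 : (B⁻¹)ᵀ * G * B⁻¹ = 1 := by
    rw [hB, transpose_nonsing_inv]
    simp only [Matrix.mul_assoc]
    rw [nonsing_inv_mul_cancel_left _ _ hBt, mul_nonsing_inv _ hBd]
  rcases lt_or_ge 0 (B⁻¹).det with h | h
  · exact ⟨B⁻¹, h1, h⟩
  · have hne : (B⁻¹).det ≠ 0 := (isUnit_nonsing_inv_det _ hBd).ne_zero
    refine ⟨B⁻¹ * diagonal ![-1, 1, 1, 1], ?_, ?_⟩
    · have : (B⁻¹ * diagonal ![-1, 1, 1, 1])ᵀ * G * (B⁻¹ * diagonal ![-1, 1, 1, 1])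
          = diagonal ![-1, 1, 1, 1] * ((B⁻¹)ᵀ * G * B⁻¹) * diagonal ![-1, 1, 1, 1] := by
        simp only [transpose_mul, diagonal_transpose, Matrix.mul_assoc]
      rw [this, h1, Matrix.mul_one, diagonal_mul_diagonal, ← diagonal_one]
      congr 1
      ext i
      fin_cases i <;> simp
    · rw [det_mul, det_diagonal]
      have : (∏ i, ![(-1 : ℝ), 1, 1, 1] i) = -1 := by simp [Fin.prod_univ_four]
      rw [this]
      linarith [lt_of_le_of_ne h hne]

end

/-! ### Algebra of self-dual and anti-self-dual endomorphisms, in an oriented orthonormal frame -/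

theorem conj_injective {P A B : Mat4} (hP : IsUnit P.det) (h : P⁻¹ * A * P = P⁻¹ * B * P) :
    A = B := by
  have := congrArg (fun Z => P * Z * P⁻¹) h
  simpa only [Matrix.mul_assoc, mul_nonsing_inv_cancel_left _ _ hP, mul_nonsing_inv _ hP,
    Matrix.mul_one] using this

theorem inv_mulVec_mulVec {P : Mat4} (hP : IsUnit P.det) (T : Mat4) (v : Fin 4 → ℝ) :
    P⁻¹ *ᵥ (T *ᵥ v) = (P⁻¹ * T * P) *ᵥ (P⁻¹ *ᵥ v) := by
  rw [mulVec_mulVec, mulVec_mulVec, Matrix.mul_assoc, mul_nonsing_inv _ hP, Matrix.mul_one]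

theorem conj_mul {P : Mat4} (hP : IsUnit P.det) (S T : Mat4) :
    P⁻¹ * (S * T) * P = (P⁻¹ * S * P) * (P⁻¹ * T * P) := by
  simp only [Matrix.mul_assoc, mul_nonsing_inv_cancel_left _ _ hP]

theorem dotProduct_conj {G P : Mat4} (hP : IsUnit P.det) (h : Pᵀ * G * P = 1) (a b : Fin 4 → ℝ) :
    a ⬝ᵥ G *ᵥ b = (P⁻¹ *ᵥ a) ⬝ᵥ (P⁻¹ *ᵥ b) := by
  have h1 : ∀ v, P *ᵥ (P⁻¹ *ᵥ v) = v := fun v => by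
    rw [mulVec_mulVec, mul_nonsing_inv _ hP, one_mulVec]
  conv_lhs => rw [← h1 a, ← h1 b]
  generalize P⁻¹ *ᵥ a = a'
  generalize P⁻¹ *ᵥ b = b'
  rw [mulVec_mulVec, ← vecMul_transpose, ← dotProduct_mulVec, mulVec_mulVec, ← Matrix.mul_assoc, h,
    one_mulVec]

theorem wedge_one_apply (a b : Fin 4 → ℝ) (i j : Fin 4) :
    wedge 1 a b i j = a i * b j - b i * a j := by
  simp [wedge, vecMulVec_apply]

/-- Three coordinates on the self-dual two-forms. In them J is an imaginary quaternion, which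
accounts for the algebra of `sd_mul_self` and `sd_asd_commute`. -/
theorem dualForm_eq_self {J : Mat4} (h : dualForm J = J) :
    ∃ p q r : ℝ, J = !![0, p, q, r; -p, 0, r, -q; -q, -r, 0, p; -r, q, -p, 0] := by
  refine ⟨J 0 1, J 0 2, J 0 3, ?_⟩
  have e := fun i j => congrFun (congrFun h i) j
  have h0 := e 0 0
  have h1 := e 0 1
  have h2 := e 0 2
  have h3 := e 0 3
  have h4 := e 1 0
  have h5 := e 1 1
  have h6 := e 1 2
  have h7 := e 1 3
  have h8 := e 2 0
  have h9 := e 2 1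
  have h10 := e 2 2
  have h11 := e 2 3
  have h12 := e 3 0
  have h13 := e 3 1
  have h14 := e 3 2
  have h15 := e 3 3
  simp [dualForm] at h0 h1 h2 h3 h4 h5 h6 h7 h8 h9 h10 h11 h12 h13 h14 h15
  ext i j
  fin_cases i <;> fin_cases j <;> simp <;> linarith

theorem dualForm_eq_neg_self {J : Mat4} (h : dualForm J = -J) :
    ∃ p q r : ℝ, J = !![0, p, q, r; -p, 0, -r, q; -q, r, 0, -p; -r, -q, p, 0] := by
  refine ⟨J 0 1, J 0 2, J 0 3, ?_⟩
  have e := fun i j => congrFun (congrFun h i) j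
  have h0 := e 0 0
  have h1 := e 0 1
  have h2 := e 0 2
  have h3 := e 0 3
  have h4 := e 1 0
  have h5 := e 1 1
  have h6 := e 1 2
  have h7 := e 1 3
  have h8 := e 2 0
  have h9 := e 2 1
  have h10 := e 2 2
  have h11 := e 2 3
  have h12 := e 3 0
  have h13 := e 3 1
  have h14 := e 3 2
  have h15 := e 3 3
  simp [dualForm] at h0 h1 h2 h3 h4 h5 h6 h7 h8 h9 h10 h11 h12 h13 h14 h15
  ext i j
  fin_cases i <;> fin_cases j <;> simp <;> linarith

-- Equivalent to ∗(a ∧ Jv) = Ja ∧ v - ⟨a, v⟩ J. The right-hand side below is, up to sign, the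
-- commutator of a ∧ v with J (`wedge_commutator`). With v = grad log ρ, the effect of a conformal
-- change on ∇J thus becomes a self-dual wedge plus a multiple of J, and both directions of the
-- theorem rest on this.
set_option maxHeartbeats 1000000 in
theorem sd_wedge_identity {G J : Mat4} (hG : G.PosDef) (hJ : hodgeEndo G J = J)
    (a v : Fin 4 → ℝ) :
    (2 : ℝ) • sdPart G (wedge G a (J *ᵥ v)) + (a ⬝ᵥ G *ᵥ v) • J
      = wedge G a (J *ᵥ v) + wedge G (J *ᵥ a) v := by
  obtain ⟨P, hP, hd⟩ := exists_frame hG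
  have hu : IsUnit P.det := hd.ne'.isUnit
  apply conj_injective hu
  have hJ' := hodgeEndo_conj G J P hd
  rw [hJ, hP, hodgeEndo_one] at hJ'
  simp only [mul_add, add_mul, Matrix.mul_smul, Matrix.smul_mul, ← sdPart_conj _ _ _ hd,
    ← wedge_conj _ _ hu, hP, inv_mulVec_mulVec hu J, dotProduct_conj hu hP]
  generalize P⁻¹ * J * P = J' at *
  generalize P⁻¹ *ᵥ a = a
  generalize P⁻¹ *ᵥ v = v
  obtain ⟨p, q, r, rfl⟩ := dualForm_eq_self hJ'
  ext i j
  fin_cases i <;> fin_cases j <;>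
    simp [sdPart, hodgeEndo_one, dualForm, wedge_one_apply, dotProduct,
      Fin.sum_univ_four] <;> ring

theorem mul_hodgeEndo_skew {G : Mat4} (hG : G.PosDef) (T : Mat4) :
    (G * hodgeEndo G T)ᵀ = -(G * hodgeEndo G T) := by
  rw [mul_hodgeEndo hG, hodgeStar_transpose]

theorem skew_of_sd {G J : Mat4} (hG : G.PosDef) (hJ : hodgeEndo G J = J) :
    (G * J)ᵀ = -(G * J) := by
  simpa only [hJ] using mul_hodgeEndo_skew hG J

/-- A skew endomorphism acts on bivectors as a derivation: [J, a ∧ b] = Ja ∧ b + a ∧ Jb. -/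
theorem wedge_commutator {G J : Mat4} (hG : G.PosDef) (hJ : (G * J)ᵀ = -(G * J))
    (a b : Fin 4 → ℝ) :
    wedge G a b * J - J * wedge G a b = -(wedge G a (J *ᵥ b) + wedge G (J *ᵥ a) b) := by
  have h : ∀ b, (G *ᵥ b) ᵥ* J = -(G *ᵥ (J *ᵥ b)) := by
    intro b
    rw [← mulVec_transpose, mulVec_mulVec, mulVec_mulVec, ← neg_mulVec, ← hJ, transpose_mul,
      transpose_eq_of_posDef hG]
  simp only [wedge, sub_mul, mul_sub, vecMulVec_mul, mul_vecMulVec, h, vecMulVec_neg]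
  abel

/-- so(4) is the direct sum of two commuting copies of so(3). Through this the anti-self-dual Weyl
tensor disappears from the Ricci identity for self-dual endomorphisms. -/
theorem sd_asd_commute {G J W : Mat4} (hG : G.PosDef) (hJ : hodgeEndo G J = J)
    (hW : hodgeEndo G W = -W) : W * J = J * W := by
  obtain ⟨P, hP, hd⟩ := exists_frame hG
  have hu : IsUnit P.det := hd.ne'.isUnit
  apply conj_injective hu
  have hJ' := hodgeEndo_conj G J P hd
  have hW' := hodgeEndo_conj G W P hd
  rw [hJ, hP, hodgeEndo_one] at hJ'
  rw [hW, hP, hodgeEndo_one, Matrix.mul_neg, Matrix.neg_mul] at hW'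
  rw [conj_mul hu, conj_mul hu]
  obtain ⟨p, q, r, h⟩ := dualForm_eq_self hJ'
  obtain ⟨p', q', r', h'⟩ := dualForm_eq_neg_self hW'
  rw [h, h']
  ext i j
  fin_cases i <;> fin_cases j <;> simp [mul_apply, Fin.sum_univ_four] <;> ring

/-- A self-dual endomorphism squares to a nonpositive multiple of the identity. -/
theorem sd_mul_self {G J : Mat4} (hG : G.PosDef) (hJ : hodgeEndo G J = J) :
    ∃ s : ℝ, 0 ≤ s ∧ J * J = -s • (1 : Mat4) ∧ (s = 0 → J = 0) := by
  obtain ⟨P, hP, hd⟩ := exists_frame hG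
  have hu : IsUnit P.det := hd.ne'.isUnit
  have hJ' := hodgeEndo_conj G J P hd
  rw [hJ, hP, hodgeEndo_one] at hJ'
  obtain ⟨p, q, r, h⟩ := dualForm_eq_self hJ'
  refine ⟨p ^ 2 + q ^ 2 + r ^ 2, by positivity, ?_, fun hs => ?_⟩
  · apply conj_injective hu
    rw [conj_mul hu, Matrix.mul_smul, Matrix.smul_mul, Matrix.mul_one, nonsing_inv_mul _ hu, h]
    ext i j
    fin_cases i <;> fin_cases j <;> simp [mul_apply, Fin.sum_univ_four] <;> ring
  · have hp : p = 0 := by nlinarith [sq_nonneg p, sq_nonneg q, sq_nonneg r]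
    have hq : q = 0 := by nlinarith [sq_nonneg p, sq_nonneg q, sq_nonneg r]
    have hr : r = 0 := by nlinarith [sq_nonneg p, sq_nonneg q, sq_nonneg r]
    apply conj_injective hu
    rw [h, hp, hq, hr]
    ext i j
    fin_cases i <;> fin_cases j <;> simp

/-- ∗² = 1 on two-forms. Skewness is needed because `dualForm` sees only the skew part of its
argument. -/
theorem hodgeEndo_hodgeEndo {G T : Mat4} (hG : G.PosDef) (hT : (G * T)ᵀ = -(G * T)) :
    hodgeEndo G (hodgeEndo G T) = T := by
  obtain ⟨P, hP, hd⟩ := exists_frame hG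
  have hu : IsUnit P.det := hd.ne'.isUnit
  apply conj_injective hu
  rw [← hodgeEndo_conj _ _ _ hd, ← hodgeEndo_conj _ _ _ hd, hP, hodgeEndo_one, hodgeEndo_one]
  have hT' : (P⁻¹ * T * P)ᵀ = -(P⁻¹ * T * P) := by
    have := mul_conj_inv P T hu G
    rw [hP, Matrix.one_mul] at this
    rw [this, transpose_mul, transpose_mul, hT, transpose_transpose]
    simp only [Matrix.neg_mul, Matrix.mul_neg, Matrix.mul_assoc]
  generalize P⁻¹ * T * P = T at *
  have e := fun i j => congrFun (congrFun hT' i) j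
  simp only [transpose_apply] at e
  ext i j
  have e1 := e i j
  have e2 := e i i
  fin_cases i <;> fin_cases j <;> simp [dualForm] at * <;> linarith

theorem hodgeEndo_sdPart {G T : Mat4} (hG : G.PosDef) (hT : (G * T)ᵀ = -(G * T)) :
    hodgeEndo G (sdPart G T) = sdPart G T := by
  rw [sdPart, hodgeEndo_smul, hodgeEndo_add, hodgeEndo_hodgeEndo hG hT, add_comm]

theorem sdPart_of_asd {G J : Mat4} (hJ : hodgeEndo G J = -J) : sdPart G J = 0 := by
  rw [sdPart, hJ]
  module

theorem trace_conj {P : Mat4} (hP : IsUnit P.det) (T : Mat4) : trace (P⁻¹ * T * P) = trace T := by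
  rw [trace_mul_comm, ← Matrix.mul_assoc, mul_nonsing_inv _ hP, Matrix.one_mul]

/-- Self-dual endomorphisms are trace-orthogonal to the anti-self-dual and to the symmetric ones, so
pairing with J already selects the self-dual part of T. -/
theorem trace_mul_sdPart {G J : Mat4} (hG : G.PosDef) (hJ : hodgeEndo G J = J) (T : Mat4) :
    trace (J * sdPart G T) = trace (J * T) := by
  obtain ⟨P, hP, hd⟩ := exists_frame hG
  have hu : IsUnit P.det := hd.ne'.isUnit
  have hJ' := hodgeEndo_conj G J P hd
  rw [hJ, hP, hodgeEndo_one] at hJ'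
  rw [← trace_conj hu, conj_mul hu, ← sdPart_conj _ _ _ hd, hP, ← trace_conj hu (J * T),
    conj_mul hu]
  obtain ⟨p, q, r, h⟩ := dualForm_eq_self hJ'
  rw [h]
  generalize P⁻¹ * T * P = T
  simp only [trace, diag_apply, mul_apply, Fin.sum_univ_four, sdPart, hodgeEndo_one, dualForm]
  simp
  ring

theorem trace_mul_wedge {G J : Mat4} (hG : G.PosDef) (hJ : (G * J)ᵀ = -(G * J))
    (a b : Fin 4 → ℝ) : trace (J * wedge G a b) = -2 * (a ⬝ᵥ G *ᵥ (J *ᵥ b)) := by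
  have h1 : ∀ a b, (J *ᵥ a) ⬝ᵥ G *ᵥ b = -(a ⬝ᵥ G *ᵥ (J *ᵥ b)) := by
    intro a b
    rw [mulVec_mulVec, ← vecMul_transpose, ← dotProduct_mulVec, mulVec_mulVec,
      ← dotProduct_neg, ← neg_mulVec, ← hJ, transpose_mul, transpose_eq_of_posDef hG]
  have h2 : ∀ a b, a ⬝ᵥ G *ᵥ b = b ⬝ᵥ G *ᵥ a := by
    intro a b
    rw [dotProduct_mulVec, ← mulVec_transpose, transpose_eq_of_posDef hG, dotProduct_comm]
  rw [wedge, mul_sub, trace_sub, mul_vecMulVec, mul_vecMulVec, trace_vecMulVec, trace_vecMulVec,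
    h1, h2 (J *ᵥ b)]
  ring

theorem eq_zero_of_sdPart_wedge {G : Mat4} (hG : G.PosDef) {x : Fin 4 → ℝ}
    (h : ∀ a, sdPart G (wedge G a x) = 0) : x = 0 := by
  obtain ⟨P, hP, hd⟩ := exists_frame hG
  have hu : IsUnit P.det := hd.ne'.isUnit
  have h' : ∀ a, sdPart 1 (wedge 1 a (P⁻¹ *ᵥ x)) = 0 := by
    intro a
    have h1 := congrArg (fun Z => P⁻¹ * Z * P) (h (P *ᵥ a))
    simp only [← sdPart_conj _ _ _ hd, ← wedge_conj _ _ hu, hP, mulVec_mulVec,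
      nonsing_inv_mul _ hu, one_mulVec, Matrix.mul_zero, Matrix.zero_mul] at h1
    exact h1
  have h2 : P⁻¹ *ᵥ x = 0 := by
    generalize P⁻¹ *ᵥ x = x at *
    -- Taking a = e₀ recovers x₁, x₂, x₃; taking a = e₁ recovers x₀.
    have e0 := fun j => congrFun (congrFun (h' (Pi.single 0 1)) 0) j
    have e1 := congrFun (congrFun (h' (Pi.single 1 1)) 0) 1
    have e01 := e0 1
    have e02 := e0 2
    have e03 := e0 3
    simp [sdPart, hodgeEndo_one, dualForm, wedge_one_apply] at e01 e02 e03 e1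
    ext i
    fin_cases i <;> simp <;> linarith
  have h3 := congrArg (fun z => P *ᵥ z) h2
  simpa [mulVec_mulVec, mul_nonsing_inv _ hu] using h3

/-- The left-hand side is a linear map from Λ² to Λ⁺ built from D. The trace of D contributes a
scalar on Λ⁺, its trace-free symmetric part a map from Λ⁻ to Λ⁺, and its self-dual part a commutator
on Λ⁺; its anti-self-dual part drops out. The right-hand side is a commutator with Φ, so the
symmetric part of D must vanish and the self-dual part of D must be lΦ. -/
theorem skew_of_sdPart_wedge {G D Φ : Mat4} (hG : G.PosDef) (hΦ : hodgeEndo G Φ = Φ) (l : ℝ)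
    (h : ∀ a b, (2 : ℝ) • sdPart G (wedge G b (D *ᵥ a) - wedge G a (D *ᵥ b))
      = (2 * l) • (wedge G a b * Φ - Φ * wedge G a b)) : 
    (G * D)ᵀ = -(G * D) ∧ (D = 0 → l ≠ 0 → Φ = 0) := by
  obtain ⟨P, hP, hd⟩ := exists_frame hG
  have hu : IsUnit P.det := hd.ne'.isUnit
  have hΦ' := hodgeEndo_conj G Φ P hd
  rw [hΦ, hP, hodgeEndo_one] at hΦ'
  have h' : ∀ a b, (2 : ℝ) • sdPart 1 (wedge 1 b ((P⁻¹ * D * P) *ᵥ a) -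
      wedge 1 a ((P⁻¹ * D * P) *ᵥ b)) = (2 * l) • (wedge 1 a b * (P⁻¹ * Φ * P) -
        (P⁻¹ * Φ * P) * wedge 1 a b) := by
    intro a b
    have h1 := congrArg (fun Z => P⁻¹ * Z * P) (h (P *ᵥ a) (P *ᵥ b))
    simp only [mul_sub, sub_mul, Matrix.mul_smul, Matrix.smul_mul, ← sdPart_conj _ _ _ hd,
      ← wedge_conj _ _ hu, hP, conj_mul hu, inv_mulVec_mulVec hu D] at h1
    simpa only [mulVec_mulVec, nonsing_inv_mul _ hu, Matrix.mul_one, one_mulVec,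
      ← Matrix.mul_assoc] using h1
  obtain ⟨p, q, r, hpqr⟩ := dualForm_eq_self hΦ'
  -- A self-dual matrix is determined by its row 0, so the six coordinate planes and three entries
  -- each give 18 linear equations for the entries of D.
  have hk : ∀ k l j : Fin 4, _ := fun k l j =>
    congrFun (congrFun (h' (Pi.single k 1) (Pi.single l 1)) 0) j
  rw [hpqr] at hk
  have hDe : (P⁻¹ * D * P = 0 → l ≠ 0 → P⁻¹ * Φ * P = 0) ∧ (P⁻¹ * D * P)ᵀ = -(P⁻¹ * D * P) := by
    rw [hpqr]
    generalize P⁻¹ * D * P = D at *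
    have a1 := hk 0 1 1
    have a2 := hk 0 1 2
    have a3 := hk 0 1 3
    have b1 := hk 0 2 1
    have b2 := hk 0 2 2
    have b3 := hk 0 2 3
    have c1 := hk 0 3 1
    have c2 := hk 0 3 2
    have c3 := hk 0 3 3
    have d1 := hk 1 2 1
    have d2 := hk 1 2 2
    have d3 := hk 1 2 3
    have e1 := hk 1 3 1
    have e2 := hk 1 3 2
    have e3 := hk 1 3 3
    have f1 := hk 2 3 1
    have f2 := hk 2 3 2
    have f3 := hk 2 3 3
    clear hk
    simp only [Matrix.smul_apply, Matrix.sub_apply, mul_apply, Fin.sum_univ_four, sdPart,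
      hodgeEndo_one, dualForm, wedge_one_apply] at a1 a2 a3 b1 b2 b3 c1 c2 c3 d1 d2 d3 e1 e2 e3 f1 f2 f3
    simp [wedge_one_apply] at a1 a2 a3 b1 b2 b3 c1 c2 c3 d1 d2 d3 e1 e2 e3 f1 f2 f3
    constructor
    · intro h0 hl
      simp [h0] at a3 a2 b3
      simp [hl] at a3 a2 b3
      simp [a2, a3, b3]
      ext i j
      fin_cases i <;> fin_cases j <;> simp
    · ext i j
      fin_cases i <;> fin_cases j <;> simp <;> linarith
  constructor
  · have h1 := mul_conj_inv P D hu G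
    rw [hP, Matrix.one_mul] at h1
    have h2 := hDe.2
    have hPt : IsUnit Pᵀ.det := by rwa [det_transpose]
    have h3 : G * D = (P⁻¹)ᵀ * (P⁻¹ * D * P) * P⁻¹ := by
      rw [h1, transpose_nonsing_inv]
      simp only [Matrix.mul_assoc]
      rw [nonsing_inv_mul_cancel_left _ _ hPt, mul_nonsing_inv _ hu, Matrix.mul_one]
    rw [h3, transpose_mul, transpose_mul, h2, transpose_transpose]
    simp only [Matrix.neg_mul, Matrix.mul_neg, Matrix.mul_assoc]
  · intro h0 hl
    apply conj_injective hu
    rw [hDe.1 (by simp [h0]) hl]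
    simp

/-! ### Calculus of matrix-valued functions on an open set of coordinates -/

/-- Smooth matrix-valued functions on a set. -/
def SmoothMat (O : Set E4) (T : E4 → Mat4) : Prop := ∀ i j, ContDiffOn ℝ ∞ (fun z => T z i j) O

/-- Smooth vector-valued functions on a set. -/
def SmoothVec (O : Set E4) (X : E4 → Fin 4 → ℝ) : Prop := ∀ i, ContDiffOn ℝ ∞ (fun z => X z i) O

/-- The entrywise partial derivative of a matrix-valued function. -/
def pdM (k : Fin 4) (T : E4 → Mat4) (y : E4) : Mat4 := of fun i j => pd k (fun z => T z i j) y

/-- The entrywise partial derivative of a vector-valued function. -/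
def pdV (k : Fin 4) (X : E4 → Fin 4 → ℝ) (y : E4) : Fin 4 → ℝ := fun i => pd k (fun z => X z i) y

section
variable {O : Set E4} {y : E4} {f h : E4 → ℝ} {S T : E4 → Mat4} {X Y : E4 → Fin 4 → ℝ}

theorem differentiableAt_of_smooth (hO : IsOpen O) (hy : y ∈ O) (hf : ContDiffOn ℝ ∞ f O) :
    DifferentiableAt ℝ f y :=
  (hf.contDiffAt (hO.mem_nhds hy)).differentiableAt (by simp)

theorem pd_congr (hO : IsOpen O) (hy : y ∈ O) (h' : ∀ z ∈ O, f z = h z) (k : Fin 4) :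
    pd k f y = pd k h y := by
  have : f =ᶠ[nhds y] h := Filter.eventually_of_mem (hO.mem_nhds hy) h'
  rw [pd, pd, this.fderiv_eq]

theorem pd_add (hO : IsOpen O) (hy : y ∈ O) (hf : ContDiffOn ℝ ∞ f O) (hh : ContDiffOn ℝ ∞ h O)
    (k : Fin 4) : pd k (fun z => f z + h z) y = pd k f y + pd k h y := by
  rw [pd, fderiv_fun_add (differentiableAt_of_smooth hO hy hf) (differentiableAt_of_smooth hO hy hh)]
  rfl

theorem pd_neg (k : Fin 4) : pd k (fun z => -f z) y = -pd k f y := by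
  rw [pd, fderiv_fun_neg]
  rfl

theorem pd_sub (hO : IsOpen O) (hy : y ∈ O) (hf : ContDiffOn ℝ ∞ f O) (hh : ContDiffOn ℝ ∞ h O)
    (k : Fin 4) : pd k (fun z => f z - h z) y = pd k f y - pd k h y := by
  rw [pd, fderiv_fun_sub (differentiableAt_of_smooth hO hy hf) (differentiableAt_of_smooth hO hy hh)]
  rfl

theorem pd_mul (hO : IsOpen O) (hy : y ∈ O) (hf : ContDiffOn ℝ ∞ f O) (hh : ContDiffOn ℝ ∞ h O)
    (k : Fin 4) : pd k (fun z => f z * h z) y = pd k f y * h y + f y * pd k h y := by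
  rw [pd, fderiv_fun_mul (differentiableAt_of_smooth hO hy hf) (differentiableAt_of_smooth hO hy hh)]
  simp [pd]
  ring

theorem pd_sum {ι : Type*} (s : Finset ι) {f : ι → E4 → ℝ} (hO : IsOpen O) (hy : y ∈ O)
    (hf : ∀ i ∈ s, ContDiffOn ℝ ∞ (f i) O) (k : Fin 4) :
    pd k (fun z => ∑ i ∈ s, f i z) y = ∑ i ∈ s, pd k (f i) y := by
  rw [pd, fderiv_fun_sum fun i hi => differentiableAt_of_smooth hO hy (hf i hi)]
  simp [pd]

theorem pd_const (c : ℝ) (k : Fin 4) : pd k (fun _ => c) y = 0 := by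
  simp [pd]

theorem smooth_pd (hO : IsOpen O) (hf : ContDiffOn ℝ ∞ f O) (k : Fin 4) :
    ContDiffOn ℝ ∞ (pd k f) O :=
  (hf.fderiv_of_isOpen hO (m := ∞) (by simp)).clm_apply contDiffOn_const

theorem pd_comm (hO : IsOpen O) (hy : y ∈ O) (hf : ContDiffOn ℝ ∞ f O) (k l : Fin 4) :
    pd k (pd l f) y = pd l (pd k f) y := by
  have hc := hf.contDiffAt (hO.mem_nhds hy)
  have hs := hc.isSymmSndFDerivAt (by simp; exact WithTop.coe_le_coe.2 (le_top : (2 : ℕ∞) ≤ ⊤))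
  have hd : DifferentiableAt ℝ (fderiv ℝ f) y :=
    ((hf.fderiv_of_isOpen hO (m := ∞) (by simp)).contDiffAt (hO.mem_nhds hy)).differentiableAt
      (by simp)
  have : ∀ k l, pd k (pd l f) y
      = fderiv ℝ (fderiv ℝ f) y (EuclideanSpace.single k 1) (EuclideanSpace.single l 1) := by
    intro k l
    have h1 : pd l f = fun z => fderiv ℝ f z (EuclideanSpace.single l 1) := rfl
    rw [pd, h1, fderiv_clm_apply hd (differentiableAt_const _)]
    simp
  rw [this, this]
  exact hs _ _

theorem SmoothMat.add (hS : SmoothMat O S) (hT : SmoothMat O T) :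
    SmoothMat O (fun z => S z + T z) := fun i j => (hS i j).add (hT i j)

theorem SmoothMat.sub (hS : SmoothMat O S) (hT : SmoothMat O T) :
    SmoothMat O (fun z => S z - T z) := fun i j => (hS i j).sub (hT i j)

theorem SmoothMat.mul (hS : SmoothMat O S) (hT : SmoothMat O T) :
    SmoothMat O (fun z => S z * T z) := fun i j => by
  simp only [mul_apply]
  exact ContDiffOn.sum fun l _ => (hS i l).mul (hT l j)

theorem SmoothMat.smul (hf : ContDiffOn ℝ ∞ f O) (hT : SmoothMat O T) :
    SmoothMat O (fun z => f z • T z) := fun i j => hf.mul (hT i j)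

theorem SmoothMat.transpose (hT : SmoothMat O T) : SmoothMat O (fun z => (T z)ᵀ) :=
  fun i j => hT j i

theorem SmoothMat.pdM (hO : IsOpen O) (hT : SmoothMat O T) (k : Fin 4) : SmoothMat O (pdM k T) :=
  fun i j => smooth_pd hO (hT i j) k

theorem SmoothVec.pdV (hO : IsOpen O) (hX : SmoothVec O X) (k : Fin 4) : SmoothVec O (pdV k X) :=
  fun i => smooth_pd hO (hX i) k

theorem SmoothMat.mulVec (hT : SmoothMat O T) (hX : SmoothVec O X) :
    SmoothVec O (fun z => T z *ᵥ X z) := fun i => by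
  simp only [Matrix.mulVec, dotProduct]
  exact ContDiffOn.sum fun l _ => (hT i l).mul (hX l)

theorem SmoothVec.add (hX : SmoothVec O X) (hY : SmoothVec O Y) :
    SmoothVec O (fun z => X z + Y z) := fun i => (hX i).add (hY i)

theorem SmoothVec.smul (hf : ContDiffOn ℝ ∞ f O) (hX : SmoothVec O X) :
    SmoothVec O (fun z => f z • X z) := fun i => hf.mul (hX i)

theorem SmoothVec.const (a : Fin 4 → ℝ) : SmoothVec O (fun _ => a) := fun _ => contDiffOn_const

theorem SmoothMat.vecMulVec (hX : SmoothVec O X) (hY : SmoothVec O Y) :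
    SmoothMat O (fun z => vecMulVec (X z) (Y z)) := fun i j => (hX i).mul (hY j)

theorem SmoothMat.det (hT : SmoothMat O T) : ContDiffOn ℝ ∞ (fun z => (T z).det) O := by
  simp only [det_apply]
  exact ContDiffOn.sum fun σ _ => (contDiffOn_prod fun i _ => hT (σ i) i).const_smul _

/-- The inverse is the adjugate divided by the determinant, and the cofactors are themselves
determinants of smooth matrices. -/
theorem SmoothMat.inv (hT : SmoothMat O T) (hd : ∀ z ∈ O, (T z).det ≠ 0) :
    SmoothMat O (fun z => (T z)⁻¹) := by
  intro i j
  have h1 : ∀ z, (T z)⁻¹ i j = (T z).det⁻¹ * (T z).adjugate i j := by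
    intro z
    rw [inv_def, Ring.inverse_eq_inv', Matrix.smul_apply, smul_eq_mul]
  simp only [h1, adjugate_apply]
  refine (hT.det.inv hd).mul (SmoothMat.det (T := fun z => updateRow (T z) j (Pi.single i 1)) ?_)
  intro a b
  by_cases h : a = j
  · subst h
    simp only [updateRow_self]
    exact contDiffOn_const
  · simp only [updateRow_ne h]
    exact hT a b

theorem pdM_congr (hO : IsOpen O) (hy : y ∈ O) (h' : ∀ z ∈ O, S z = T z) (k : Fin 4) :
    pdM k S y = pdM k T y := by
  ext i j
  exact pd_congr hO hy (fun z hz => by rw [h' z hz]) k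

theorem pdV_congr (hO : IsOpen O) (hy : y ∈ O) (h' : ∀ z ∈ O, X z = Y z) (k : Fin 4) :
    pdV k X y = pdV k Y y := by
  ext i
  exact pd_congr hO hy (fun z hz => by rw [h' z hz]) k

theorem pdM_add (hO : IsOpen O) (hy : y ∈ O) (hS : SmoothMat O S) (hT : SmoothMat O T)
    (k : Fin 4) : pdM k (fun z => S z + T z) y = pdM k S y + pdM k T y := by
  ext i j
  exact pd_add hO hy (hS i j) (hT i j) k

theorem pdM_sub (hO : IsOpen O) (hy : y ∈ O) (hS : SmoothMat O S) (hT : SmoothMat O T)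
    (k : Fin 4) : pdM k (fun z => S z - T z) y = pdM k S y - pdM k T y := by
  ext i j
  exact pd_sub hO hy (hS i j) (hT i j) k

theorem pdM_mul (hO : IsOpen O) (hy : y ∈ O) (hS : SmoothMat O S) (hT : SmoothMat O T)
    (k : Fin 4) : pdM k (fun z => S z * T z) y = pdM k S y * T y + S y * pdM k T y := by
  ext i j
  simp only [pdM, Matrix.add_apply, mul_apply, of_apply]
  rw [pd_sum _ hO hy fun l _ => (hS i l).mul (hT l j), ← Finset.sum_add_distrib]
  exact Finset.sum_congr rfl fun l _ => pd_mul hO hy (hS i l) (hT l j) k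

theorem pdM_smul (hO : IsOpen O) (hy : y ∈ O) (hf : ContDiffOn ℝ ∞ f O) (hT : SmoothMat O T)
    (k : Fin 4) : pdM k (fun z => f z • T z) y = pd k f y • T y + f y • pdM k T y := by
  ext i j
  exact pd_mul hO hy hf (hT i j) k

theorem pdM_const (A : Mat4) (k : Fin 4) : pdM k (fun _ => A) y = 0 := by
  ext i j
  exact pd_const _ k

theorem pdM_transpose (k : Fin 4) : pdM k (fun z => (T z)ᵀ) y = (pdM k T y)ᵀ := rfl

theorem pdV_add (hO : IsOpen O) (hy : y ∈ O) (hX : SmoothVec O X) (hY : SmoothVec O Y)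
    (k : Fin 4) : pdV k (fun z => X z + Y z) y = pdV k X y + pdV k Y y := by
  ext i
  exact pd_add hO hy (hX i) (hY i) k

theorem pdV_const (a : Fin 4 → ℝ) (k : Fin 4) : pdV k (fun _ => a) y = 0 := by
  ext i
  exact pd_const _ k

theorem pdV_mulVec (hO : IsOpen O) (hy : y ∈ O) (hT : SmoothMat O T) (hX : SmoothVec O X)
    (k : Fin 4) : pdV k (fun z => T z *ᵥ X z) y = pdM k T y *ᵥ X y + T y *ᵥ pdV k X y := by
  ext i
  simp only [pdV, pdM, mulVec, dotProduct, of_apply, Pi.add_apply]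
  rw [pd_sum _ hO hy fun l _ => (hT i l).mul (hX l), ← Finset.sum_add_distrib]
  exact Finset.sum_congr rfl fun l _ => pd_mul hO hy (hT i l) (hX l) k

theorem pdM_vecMulVec (hO : IsOpen O) (hy : y ∈ O) (hX : SmoothVec O X) (hY : SmoothVec O Y)
    (k : Fin 4) : pdM k (fun z => vecMulVec (X z) (Y z)) y
      = vecMulVec (pdV k X y) (Y y) + vecMulVec (X y) (pdV k Y y) := by
  ext i j
  exact pd_mul hO hy (hX i) (hY j) k

theorem pdM_inv (hO : IsOpen O) (hy : y ∈ O) (hT : SmoothMat O T) (hd : ∀ z ∈ O, (T z).det ≠ 0)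
    (k : Fin 4) : pdM k (fun z => (T z)⁻¹) y = -((T y)⁻¹ * pdM k T y * (T y)⁻¹) := by
  have hu : ∀ z ∈ O, IsUnit (T z).det := fun z hz => (hd z hz).isUnit
  have h1 := pdM_mul hO hy hT (hT.inv hd) k
  rw [pdM_congr hO hy (T := fun _ => 1) (fun z hz => mul_nonsing_inv _ (hu z hz)), pdM_const] at h1
  have h2 := congrArg (fun Z => (T y)⁻¹ * Z) h1
  simp only [Matrix.mul_zero, mul_add, nonsing_inv_mul_cancel_left _ _ (hu y hy)] at h2
  rw [eq_neg_iff_add_eq_zero, add_comm, Matrix.mul_assoc]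
  exact h2.symm

theorem pd_trace (hO : IsOpen O) (hy : y ∈ O) (hT : SmoothMat O T) (k : Fin 4) :
    pd k (fun z => trace (T z)) y = trace (pdM k T y) :=
  pd_sum _ hO hy (fun i _ => hT i i) k

/-- Jacobi's formula. Leibniz's rule replaces one column of T at a time by its derivative, and the
resulting determinants are the diagonal entries of adj(T) ∂T. -/
theorem pd_det (hO : IsOpen O) (hy : y ∈ O) (hT : SmoothMat O T) (k : Fin 4) :
    pd k (fun z => (T z).det) y = trace ((T y).adjugate * pdM k T y) := by
  have h1 : ∀ i, ((T y).adjugate * pdM k T y) i i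
      = (updateCol (T y) i fun r => pdM k T y r i).det := by
    intro i
    rw [← cramer_apply, cramer_eq_adjugate_mulVec]
    rfl
  have h2 : HasFDerivAt (fun z => (T z).det) (∑ σ : Equiv.Perm (Fin 4), Equiv.Perm.sign σ •
      ∑ i, (∏ j ∈ Finset.univ.erase i, T y (σ j) j) • fderiv ℝ (fun z => T z (σ i) i) y) y := by
    simp only [det_apply]
    refine HasFDerivAt.fun_sum fun σ _ => HasFDerivAt.const_smul ?_ _
    exact HasFDerivAt.finsetProd fun i _ =>
      (differentiableAt_of_smooth hO hy (hT (σ i) i)).hasFDerivAt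
  rw [pd, h2.fderiv, trace]
  simp only [diag_apply, h1, det_apply]
  rw [Finset.sum_comm]
  simp only [_root_.sum_apply, _root_.smul_apply, ← Finset.smul_sum]
  refine Finset.sum_congr rfl fun σ _ => ?_
  congr 1
  refine Finset.sum_congr rfl fun i _ => ?_
  rw [← Finset.mul_prod_erase _ _ (Finset.mem_univ i), updateCol_self, smul_eq_mul, mul_comm]
  congr 1
  refine Finset.prod_congr rfl fun j hj => ?_
  rw [updateCol_ne (Finset.ne_of_mem_erase hj)]

end

/-! ### The Levi-Civita connection -/

/-- `G` is the matrix of a smooth Riemannian metric on the open set `O`. -/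
structure IsMetricOn (G : E4 → Mat4) (O : Set E4) : Prop where
  isOpen : IsOpen O
  smooth : SmoothMat O G
  posDef : ∀ z ∈ O, (G z).PosDef

/-- The connection matrix `(Γ_k)^i_j = Γ^i_{kj}`. -/
def gam (G : E4 → Mat4) (k : Fin 4) (y : E4) : Mat4 := of fun i j => christoffel G y i k j

/-- The curvature matrix `(R_{cd})^a_b = R^a_{bcd}`. -/
def curvM (G : E4 → Mat4) (c d : Fin 4) (y : E4) : Mat4 := of fun a b => curvature G y a b c d

/-- The covariant derivative of an endomorphism field. -/
def cov (G : E4 → Mat4) (k : Fin 4) (T : E4 → Mat4) (y : E4) : Mat4 :=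
  pdM k T y + gam G k y * T y - T y * gam G k y

/-- The covariant derivative of a vector field. -/
def covV (G : E4 → Mat4) (k : Fin 4) (X : E4 → Fin 4 → ℝ) (y : E4) : Fin 4 → ℝ :=
  pdV k X y + gam G k y *ᵥ X y

theorem covDerivEndo_eq (G J : E4 → Mat4) (y : E4) (k i j : Fin 4) :
    covDerivEndo G J y k i j = cov G k J y i j := by
  simp only [covDerivEndo, cov, Matrix.sub_apply, Matrix.add_apply, mul_apply, pdM, gam, of_apply,
    Finset.sum_sub_distrib, add_sub_assoc]
  congr 2
  exact Finset.sum_congr rfl fun _ _ => mul_comm _ _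

theorem curvM_eq (G : E4 → Mat4) (c d : Fin 4) (y : E4) :
    curvM G c d y = pdM c (gam G d) y - pdM d (gam G c) y
      + (gam G c y * gam G d y - gam G d y * gam G c y) := by
  ext a b
  simp [curvM, curvature, pdM, gam, mul_apply, Finset.sum_sub_distrib]

section
variable {G : E4 → Mat4} {O : Set E4} {y : E4} {S T : E4 → Mat4} {X : E4 → Fin 4 → ℝ}

theorem IsMetricOn.det_ne_zero (hG : IsMetricOn G O) : ∀ z ∈ O, (G z).det ≠ 0 :=
  fun z hz => (hG.posDef z hz).det_pos.ne'

theorem IsMetricOn.smooth_inv (hG : IsMetricOn G O) : SmoothMat O (fun z => (G z)⁻¹) :=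
  hG.smooth.inv hG.det_ne_zero

theorem IsMetricOn.symm (hG : IsMetricOn G O) {z : E4} (hz : z ∈ O) (i j : Fin 4) :
    G z i j = G z j i :=
  congrFun (congrFun (transpose_eq_of_posDef (hG.posDef z hz)) j) i

theorem IsMetricOn.pd_symm (hG : IsMetricOn G O) (hy : y ∈ O) (k i j : Fin 4) :
    pd k (fun z => G z i j) y = pd k (fun z => G z j i) y :=
  pd_congr hG.isOpen hy (fun _ hz => hG.symm hz i j) k

theorem IsMetricOn.smooth_gam (hG : IsMetricOn G O) (k : Fin 4) : SmoothMat O (gam G k) := by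
  intro i j
  simp only [gam, christoffel, of_apply]
  refine contDiffOn_const.mul (ContDiffOn.sum fun l _ => (hG.smooth_inv i l).mul ?_)
  exact ((smooth_pd hG.isOpen (hG.smooth _ _) _).add
    (smooth_pd hG.isOpen (hG.smooth _ _) _)).sub (smooth_pd hG.isOpen (hG.smooth _ _) _)

theorem gam_symm (hG : IsMetricOn G O) (hy : y ∈ O) (i k j : Fin 4) :
    gam G k y i j = gam G j y i k := by
  simp only [gam, christoffel, of_apply]
  congr 1
  refine Finset.sum_congr rfl fun l _ => ?_
  rw [hG.pd_symm hy l k j]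
  ring

theorem gam_mulVec_single (hG : IsMetricOn G O) (hy : y ∈ O) (k j : Fin 4) :
    gam G k y *ᵥ Pi.single j 1 = gam G j y *ᵥ Pi.single k 1 := by
  ext i
  rw [mulVec_single_one, mulVec_single_one]
  exact gam_symm hG hy i k j

theorem metric_mul_gam (hG : IsMetricOn G O) (hy : y ∈ O) (k i j : Fin 4) :
    (G y * gam G k y) i j = (1 / 2) * (pd k (fun z => G z j i) y + pd j (fun z => G z k i) y
      - pd i (fun z => G z k j) y) := by
  have h1 : gam G k y = (1 / 2 : ℝ) • ((G y)⁻¹ * of fun l j => (pd k (fun z => G z j l) y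
      + pd j (fun z => G z k l) y - pd l (fun z => G z k j) y)) := by
    ext i j
    simp [gam, christoffel, mul_apply]
  rw [h1, Matrix.mul_smul,
    mul_nonsing_inv_cancel_left _ _ (isUnit_det_of_posDef (hG.posDef y hy))]
  rfl

/-- The Levi-Civita connection is metric. -/
theorem pdM_metric (hG : IsMetricOn G O) (hy : y ∈ O) (k : Fin 4) :
    pdM k G y = G y * gam G k y + (gam G k y)ᵀ * G y := by
  have h1 : (gam G k y)ᵀ * G y = (G y * gam G k y)ᵀ := by
    rw [transpose_mul, transpose_eq_of_posDef (hG.posDef y hy)]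
  ext i j
  rw [h1, Matrix.add_apply, transpose_apply, metric_mul_gam hG hy, metric_mul_gam hG hy,
    hG.pd_symm hy k j i, hG.pd_symm hy j k i, hG.pd_symm hy i k j]
  simp only [pdM, of_apply]
  ring

theorem SmoothVec.covV (hG : IsMetricOn G O) (hX : SmoothVec O X) (k : Fin 4) :
    SmoothVec O (covV G k X) :=
  (hX.pdV hG.isOpen k).add ((hG.smooth_gam k).mulVec hX)

theorem cov_congr (hO : IsOpen O) (hy : y ∈ O) (h : ∀ z ∈ O, S z = T z) (k : Fin 4) :
    cov G k S y = cov G k T y := by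
  rw [cov, cov, pdM_congr hO hy h, h y hy]

theorem cov_add (hG : IsMetricOn G O) (hy : y ∈ O) (hS : SmoothMat O S) (hT : SmoothMat O T)
    (k : Fin 4) : cov G k (fun z => S z + T z) y = cov G k S y + cov G k T y := by
  rw [cov, cov, cov, pdM_add hG.isOpen hy hS hT]
  noncomm_ring

theorem cov_sub (hG : IsMetricOn G O) (hy : y ∈ O) (hS : SmoothMat O S) (hT : SmoothMat O T)
    (k : Fin 4) : cov G k (fun z => S z - T z) y = cov G k S y - cov G k T y := by
  rw [cov, cov, cov, pdM_sub hG.isOpen hy hS hT]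
  noncomm_ring

theorem cov_smul (hG : IsMetricOn G O) (hy : y ∈ O) {f : E4 → ℝ} (hf : ContDiffOn ℝ ∞ f O)
    (hT : SmoothMat O T) (k : Fin 4) :
    cov G k (fun z => f z • T z) y = pd k f y • T y + f y • cov G k T y := by
  rw [cov, cov, pdM_smul hG.isOpen hy hf hT, Matrix.mul_smul, Matrix.smul_mul]
  module

theorem cov_mul (hG : IsMetricOn G O) (hy : y ∈ O) (hS : SmoothMat O S) (hT : SmoothMat O T)
    (k : Fin 4) : cov G k (fun z => S z * T z) y = cov G k S y * T y + S y * cov G k T y := by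
  rw [cov, cov, cov, pdM_mul hG.isOpen hy hS hT]
  noncomm_ring

theorem covV_mulVec (hG : IsMetricOn G O) (hy : y ∈ O) (hT : SmoothMat O T) (hX : SmoothVec O X)
    (k : Fin 4) :
    covV G k (fun z => T z *ᵥ X z) y = cov G k T y *ᵥ X y + T y *ᵥ covV G k X y := by
  rw [cov, covV, covV, pdV_mulVec hG.isOpen hy hT hX]
  simp only [sub_mulVec, add_mulVec, mulVec_add, mulVec_mulVec]
  abel

theorem trace_cov (hG : IsMetricOn G O) (hy : y ∈ O) (hT : SmoothMat O T) (k : Fin 4) :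
    pd k (fun z => trace (T z)) y = trace (cov G k T y) := by
  rw [pd_trace hG.isOpen hy hT, cov, trace_sub, trace_add, trace_mul_comm (gam G k y)]
  ring

/-- Leibniz's rule; lowering an index commutes with ∇ because the metric is parallel. -/
theorem cov_wedge (hG : IsMetricOn G O) (hy : y ∈ O) {Y : E4 → Fin 4 → ℝ} (hX : SmoothVec O X)
    (hY : SmoothVec O Y) (k : Fin 4) : cov G k (fun z => wedge (G z) (X z) (Y z)) y
      = wedge (G y) (covV G k X y) (Y y) + wedge (G y) (X y) (covV G k Y y) := by
  have h : ∀ {X Y : E4 → Fin 4 → ℝ}, SmoothVec O X → SmoothVec O Y →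
      cov G k (fun z => vecMulVec (X z) (G z *ᵥ Y z)) y
      = vecMulVec (covV G k X y) (G y *ᵥ Y y) + vecMulVec (X y) (G y *ᵥ covV G k Y y) := by
    intro X Y hX hY
    rw [cov, pdM_vecMulVec hG.isOpen hy hX (hG.smooth.mulVec hY),
      pdV_mulVec hG.isOpen hy hG.smooth hY, pdM_metric hG hy, mul_vecMulVec, vecMulVec_mul, covV,
      covV]
    have : (G y *ᵥ Y y) ᵥ* gam G k y = ((gam G k y)ᵀ * G y) *ᵥ Y y := by
      rw [← mulVec_transpose, mulVec_mulVec]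
    rw [this]
    simp only [add_mulVec, mulVec_add, mulVec_mulVec, vecMulVec_add, add_vecMulVec]
    abel
  simp only [wedge]
  rw [cov_sub hG hy (.vecMulVec hX (hG.smooth.mulVec hY)) (.vecMulVec hY (hG.smooth.mulVec hX)),
    h hX hY, h hY hX]
  abel

/-- The Ricci identity for endomorphism fields. -/
theorem cov_cov_sub (hG : IsMetricOn G O) (hy : y ∈ O) (hT : SmoothMat O T) (k l : Fin 4) :
    cov G k (cov G l T) y - cov G l (cov G k T) y = curvM G k l y * T y - T y * curvM G k l y := by
  have h : ∀ k l, pdM k (cov G l T) y = pdM k (pdM l T) y + (pdM k (gam G l) y * T y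
      + gam G l y * pdM k T y) - (pdM k T y * gam G l y + T y * pdM k (gam G l) y) := by
    intro k l
    have hl := hG.smooth_gam l
    unfold cov
    rw [pdM_sub hG.isOpen hy ((hT.pdM hG.isOpen l).add (hl.mul hT)) (hT.mul hl),
      pdM_add hG.isOpen hy (hT.pdM hG.isOpen l) (hl.mul hT), pdM_mul hG.isOpen hy hl hT,
      pdM_mul hG.isOpen hy hT hl]
  have hc : pdM k (pdM l T) y = pdM l (pdM k T) y := by
    ext i j
    exact pd_comm hG.isOpen hy (hT i j) k l
  have e : ∀ k l, cov G k (cov G l T) y = pdM k (cov G l T) y + gam G k y * cov G l T y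
      - cov G l T y * gam G k y := fun _ _ => rfl
  rw [e, e, h, h, hc, curvM_eq, cov, cov]
  noncomm_ring

/-- The Ricci identity for vector fields. -/
theorem covV_covV_sub (hG : IsMetricOn G O) (hy : y ∈ O) (hX : SmoothVec O X) (k l : Fin 4) :
    covV G k (covV G l X) y - covV G l (covV G k X) y = curvM G k l y *ᵥ X y := by
  have h : ∀ k l, pdV k (covV G l X) y = pdV k (pdV l X) y + (pdM k (gam G l) y *ᵥ X y
      + gam G l y *ᵥ pdV k X y) := by
    intro k l
    have hl := hG.smooth_gam l
    unfold covV
    rw [pdV_add hG.isOpen hy (hX.pdV hG.isOpen l) (hl.mulVec hX), pdV_mulVec hG.isOpen hy hl hX]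
  have hc : pdV k (pdV l X) y = pdV l (pdV k X) y := by
    ext i
    exact pd_comm hG.isOpen hy (hX i) k l
  have e : ∀ k l, covV G k (covV G l X) y = pdV k (covV G l X) y + gam G k y *ᵥ covV G l X y :=
    fun _ _ => rfl
  rw [e, e, h, h, hc, curvM_eq, covV, covV]
  simp only [add_mulVec, sub_mulVec, mulVec_add, mulVec_mulVec]
  abel

/-- The curvature is skew with respect to the metric. -/
theorem curvM_skew (hG : IsMetricOn G O) (hy : y ∈ O) (k l : Fin 4) :
    (G y * curvM G k l y)ᵀ = -(G y * curvM G k l y) := by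
  -- Differentiate ∂G = GΓ + ΓᵀG again; skewness of the curvature is then the symmetry of the second
  -- partial derivatives of G.
  have h : ∀ k l, pdM k (pdM l G) y = (G y * gam G k y + (gam G k y)ᵀ * G y) * gam G l y
      + G y * pdM k (gam G l) y + ((pdM k (gam G l) y)ᵀ * G y
      + (gam G l y)ᵀ * (G y * gam G k y + (gam G k y)ᵀ * G y)) := by
    intro k l
    have hl := hG.smooth_gam l
    rw [pdM_congr hG.isOpen hy (fun z hz => pdM_metric hG hz l),
      pdM_add hG.isOpen hy (hG.smooth.mul hl) (hl.transpose.mul hG.smooth),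
      pdM_mul hG.isOpen hy hG.smooth hl, pdM_mul hG.isOpen hy hl.transpose hG.smooth,
      pdM_transpose, pdM_metric hG hy]
  have hc : pdM k (pdM l G) y = pdM l (pdM k G) y := by
    ext i j
    exact pd_comm hG.isOpen hy (hG.smooth i j) k l
  rw [h, h, ← sub_eq_zero] at hc
  rw [← add_eq_zero_iff_eq_neg, transpose_mul, transpose_eq_of_posDef (hG.posDef y hy), curvM_eq,
    ← hc]
  simp only [transpose_add, transpose_sub, transpose_mul]
  noncomm_ring

/-- The first Bianchi identity. -/
theorem curvM_bianchi (hG : IsMetricOn G O) (hy : y ∈ O) (a b c : Fin 4) :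
    curvM G a b y *ᵥ Pi.single c 1 + curvM G b c y *ᵥ Pi.single a 1
      + curvM G c a y *ᵥ Pi.single b 1 = 0 := by
  have h : ∀ a b c, pdM a (gam G b) y *ᵥ Pi.single c 1 = pdM a (gam G c) y *ᵥ Pi.single b 1 := by
    intro a b c
    ext i
    rw [mulVec_single_one, mulVec_single_one]
    exact pd_congr hG.isOpen hy (fun z hz => gam_symm hG hz i b c) a
  simp only [curvM_eq, add_mulVec, sub_mulVec, ← mulVec_mulVec]
  rw [h a b c, h b a c, h c b a, gam_mulVec_single hG hy b c, gam_mulVec_single hG hy a c,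
    gam_mulVec_single hG hy b a]
  abel

/-! ### The Hodge star is parallel -/

theorem SmoothMat.dualForm (hT : SmoothMat O T) : SmoothMat O (fun z => dualForm (T z)) := by
  intro a b
  simp only [dualForm_apply]
  exact contDiffOn_const.mul (ContDiffOn.sum fun c _ => ContDiffOn.sum fun d _ =>
    contDiffOn_const.mul (hT c d))

theorem pdM_dualForm (hO : IsOpen O) (hy : y ∈ O) (hT : SmoothMat O T) (k : Fin 4) :
    pdM k (fun z => dualForm (T z)) y = dualForm (pdM k T y) := by
  have h : ∀ c d e f, pd k (fun z => (T z c d - T z e f) / 2) y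
      = (pd k (fun z => T z c d) y - pd k (fun z => T z e f) y) / 2 := by
    intro c d e f
    simp only [div_eq_mul_inv]
    rw [pd_mul hO hy ((hT c d).sub (hT e f)) contDiffOn_const, pd_const,
      pd_sub hO hy (hT c d) (hT e f)]
    ring
  have h' : ∀ c d e f, pd k (fun z => -((T z c d - T z e f) / 2)) y
      = -((pd k (fun z => T z c d) y - pd k (fun z => T z e f) y) / 2) := by
    intro c d e f
    rw [pd_neg, h]
  ext a b
  fin_cases a <;> fin_cases b <;> simp [pdM, ConfKahler.dualForm, h, h', pd_const]

/-- The infinitesimal form of `dualForm_conj`. In `cov_hodgeEndo`, its trace term cancels the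
derivative of √det G, and the other terms cancel the connection terms. -/
theorem dualForm_derivation (A N : Mat4) : dualForm (A * N + N * Aᵀ)
    = trace A • dualForm N - Aᵀ * dualForm N - dualForm N * A := by
  ext a b
  simp only [Matrix.sub_apply, Matrix.smul_apply, Matrix.add_apply, mul_apply, transpose_apply,
    Fin.sum_univ_four, trace, diag_apply, ConfKahler.dualForm, smul_eq_mul]
  fin_cases a <;> fin_cases b <;> simp <;> ring

theorem smooth_sqrt_det (hG : IsMetricOn G O) :
    ContDiffOn ℝ ∞ (fun z => Real.sqrt (G z).det) O :=
  hG.smooth.det.sqrt hG.det_ne_zero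

/-- By Jacobi's formula and ∂G = GΓ + ΓᵀG, the derivative of det G is 2 det G · tr Γ. The root is
handled by differentiating its square. -/
theorem pd_sqrt_det (hG : IsMetricOn G O) (hy : y ∈ O) (k : Fin 4) :
    pd k (fun z => Real.sqrt (G z).det) y = Real.sqrt (G y).det * trace (gam G k y) := by
  have hp := (hG.posDef y hy).det_pos
  have hs := Real.sqrt_pos.mpr hp
  have h1 := pd_mul hG.isOpen hy (smooth_sqrt_det hG) (smooth_sqrt_det hG) k
  have ha : trace ((G y).adjugate * (G y * gam G k y)) = (G y).det * trace (gam G k y) := by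
    rw [← Matrix.mul_assoc, adjugate_mul, Matrix.smul_mul, Matrix.one_mul, trace_smul, smul_eq_mul]
  have hb : trace ((G y).adjugate * ((gam G k y)ᵀ * G y)) = (G y).det * trace (gam G k y) := by
    rw [trace_mul_comm, Matrix.mul_assoc, mul_adjugate, Matrix.mul_smul, Matrix.mul_one, trace_smul,
      trace_transpose, smul_eq_mul]
  rw [pd_congr hG.isOpen hy (fun z hz => Real.mul_self_sqrt (hG.posDef z hz).det_pos.le),
    pd_det hG.isOpen hy hG.smooth, pdM_metric hG hy, mul_add, trace_add, ha, hb] at h1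
  have h2 : Real.sqrt (G y).det * (pd k (fun z => Real.sqrt (G z).det) y
      - Real.sqrt (G y).det * trace (gam G k y)) = 0 := by
    have := Real.mul_self_sqrt hp.le
    linear_combination (1 / 2) * (- h1) - trace (gam G k y) * this
  have := (mul_eq_zero.mp h2).resolve_left hs.ne'
  linarith

theorem pdM_metric_inv (hG : IsMetricOn G O) (hy : y ∈ O) (k : Fin 4) :
    pdM k (fun z => (G z)⁻¹) y = -(gam G k y * (G y)⁻¹ + (G y)⁻¹ * (gam G k y)ᵀ) := by
  have hu := isUnit_det_of_posDef (hG.posDef y hy)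
  rw [pdM_inv hG.isOpen hy hG.smooth hG.det_ne_zero, pdM_metric hG hy, mul_add, add_mul,
    nonsing_inv_mul_cancel_left _ _ hu, Matrix.mul_assoc, Matrix.mul_assoc, mul_nonsing_inv _ hu,
    Matrix.mul_one]

theorem SmoothMat.hodgeEndo (hG : IsMetricOn G O) (hT : SmoothMat O T) :
    SmoothMat O (fun z => hodgeEndo (G z) (T z)) := by
  have h : SmoothMat O (fun z => Real.sqrt (G z).det • ((G z)⁻¹ * ConfKahler.dualForm (T z * (G z)⁻¹))) :=
    .smul (smooth_sqrt_det hG) (hG.smooth_inv.mul (hT.mul hG.smooth_inv).dualForm)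
  intro i j
  exact (h i j).congr fun z hz => by simp only [hodgeEndo_eq (hG.posDef z hz)]

/-- The Hodge star is parallel. -/
theorem cov_hodgeEndo (hG : IsMetricOn G O) (hy : y ∈ O) (hT : SmoothMat O T) (k : Fin 4) :
    cov G k (fun z => hodgeEndo (G z) (T z)) y = hodgeEndo (G y) (cov G k T y) := by
  have hi := hG.smooth_inv
  have hN := hT.mul hi
  have h1 : pdM k (fun z => T z * (G z)⁻¹) y = cov G k T y * (G y)⁻¹
      - (gam G k y * (T y * (G y)⁻¹) + T y * (G y)⁻¹ * (gam G k y)ᵀ) := by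
    rw [pdM_mul hG.isOpen hy hT hi, pdM_metric_inv hG hy, cov]
    noncomm_ring
  rw [cov_congr hG.isOpen hy (fun z hz => hodgeEndo_eq (hG.posDef z hz) (T z)), cov,
    hodgeEndo_eq (hG.posDef y hy), pdM_smul hG.isOpen hy (smooth_sqrt_det hG) (hi.mul hN.dualForm),
    pdM_mul hG.isOpen hy hi hN.dualForm, pdM_dualForm hG.isOpen hy hN, h1, pd_sqrt_det hG hy,
    pdM_metric_inv hG hy, dualForm_sub, dualForm_derivation]
  simp only [Matrix.mul_smul, Matrix.smul_mul, ← smul_smul, add_mul, mul_sub, smul_add,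
    smul_sub, Matrix.neg_mul, smul_neg, Matrix.mul_assoc, neg_add]
  abel

theorem SmoothMat.sdPart (hG : IsMetricOn G O) (hT : SmoothMat O T) :
    SmoothMat O (fun z => sdPart (G z) (T z)) :=
  .smul contDiffOn_const (hT.add (hT.hodgeEndo hG))

theorem cov_sdPart (hG : IsMetricOn G O) (hy : y ∈ O) (hT : SmoothMat O T) (k : Fin 4) :
    cov G k (fun z => sdPart (G z) (T z)) y = sdPart (G y) (cov G k T y) := by
  unfold ConfKahler.sdPart
  rw [cov_smul hG hy contDiffOn_const (hT.add (hT.hodgeEndo hG)), pd_const,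
    cov_add hG hy hT (hT.hodgeEndo hG), cov_hodgeEndo hG hy hT, zero_smul, zero_add]

end

/-! ### Curvature of anti-self-dual Einstein metrics and Killing fields -/

/-- `G` is the matrix of an anti-self-dual Einstein metric on the open set `O`. -/
structure IsEinsteinASDOn (G : E4 → Mat4) (O : Set E4) (Λ : ℝ) : Prop
    extends IsMetricOn G O where
  einstein : ∀ z ∈ O, ∀ i j, ricci G z i j = 6 * Λ * G z i j
  asd : ∀ z ∈ O, ∀ c d, hodgeStar (G z) (of fun a b => weyl G z a b c d)
    = -(of fun a b => weyl G z a b c d)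

/-- The covariant derivative of a vector field as an endomorphism field. -/
def nablaV (G : E4 → Mat4) (X : E4 → Fin 4 → ℝ) (y : E4) : Mat4 := of fun i k => covV G k X y i

section
variable {G : E4 → Mat4} {O : Set E4} {Λ : ℝ} {y : E4} {X : E4 → Fin 4 → ℝ}

theorem nablaV_mulVec_single (k : Fin 4) : nablaV G X y *ᵥ Pi.single k 1 = covV G k X y := by
  ext i
  rw [mulVec_single_one]
  rfl

theorem smoothMat_nablaV (hG : IsMetricOn G O) (hX : SmoothVec O X) : SmoothMat O (nablaV G X) :=
  fun i k => hX.covV hG k i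

theorem wedge_add_left (g : Mat4) (a b c : Fin 4 → ℝ) :
    wedge g (a + b) c = wedge g a c + wedge g b c := by
  simp only [wedge, add_vecMulVec, mulVec_add, vecMulVec_add]
  abel

theorem wedge_add_right (g : Mat4) (a b c : Fin 4 → ℝ) :
    wedge g a (b + c) = wedge g a b + wedge g a c := by
  simp only [wedge, add_vecMulVec, mulVec_add, vecMulVec_add]
  abel

theorem wedge_smul_left (g : Mat4) (r : ℝ) (a b : Fin 4 → ℝ) :
    wedge g (r • a) b = r • wedge g a b := by
  simp only [wedge, smul_vecMulVec, mulVec_smul, vecMulVec_smul, smul_sub]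

theorem wedge_smul_right (g : Mat4) (r : ℝ) (a b : Fin 4 → ℝ) :
    wedge g a (r • b) = r • wedge g a b := by
  simp only [wedge, smul_vecMulVec, mulVec_smul, vecMulVec_smul, smul_sub]

theorem wedge_sum_right (g : Mat4) (a x : Fin 4 → ℝ) :
    wedge g a x = ∑ l, x l • wedge g a (Pi.single l 1) := by
  have h := map_sum (AddMonoidHom.mk' (wedge g a) (wedge_add_right g a))
    (fun l => x l • (Pi.single l 1 : Fin 4 → ℝ)) Finset.univ
  simp only [AddMonoidHom.mk'_apply, wedge_smul_right] at h
  rw [← h, ← pi_eq_sum_univ' x]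

theorem mul_wedge_single (k l a b : Fin 4) :
    (G y * wedge (G y) (Pi.single k 1) (Pi.single l 1)) a b
      = G y a k * G y b l - G y a l * G y b k := by
  simp only [wedge, mul_sub, mul_vecMulVec, mulVec_single_one, Matrix.sub_apply, vecMulVec_apply,
    col_apply]

theorem mul_curvM (k l a b : Fin 4) : (G y * curvM G k l y) a b = riemann G y a b k l := by
  simp [mul_apply, curvM, riemann]

/-- The decomposition of the curvature into Weyl, trace-free Ricci and scalar parts. With Ric = 6Λg
and R = 24Λ, the non-Weyl terms add up to 6Λ - 4Λ = 2Λ times the curvature of constant sectional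
curvature 1. -/
theorem exists_asd_curvM (hE : IsEinsteinASDOn G O Λ) (hy : y ∈ O) (k l : Fin 4) :
    ∃ W : Mat4, hodgeEndo (G y) W = -W ∧
      curvM G k l y = W + (2 * Λ) • wedge (G y) (Pi.single k 1) (Pi.single l 1) := by
  have hG := hE.toIsMetricOn
  have hu := isUnit_det_of_posDef (hG.posDef y hy)
  have hs : scalarCurvature G y = 24 * Λ := by
    have h1 : scalarCurvature G y = 6 * Λ * trace ((G y)⁻¹ * G y) := by
      simp only [scalarCurvature, hE.einstein y hy, trace, diag_apply, mul_apply, Finset.mul_sum]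
      refine Finset.sum_congr rfl fun b _ => Finset.sum_congr rfl fun d _ => ?_
      rw [hG.symm hy b d]
      ring
    rw [h1, nonsing_inv_mul _ hu, trace_one]
    norm_num
    ring
  refine ⟨(G y)⁻¹ * of fun a b => weyl G y a b k l, ?_, ?_⟩
  · rw [hodgeEndo, mul_nonsing_inv_cancel_left _ _ hu, hE.asd y hy, Matrix.mul_neg]
  · have h : G y * curvM G k l y = G y * ((G y)⁻¹ * (of fun a b => weyl G y a b k l)
        + (2 * Λ) • wedge (G y) (Pi.single k 1) (Pi.single l 1)) := by
      rw [mul_add, mul_nonsing_inv_cancel_left _ _ hu, Matrix.mul_smul]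
      ext a b
      rw [mul_curvM, Matrix.add_apply, Matrix.smul_apply, mul_wedge_single, of_apply, weyl]
      simp only [hE.einstein y hy, hs, smul_eq_mul]
      ring
    have h' := congrArg (fun Z => (G y)⁻¹ * Z) h
    simpa only [nonsing_inv_mul_cancel_left _ _ hu] using h'

theorem sdPart_curvM (hE : IsEinsteinASDOn G O Λ) (hy : y ∈ O) (k l : Fin 4) :
    sdPart (G y) (curvM G k l y)
      = (2 * Λ) • sdPart (G y) (wedge (G y) (Pi.single k 1) (Pi.single l 1)) := by
  obtain ⟨W, hW, h⟩ := exists_asd_curvM hE hy k l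
  rw [h, sdPart_add, sdPart_of_asd hW, sdPart_smul, zero_add]

/-- Since ∇ is torsion-free and metric, the partial derivatives in L_X g may be replaced by
covariant ones: L_X g is the symmetrization of ∇X. -/
theorem lieDerivMetric_eq (hG : IsMetricOn G O) (hy : y ∈ O) (i j : Fin 4) :
    lieDerivMetric G X y i j = (G y * nablaV G X y) i j + (G y * nablaV G X y) j i := by
  have h1 : ∀ i j, (G y * nablaV G X y) j i
      = ∑ k, G y j k * pd i (fun z => X z k) y + ∑ k, X y k * (G y * gam G k y) j i := by
    intro i j
    have h2 : ∀ k, (G y * gam G k y) j i = (G y * gam G i y) j k := by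
      intro k
      simp only [mul_apply]
      exact Finset.sum_congr rfl fun m _ => by rw [gam_symm hG hy]
    simp only [h2]
    have h3 : ∑ k, X y k * (G y * gam G i y) j k = (G y *ᵥ (gam G i y *ᵥ X y)) j := by
      rw [mulVec_mulVec]
      exact Finset.sum_congr rfl fun k _ => mul_comm _ _
    rw [h3]
    simp only [mul_apply, nablaV, of_apply, covV, Pi.add_apply, mul_add, Finset.sum_add_distrib,
      pdV]
    rfl
  have h4 : ∀ k, pd k (fun z => G z i j) y = (G y * gam G k y) i j + (G y * gam G k y) j i := by
    intro k
    have := congrFun (congrFun (pdM_metric hG hy k) i) j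
    rw [Matrix.add_apply] at this
    rw [show (G y * gam G k y) j i = ((gam G k y)ᵀ * G y) i j by
      rw [← transpose_apply (G y * gam G k y), transpose_mul,
        transpose_eq_of_posDef (hG.posDef y hy)]]
    exact this
  rw [h1, h1, lieDerivMetric]
  simp only [h4, Finset.sum_add_distrib, mul_add]
  simp only [hG.symm hy _ j]
  ring

theorem isKilling_iff (hG : IsMetricOn G O) (hy : y ∈ O) :
    (∀ i j, lieDerivMetric G X y i j = 0) ↔
      (G y * nablaV G X y)ᵀ = -(G y * nablaV G X y) := by
  simp only [lieDerivMetric_eq hG hy]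
  constructor
  · intro h
    ext i j
    rw [transpose_apply, Matrix.neg_apply]
    linarith [h i j]
  · intro h i j
    have := congrFun (congrFun h i) j
    rw [transpose_apply, Matrix.neg_apply] at this
    linarith

theorem cov_skew (hG : IsMetricOn G O) (hy : y ∈ O) {A : E4 → Mat4} (hA : SmoothMat O A)
    (h : ∀ z ∈ O, (G z * A z)ᵀ = -(G z * A z)) (k : Fin 4) :
    (G y * cov G k A y)ᵀ = -(G y * cov G k A y) := by
  have h1 : pdM k (fun z => G z * A z + (G z * A z)ᵀ) y = 0 := by
    rw [pdM_congr hG.isOpen hy (T := fun _ => 0) (fun z hz => by rw [h z hz, add_neg_cancel]),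
      pdM_const]
  have hs := hG.smooth.mul hA
  rw [pdM_add hG.isOpen hy hs hs.transpose, pdM_transpose, pdM_mul hG.isOpen hy hG.smooth hA,
    pdM_metric hG hy] at h1
  have h2 := h y hy
  rw [← add_eq_zero_iff_eq_neg'] at h2 ⊢
  have h3 : G y * cov G k A y + (G y * cov G k A y)ᵀ
      = ((G y * gam G k y + (gam G k y)ᵀ * G y) * A y + G y * pdM k A y
        + ((G y * gam G k y + (gam G k y)ᵀ * G y) * A y + G y * pdM k A y)ᵀ)
        - (gam G k y)ᵀ * (G y * A y + (G y * A y)ᵀ) - (G y * A y + (G y * A y)ᵀ) * gam G k y := by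
    simp only [cov, transpose_mul, transpose_add, transpose_sub, mul_add, add_mul, mul_sub,
      transpose_transpose, transpose_eq_of_posDef (hG.posDef y hy)]
    noncomm_ring
  rw [h3, h1, h2]
  simp

/-- The second covariant derivative of a Killing field is given by the curvature. -/
theorem cov_nablaV_of_killing (hG : IsMetricOn G O) (hy : y ∈ O) (hX : SmoothVec O X)
    (hK : ∀ z ∈ O, ∀ i j, lieDerivMetric G X z i j = 0) (k : Fin 4) :
    cov G k (nablaV G X) y = ∑ l, X y l • curvM G k l y := by
  have hA : SmoothMat O (nablaV G X) := smoothMat_nablaV hG hX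
  set A := nablaV G X with hAdef
  have hu := isUnit_det_of_posDef (hG.posDef y hy)
  have hsk := fun k => cov_skew hG hy hA (fun z hz => (isKilling_iff hG hz).mp (hK z hz)) k
  -- The Ricci identity for X, with A = ∇X: it prescribes the part of ∇A that is skew in the two
  -- differentiation indices.
  have hcomm : ∀ k i, cov G k A y *ᵥ Pi.single i 1 - cov G i A y *ᵥ Pi.single k 1
      = curvM G k i y *ᵥ X y := by
    have h1 : ∀ k i, covV G k (covV G i X) y = cov G k A y *ᵥ Pi.single i 1
        + A y *ᵥ (gam G k y *ᵥ Pi.single i 1) := by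
      intro k i
      have : covV G i X = fun z => A z *ᵥ Pi.single i 1 := by
        ext1 z
        rw [hAdef, nablaV_mulVec_single]
      rw [this, covV_mulVec hG hy hA (.const _), covV, pdV_const, zero_add]
    intro k i
    rw [← covV_covV_sub hG hy hX, h1, h1, gam_mulVec_single hG hy k i]
    abel
  have hb : ∀ k i j, (G y * cov G k A y) j i - (G y * cov G i A y) j k
      = (G y *ᵥ (curvM G k i y *ᵥ X y)) j := by
    intro k i j
    rw [← hcomm, mulVec_sub, mulVec_mulVec, mulVec_mulVec, mulVec_single_one, mulVec_single_one]
    rfl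
  -- By the first Bianchi identity, the curvature expression has the same skew part as ∇A.
  have hc : ∀ k i j, (G y * ∑ l, X y l • curvM G k l y) j i
      - (G y * ∑ l, X y l • curvM G i l y) j k = (G y *ᵥ (curvM G k i y *ᵥ X y)) j := by
    intro k i j
    have h1 : ∀ k i, (G y * ∑ l, X y l • curvM G k l y) j i
        = (G y *ᵥ (∑ l, X y l • (curvM G k l y *ᵥ Pi.single i 1))) j := by
      intro k i
      have : ∑ l, X y l • (curvM G k l y *ᵥ Pi.single i 1)
          = (∑ l, X y l • curvM G k l y) *ᵥ Pi.single i 1 := by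
        rw [sum_mulVec]
        simp only [smul_mulVec]
      rw [this, mulVec_mulVec, mulVec_single_one]
      rfl
    rw [h1, h1, ← Pi.sub_apply, ← mulVec_sub, ← Finset.sum_sub_distrib]
    congr 2
    have h2 : curvM G k i y *ᵥ X y = ∑ l, X y l • (curvM G k i y *ᵥ Pi.single l 1) := by
      conv_lhs => rw [pi_eq_sum_univ' (X y)]
      rw [mulVec_sum]
      simp only [mulVec_smul]
    rw [h2]
    refine Finset.sum_congr rfl fun l _ => ?_
    rw [← smul_sub]
    congr 1
    have hbi := curvM_bianchi hG hy k l i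
    have ha : ∀ k l, curvM G k l y = -curvM G l k y := by
      intro k l
      rw [curvM_eq, curvM_eq]
      abel
    rw [ha l i, ha i k, neg_mulVec, neg_mulVec] at hbi
    rw [← sub_eq_zero, ← hbi]
    abel
  have hcs : ∀ k i j, (G y * ∑ l, X y l • curvM G k l y) j i
      = -(G y * ∑ l, X y l • curvM G k l y) i j := by
    intro k i j
    simp only [Finset.mul_sum, Matrix.mul_smul, Matrix.sum_apply, Matrix.smul_apply, smul_eq_mul,
      ← Finset.sum_neg_distrib]
    refine Finset.sum_congr rfl fun l _ => ?_
    have := congrFun (congrFun (curvM_skew hG hy k l) i) j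
    rw [transpose_apply, Matrix.neg_apply] at this
    rw [this]
    ring
  have hbs : ∀ k i j, (G y * cov G k A y) j i = -(G y * cov G k A y) i j := fun k i j =>
    congrFun (congrFun (hsk k) i) j
  -- The difference of the two sides is symmetric in k, i and skew in i, j. Such a three-index
  -- tensor is zero, as in the uniqueness of the Levi-Civita connection.
  have hfin : G y * cov G k A y = G y * ∑ l, X y l • curvM G k l y := by
    ext j i
    linarith [hb k i j, hb i j k, hb j k i, hc k i j, hc i j k, hc j k i, hbs k i j, hbs i j k,
      hbs j k i, hcs k i j, hcs i j k, hcs j k i]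
  have h' := congrArg (fun Z => (G y)⁻¹ * Z) hfin
  simpa only [nonsing_inv_mul_cancel_left _ _ hu] using h'

/-- The self-dual part of the derivative of a Killing field of an anti-self-dual Einstein metric
satisfies the twistor equation. -/
theorem cov_sdPart_nablaV (hE : IsEinsteinASDOn G O Λ) (hy : y ∈ O) (hX : SmoothVec O X)
    (hK : ∀ z ∈ O, ∀ i j, lieDerivMetric G X z i j = 0) (k : Fin 4) :
    cov G k (fun z => sdPart (G z) (nablaV G X z)) y
      = (2 * Λ) • sdPart (G y) (wedge (G y) (Pi.single k 1) (X y)) := by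
  have hG := hE.toIsMetricOn
  rw [cov_sdPart hG hy (smoothMat_nablaV hG hX), cov_nablaV_of_killing hG hy hX hK, sdPart_sum,
    wedge_sum_right (G y) _ (X y),
    sdPart_sum, Finset.smul_sum]
  refine Finset.sum_congr rfl fun l _ => ?_
  rw [sdPart_smul, sdPart_smul, sdPart_curvM hE hy, smul_comm]

end

/-! ### Conformal changes of the metric -/

section
variable {G : E4 → Mat4} {O : Set E4} {Λ : ℝ} {y : E4} {X : E4 → Fin 4 → ℝ} {ρ : E4 → ℝ}

/-- The metric `ρ² G`. -/
def conformal (ρ : E4 → ℝ) (G : E4 → Mat4) (z : E4) : Mat4 := ρ z ^ 2 • G z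

/-- The gradient of `log ρ`. -/
def gradLog (G : E4 → Mat4) (ρ : E4 → ℝ) (y : E4) : Fin 4 → ℝ :=
  (G y)⁻¹ *ᵥ fun k => pd k ρ y / ρ y

theorem IsMetricOn.conformal (hG : IsMetricOn G O) (hρ : ContDiffOn ℝ ∞ ρ O)
    (hp : ∀ z ∈ O, 0 < ρ z) : IsMetricOn (conformal ρ G) O where
  isOpen := hG.isOpen
  smooth := .smul (hρ.pow 2) hG.smooth
  posDef := fun z hz => (hG.posDef z hz).smul (pow_pos (hp z hz) 2)

theorem metric_mulVec_gradLog (hG : IsMetricOn G O) (hy : y ∈ O) :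
    G y *ᵥ gradLog G ρ y = fun k => pd k ρ y / ρ y := by
  rw [gradLog, mulVec_mulVec, mul_nonsing_inv _ (isUnit_det_of_posDef (hG.posDef y hy)),
    one_mulVec]

theorem smooth_gradLog (hG : IsMetricOn G O) (hρ : ContDiffOn ℝ ∞ ρ O)
    (hp : ∀ z ∈ O, 0 < ρ z) : SmoothVec O (gradLog G ρ) :=
  hG.smooth_inv.mulVec fun k => (smooth_pd hG.isOpen hρ k).div hρ fun z hz => (hp z hz).ne'

/-- Lowering the upper index makes both sides explicit in first derivatives of the metric. Of the
two extra terms, the multiple of the identity commutes with every endomorphism, so only the wedge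
survives in `cov_conformal`. -/
theorem gam_conformal (hG : IsMetricOn G O) (hρ : ContDiffOn ℝ ∞ ρ O)
    (hp : ∀ z ∈ O, 0 < ρ z) (hy : y ∈ O) (k : Fin 4) :
    gam (conformal ρ G) k y = gam G k y + (pd k ρ y / ρ y) • (1 : Mat4)
      + wedge (G y) (Pi.single k 1) (gradLog G ρ y) := by
  have hc := hG.conformal hρ hp
  have hu := isUnit_det_of_posDef (hc.posDef y hy)
  have hpd : ∀ k i j, pd k (fun z => conformal ρ G z i j) y
      = 2 * ρ y * pd k ρ y * G y i j + ρ y ^ 2 * pd k (fun z => G z i j) y := by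
    intro k i j
    have h1 : pd k (fun z => ρ z ^ 2) y = 2 * ρ y * pd k ρ y := by
      simp only [pow_two]
      rw [pd_mul hG.isOpen hy hρ hρ]
      ring
    have := pd_mul hG.isOpen hy (hρ.pow 2) (hG.smooth i j) k
    rw [h1] at this
    exact this
  have h : conformal ρ G y * gam (conformal ρ G) k y = conformal ρ G y * (gam G k y
      + (pd k ρ y / ρ y) • (1 : Mat4) + wedge (G y) (Pi.single k 1) (gradLog G ρ y)) := by
    ext i j
    have hw : (G y * wedge (G y) (Pi.single k 1) (gradLog G ρ y)) i j
        = G y i k * (pd j ρ y / ρ y) - pd i ρ y / ρ y * G y j k := by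
      simp only [wedge, mul_sub, mul_vecMulVec, metric_mulVec_gradLog hG hy, Matrix.sub_apply,
        vecMulVec_apply, mulVec_single_one, col_apply]
    rw [metric_mul_gam hc hy, hpd, hpd, hpd]
    simp only [conformal, Matrix.smul_mul, mul_add, Matrix.mul_smul, Matrix.mul_one,
      Matrix.smul_apply, Matrix.add_apply, hw, metric_mul_gam hG hy, smul_eq_mul]
    rw [hG.symm hy j i, hG.symm hy k i, hG.symm hy k j]
    have := (hp y hy).ne'
    field_simp
    ring
  have h' := congrArg (fun Z => (conformal ρ G y)⁻¹ * Z) h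
  simpa only [nonsing_inv_mul_cancel_left _ _ hu] using h'

theorem cov_conformal (hG : IsMetricOn G O) (hρ : ContDiffOn ℝ ∞ ρ O)
    (hp : ∀ z ∈ O, 0 < ρ z) (hy : y ∈ O) (k : Fin 4) (J : E4 → Mat4) :
    cov (conformal ρ G) k J y = cov G k J y
      + (wedge (G y) (Pi.single k 1) (gradLog G ρ y) * J y
        - J y * wedge (G y) (Pi.single k 1) (gradLog G ρ y)) := by
  rw [cov, cov, gam_conformal hG hρ hp hy]
  simp only [add_mul, mul_add, Matrix.smul_mul, Matrix.mul_smul, Matrix.one_mul, Matrix.mul_one]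
  abel

theorem single_dotProduct_gradLog (hG : IsMetricOn G O) (hy : y ∈ O) (k : Fin 4) :
    (Pi.single k 1 : Fin 4 → ℝ) ⬝ᵥ G y *ᵥ gradLog G ρ y = pd k ρ y / ρ y := by
  rw [metric_mulVec_gradLog hG hy, single_one_dotProduct]

/-! ### From Kähler metrics to Killing fields -/

/-- The vector field `J grad (log ρ) / ρ = -J grad (1 / ρ)`. -/
def hamiltonianField (G : E4 → Mat4) (ρ : E4 → ℝ) (J : E4 → Mat4) (z : E4) : Fin 4 → ℝ :=
  (ρ z)⁻¹ • (J z *ᵥ gradLog G ρ z)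

theorem smooth_hamiltonianField (hG : IsMetricOn G O) (hρ : ContDiffOn ℝ ∞ ρ O)
    (hp : ∀ z ∈ O, 0 < ρ z) {J : E4 → Mat4} (hJ : SmoothMat O J) :
    SmoothVec O (hamiltonianField G ρ J) :=
  .smul (hρ.inv fun z hz => (hp z hz).ne') (hJ.mulVec (smooth_gradLog hG hρ hp))

/-- The parallel condition for ρ²G says ∇_k J = 2 (e_k ∧ J grad log ρ)⁺ + (∂_k log ρ) J. Scaling by
ρ⁻¹ is chosen to remove the last term, leaving the twistor equation. -/
theorem cov_inv_smul (hG : IsMetricOn G O) (hρ : ContDiffOn ℝ ∞ ρ O)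
    (hp : ∀ z ∈ O, 0 < ρ z) {J : E4 → Mat4} (hJ : SmoothMat O J)
    (hsd : ∀ z ∈ O, hodgeEndo (G z) (J z) = J z)
    (hpar : ∀ z ∈ O, ∀ k, cov (conformal ρ G) k J z = 0) (hy : y ∈ O) (k : Fin 4) :
    cov G k (fun z => (ρ z)⁻¹ • J z) y
      = (2 : ℝ) • sdPart (G y) (wedge (G y) (Pi.single k 1) (hamiltonianField G ρ J y)) := by
  have hne : ∀ z ∈ O, ρ z ≠ 0 := fun z hz => (hp z hz).ne'
  have hi : ContDiffOn ℝ ∞ (fun z => (ρ z)⁻¹) O := hρ.inv hne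
  have h1 : pd k (fun z => (ρ z)⁻¹) y = -(ρ y)⁻¹ * (pd k ρ y / ρ y) := by
    have h2 := pd_mul hG.isOpen hy hρ hi k
    rw [pd_congr hG.isOpen hy (h := fun _ => 1) (fun z hz => mul_inv_cancel₀ (hne z hz)),
      pd_const] at h2
    have := hne y hy
    field_simp
    field_simp at h2
    linarith
  have h3 := hpar y hy k
  rw [cov_conformal hG hρ hp hy,
    wedge_commutator (hG.posDef y hy) (skew_of_sd (hG.posDef y hy) (hsd y hy)),
    ← sd_wedge_identity (hG.posDef y hy) (hsd y hy), single_dotProduct_gradLog hG hy,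
    ← sub_eq_add_neg, sub_eq_zero] at h3
  rw [cov_smul hG hy hi hJ, h3, h1, hamiltonianField, wedge_smul_right, sdPart_smul]
  module

theorem eq_zero_of_bilinear {F : (Fin 4 → ℝ) → (Fin 4 → ℝ) → Mat4}
    (h1 : ∀ a b c, F (a + b) c = F a c + F b c) (h2 : ∀ (r : ℝ) a b, F (r • a) b = r • F a b)
    (h3 : ∀ a b c, F a (b + c) = F a b + F a c) (h4 : ∀ (r : ℝ) a b, F a (r • b) = r • F a b)
    (h : ∀ k l, F (Pi.single k 1) (Pi.single l 1) = 0) (a b : Fin 4 → ℝ) : F a b = 0 := by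
  have h5 : LinearMap.mk₂ ℝ F h1 h2 h3 h4 = 0 := by
    refine (Pi.basisFun ℝ (Fin 4)).ext fun k => (Pi.basisFun ℝ (Fin 4)).ext fun l => ?_
    simpa using h k l
  exact LinearMap.congr_fun₂ h5 a b

/-- The integrability condition of the twistor equation: its derivative is skew-symmetrized and
compared with the Ricci identity. Bilinearity in a, b reduces it to coordinate vectors, whose own
covariant derivatives cancel because the Christoffel symbols are symmetric. -/
theorem sdPart_wedge_nablaV (hE : IsEinsteinASDOn G O Λ) (hy : y ∈ O) {Φ : E4 → Mat4}
    (hΦ : SmoothMat O Φ) (hsd : hodgeEndo (G y) (Φ y) = Φ y) (hX : SmoothVec O X)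
    (h : ∀ z ∈ O, ∀ k, cov G k Φ z
      = (2 : ℝ) • sdPart (G z) (wedge (G z) (Pi.single k 1) (X z))) (a b : Fin 4 → ℝ) :
    (2 : ℝ) • sdPart (G y) (wedge (G y) b (nablaV G X y *ᵥ a) - wedge (G y) a (nablaV G X y *ᵥ b))
      = (2 * Λ) • (wedge (G y) a b * Φ y - Φ y * wedge (G y) a b) := by
  have hG := hE.toIsMetricOn
  rw [← sub_eq_zero]
  refine eq_zero_of_bilinear (F := fun a b => (2 : ℝ) • sdPart (G y) (wedge (G y) b
    (nablaV G X y *ᵥ a) - wedge (G y) a (nablaV G X y *ᵥ b))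
      - (2 * Λ) • (wedge (G y) a b * Φ y - Φ y * wedge (G y) a b)) ?_ ?_ ?_ ?_ ?_ a b
  · intro a b c
    simp only [wedge_add_left, wedge_add_right, mulVec_add, sdPart_add, sdPart_sub, add_mul, mul_add]
    module
  · intro r a b
    simp only [wedge_smul_left, wedge_smul_right, mulVec_smul, sdPart_smul, sdPart_sub,
      Matrix.smul_mul, Matrix.mul_smul]
    module
  · intro a b c
    simp only [wedge_add_left, wedge_add_right, mulVec_add, sdPart_add, sdPart_sub, add_mul, mul_add]
    module
  · intro r a b
    simp only [wedge_smul_left, wedge_smul_right, mulVec_smul, sdPart_smul, sdPart_sub,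
      Matrix.smul_mul, Matrix.mul_smul]
    module
  · intro l k
    have hw : ∀ k, SmoothMat O fun z => wedge (G z) (Pi.single k 1) (X z) := fun k =>
      (SmoothMat.vecMulVec (.const _) (hG.smooth.mulVec hX)).sub
        (.vecMulVec hX (hG.smooth.mulVec (.const _)))
    have h1 : ∀ k l, cov G l (cov G k Φ) y = (2 : ℝ) • sdPart (G y)
        (wedge (G y) (gam G l y *ᵥ Pi.single k 1) (X y)
          + wedge (G y) (Pi.single k 1) (nablaV G X y *ᵥ Pi.single l 1)) := by
      intro k l
      rw [cov_congr hG.isOpen hy (fun z hz => h z hz k),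
        cov_smul hG hy contDiffOn_const ((hw k).sdPart hG), pd_const, zero_smul, zero_add,
        cov_sdPart hG hy (hw k), cov_wedge hG hy (.const _) hX, nablaV_mulVec_single,
        covV, pdV_const, zero_add]
    obtain ⟨W, hW, hR⟩ := exists_asd_curvM hE hy l k
    have h2 := cov_cov_sub hG hy hΦ l k
    -- W is anti-self-dual and commutes with Φ, so only the constant-curvature term contributes to
    -- the commutator.
    rw [h1, h1, gam_mulVec_single hG hy k l, hR, add_mul, mul_add,
      sd_asd_commute (hG.posDef y hy) hsd hW, Matrix.smul_mul, Matrix.mul_smul] at h2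
    rw [sub_eq_zero, smul_sub, sdPart_sub]
    rw [sdPart_add, sdPart_add] at h2
    rw [add_sub_add_left_eq_sub] at h2
    rw [← h2]
    module

/-- The integrability condition for Φ = J/ρ makes ∇X skew. If X were zero on all of O, then ∇X would
vanish at y, and Λ ≠ 0 would force J y = 0. -/
theorem killing_of_kahler (hE : IsEinsteinASDOn G O Λ) (hρ : ContDiffOn ℝ ∞ ρ O)
    (hp : ∀ z ∈ O, 0 < ρ z) {J : E4 → Mat4} (hJ : SmoothMat O J)
    (hsd : ∀ z ∈ O, hodgeEndo (G z) (J z) = J z)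
    (hpar : ∀ z ∈ O, ∀ k, cov (conformal ρ G) k J z = 0) (hy : y ∈ O) :
    (∀ i j, lieDerivMetric G (hamiltonianField G ρ J) y i j = 0) ∧
      (Λ ≠ 0 → J y ≠ 0 → ∃ z ∈ O, hamiltonianField G ρ J z ≠ 0) := by
  have hG := hE.toIsMetricOn
  have hX := smooth_hamiltonianField hG hρ hp hJ
  have hsd' : hodgeEndo (G y) ((ρ y)⁻¹ • J y) = (ρ y)⁻¹ • J y := by
    rw [hodgeEndo_smul, hsd y hy]
  have h := skew_of_sdPart_wedge (hG.posDef y hy) hsd' Λ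
    (sdPart_wedge_nablaV hE hy (.smul (hρ.inv fun z hz => (hp z hz).ne') hJ) hsd' hX
      fun z hz k => cov_inv_smul hG hρ hp hJ hsd hpar hz k)
  refine ⟨(isKilling_iff hG hy).mpr h.1, fun hΛ hne => ?_⟩
  by_contra! hz
  have h0 : nablaV G (hamiltonianField G ρ J) y = 0 := by
    ext i k
    have : covV G k (hamiltonianField G ρ J) y = 0 := by
      rw [covV, pdV_congr hG.isOpen hy (Y := fun _ => 0) hz, pdV_const, hz y hy, mulVec_zero,
        zero_add]
    exact congrFun this i
  have h1 := h.2 h0 hΛ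
  exact hne ((smul_eq_zero.mp h1).resolve_left (inv_pos.mpr (hp y hy)).ne')

/-! ### From Killing fields to Kähler metrics -/

/-- The self-dual part of the covariant derivative of a vector field. -/
def sdNabla (G : E4 → Mat4) (X : E4 → Fin 4 → ℝ) (z : E4) : Mat4 := sdPart (G z) (nablaV G X z)

/-- The squared norm `-tr T² / 4` of an endomorphism. -/
def normSqEndo (T : Mat4) : ℝ := -(trace (T * T) / 4)

theorem sd_mul_self_eq {g T : Mat4} (hg : g.PosDef) (hT : hodgeEndo g T = T) :
    T * T = -normSqEndo T • (1 : Mat4) ∧ 0 ≤ normSqEndo T ∧ (normSqEndo T = 0 → T = 0) := by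
  obtain ⟨s, h0, h1, h2⟩ := sd_mul_self hg hT
  have : normSqEndo T = s := by
    rw [normSqEndo, h1, trace_smul, trace_one, Fintype.card_fin, smul_eq_mul]
    norm_num
    ring
  rw [this]
  exact ⟨h1, h0, h2⟩

theorem hodgeEndo_sdNabla (hG : IsMetricOn G O) (hy : y ∈ O)
    (hK : ∀ i j, lieDerivMetric G X y i j = 0) :
    hodgeEndo (G y) (sdNabla G X y) = sdNabla G X y :=
  hodgeEndo_sdPart (hG.posDef y hy) ((isKilling_iff hG hy).mp hK)

theorem smooth_sdNabla (hG : IsMetricOn G O) (hX : SmoothVec O X) : SmoothMat O (sdNabla G X) :=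
  (smoothMat_nablaV hG hX).sdPart hG

theorem smooth_normSqEndo {T : E4 → Mat4} (hT : SmoothMat O T) :
    ContDiffOn ℝ ∞ (fun z => normSqEndo (T z)) O :=
  ((ContDiffOn.sum fun i _ => (hT.mul hT) i i).div_const 4).neg

/-- With Φ = (∇X)⁺ and ρ⁻² = |Φ|², the twistor equation determines dρ as well as ∇Φ. The derivative
of ρΦ for G then cancels exactly the conformal correction. -/
theorem kahler_of_killing (hE : IsEinsteinASDOn G O Λ) (hX : SmoothVec O X)
    (hK : ∀ z ∈ O, ∀ i j, lieDerivMetric G X z i j = 0) (hρ : ContDiffOn ℝ ∞ ρ O)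
    (hp : ∀ z ∈ O, 0 < ρ z) (hn : ∀ z ∈ O, ρ z ^ 2 * normSqEndo (sdNabla G X z) = 1)
    (hy : y ∈ O) (k : Fin 4) :
    cov (conformal ρ G) k (fun z => ρ z • sdNabla G X z) y = 0 := by
  have hG := hE.toIsMetricOn
  have hΦ := smooth_sdNabla hG hX
  have hg := hG.posDef y hy
  have hsd := hodgeEndo_sdNabla hG hy (hK y hy)
  have hne := (hp y hy).ne'
  set Φ := sdNabla G X with hΦdef
  have hcov : ∀ k, cov G k Φ y = (2 * Λ) • sdPart (G y) (wedge (G y) (Pi.single k 1) (X y)) :=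
    fun k => cov_sdPart_nablaV hE hy hX hK k
  -- Differentiate -tr Φ²/4 using the twistor equation; since Φ is self-dual, the projection of e_k
  -- ∧ X may be dropped inside the trace.
  have hs : ∀ k, pd k (fun z => normSqEndo (Φ z)) y
      = 2 * Λ * ((Pi.single k 1 : Fin 4 → ℝ) ⬝ᵥ G y *ᵥ (Φ y *ᵥ X y)) := by
    intro k
    have h1 : (fun z => normSqEndo (Φ z)) = fun z => (-(1 / 4 : ℝ)) * trace (Φ z * Φ z) := by
      ext z
      rw [normSqEndo]
      ring
    have h2 : ContDiffOn ℝ ∞ (fun z => trace (Φ z * Φ z)) O :=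
      ContDiffOn.sum fun i _ => (hΦ.mul hΦ) i i
    rw [h1, pd_mul hG.isOpen hy contDiffOn_const h2, pd_const, trace_cov hG hy (hΦ.mul hΦ),
      cov_mul hG hy hΦ hΦ, trace_add, trace_mul_comm (cov G k Φ y), hcov, Matrix.mul_smul,
      trace_smul, trace_mul_sdPart hg hsd, trace_mul_wedge hg (skew_of_sd hg hsd), smul_eq_mul]
    ring
  have hu : ∀ k, pd k ρ y / ρ y
      = -Λ * ρ y ^ 2 * ((Pi.single k 1 : Fin 4 → ℝ) ⬝ᵥ G y *ᵥ (Φ y *ᵥ X y)) := by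
    intro k
    have h1 := pd_mul hG.isOpen hy (hρ.pow 2) (smooth_normSqEndo hΦ) k
    rw [pd_congr hG.isOpen hy (h := fun _ => 1) hn, pd_const, hs] at h1
    have h2 : pd k (fun z => ρ z ^ 2) y = 2 * ρ y * pd k ρ y := by
      simp only [pow_two]
      rw [pd_mul hG.isOpen hy hρ hρ]
      ring
    have h3 := hn y hy
    rw [h2] at h1
    rw [div_eq_iff hne]
    generalize (Pi.single k 1 : Fin 4 → ℝ) ⬝ᵥ G y *ᵥ (Φ y *ᵥ X y) = p at *
    generalize normSqEndo (Φ y) = s at *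
    have h4 : ρ y * (2 * (pd k ρ y * s + Λ * ρ y * p)) = 0 := by linarith
    have h5 := (mul_eq_zero.mp h4).resolve_left hne
    linear_combination (ρ y ^ 2 / 2) * h5 - (pd k ρ y) * h3
  have hgrad : gradLog G ρ y = (-Λ * ρ y ^ 2) • (Φ y *ᵥ X y) := by
    have h1 : G y *ᵥ gradLog G ρ y = G y *ᵥ ((-Λ * ρ y ^ 2) • (Φ y *ᵥ X y)) := by
      rw [metric_mulVec_gradLog hG hy, mulVec_smul]
      ext k
      rw [hu, single_one_dotProduct, Pi.smul_apply, smul_eq_mul]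
    have h2 := congrArg (fun z => (G y)⁻¹ *ᵥ z) h1
    simpa only [mulVec_mulVec, nonsing_inv_mul _ (isUnit_det_of_posDef hg), one_mulVec] using h2
  have hJ : hodgeEndo (G y) (ρ y • Φ y) = ρ y • Φ y := by rw [hodgeEndo_smul, hsd]
  -- J grad log ρ = -Λρ³Φ²X, and ρ²Φ² = -1: up to scale, J turns the gradient back into X.
  have hv : (ρ y • Φ y) *ᵥ gradLog G ρ y = (Λ * ρ y) • X y := by
    rw [hgrad, mulVec_smul, smul_mulVec, mulVec_mulVec, (sd_mul_self_eq hg hsd).1, smul_mulVec,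
      one_mulVec, smul_smul, smul_smul]
    congr 1
    linear_combination (Λ * ρ y) * hn y hy
  rw [cov_conformal hG hρ hp hy, wedge_commutator hg (skew_of_sd hg hJ),
    ← sd_wedge_identity hg hJ, single_dotProduct_gradLog hG hy, cov_smul hG hy hρ hΦ, hcov, hv,
    wedge_smul_right, sdPart_smul, smul_smul (pd k ρ y / ρ y), div_mul_cancel₀ _ hne]
  module

end

/-! ### Unique continuation of Killing fields -/

section
variable {G : E4 → Mat4} {O : Set E4} {Λ : ℝ} {y : E4} {X : E4 → Fin 4 → ℝ}

theorem fderiv_eq_sum_pd (f : E4 → ℝ) (y w : E4) : fderiv ℝ f y w = ∑ k, w k * pd k f y := by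
  have hw : w = ∑ k, w k • EuclideanSpace.single k (1 : ℝ) := by
    ext i
    simp [Pi.single_apply]
  conv_lhs => rw [hw]
  simp [pd]

/-- A solution of a linear first order system which vanishes at a point vanishes identically. -/
theorem eq_zero_of_linear_system {ι : Type*} [Fintype ι] {B : Set E4} (hB : IsOpen B)
    (hconv : Convex ℝ B) {u : ι → E4 → ℝ} (hu : ∀ a, ContDiffOn ℝ ∞ (u a) B)
    {c : Fin 4 → ι → ι → E4 → ℝ} (hc : ∀ k a b, ContinuousOn (c k a b) B)
    (h : ∀ z ∈ B, ∀ k a, pd k (u a) z = ∑ b, c k a b z * u b z) {x y : E4} (hx : x ∈ B)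
    (hy : y ∈ B) (h0 : ∀ a, u a x = 0) (a : ι) : u a y = 0 := by
  -- Along the segment from x to y, the system is a linear ordinary differential equation with
  -- continuous coefficients, so Grönwall's inequality applies.
  set γ : ℝ → E4 := fun t => x + t • (y - x) with hγ
  have hγc : Continuous γ := by fun_prop
  have hγB : ∀ t ∈ Set.Icc (0 : ℝ) 1, γ t ∈ B := fun t ht =>
    hconv.add_smul_sub_mem hx hy ht
  have hγd : ∀ t, HasDerivAt γ (y - x) t := by
    intro t
    have := ((hasDerivAt_id t).smul_const (y - x)).const_add x
    rwa [one_smul] at this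
  set F : ℝ → ι → ℝ := fun t a => u a (γ t) with hF
  set F' : ℝ → ι → ℝ := fun t a => ∑ k, (y - x) k * ∑ b, c k a b (γ t) * u b (γ t) with hF'
  set κ : ℝ → ℝ := fun t => ∑ k, ∑ a, ∑ b, |(y - x) k| * |c k a b (γ t)| with hκ
  have hderiv : ∀ t ∈ Set.Icc (0 : ℝ) 1, HasDerivAt F (F' t) t := by
    intro t ht
    rw [hasDerivAt_pi]
    intro a
    have hd := (differentiableAt_of_smooth hB (hγB t ht) (hu a)).hasFDerivAt.comp_hasDerivAt t
      (hγd t)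
    rw [fderiv_eq_sum_pd] at hd
    simp only [h _ (hγB t ht)] at hd
    exact hd
  have hκc : ContinuousOn κ (Set.Icc 0 1) := by
    refine continuousOn_finsetSum _ fun k _ => continuousOn_finsetSum _ fun a _ =>
      continuousOn_finsetSum _ fun b _ => continuousOn_const.mul ?_
    exact ((hc k a b).comp hγc.continuousOn hγB).abs
  obtain ⟨K, hK⟩ := isCompact_Icc.bddAbove_image hκc
  have hbound : ∀ t ∈ Set.Ico (0 : ℝ) 1, ‖F' t‖ ≤ K * ‖F t‖ := by
    intro t ht
    have hκK : κ t ≤ K := hK ⟨t, Set.Ico_subset_Icc_self ht, rfl⟩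
    have h1 : ‖F' t‖ ≤ κ t * ‖F t‖ := by
      refine (pi_norm_le_iff_of_nonneg ?_).mpr fun a => ?_
      · exact mul_nonneg (Finset.sum_nonneg fun _ _ => Finset.sum_nonneg fun _ _ =>
          Finset.sum_nonneg fun _ _ => by positivity) (norm_nonneg _)
      · calc ‖F' t a‖ ≤ ∑ k, ∑ b, |(y - x) k| * |c k a b (γ t)| * ‖F t‖ := by
              simp only [hF', Finset.mul_sum]
              refine (norm_sum_le _ _).trans (Finset.sum_le_sum fun k _ =>
                (norm_sum_le _ _).trans (Finset.sum_le_sum fun b _ => ?_))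
              rw [norm_mul, norm_mul, ← mul_assoc]
              exact mul_le_mul_of_nonneg_left (norm_le_pi_norm (F t) b) (by positivity)
          _ ≤ κ t * ‖F t‖ := by
              simp only [hκ, ← Finset.sum_mul]
              refine mul_le_mul_of_nonneg_right (Finset.sum_le_sum fun k _ => ?_) (norm_nonneg _)
              exact Finset.single_le_sum (f := fun a => ∑ b, |(y - x) k| * |c k a b (γ t)|)
                (fun _ _ => Finset.sum_nonneg fun _ _ => by positivity) (Finset.mem_univ a)
    exact h1.trans (mul_le_mul_of_nonneg_right hκK (norm_nonneg _))
  have hzero := eq_zero_of_abs_deriv_le_mul_abs_self_of_eq_zero_right (f := F) (f' := F') (K := K)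
    (a := 0) (b := 1) (fun t ht => (hderiv t ht).continuousAt.continuousWithinAt)
    (fun t ht => (hderiv t (Set.Ico_subset_Icc_self ht)).hasDerivWithinAt)
    (by ext a; simp [hF, hγ, h0]) hbound 1 (by simp)
  have := congrFun hzero a
  simpa [hF, hγ] using this

/-- Prolongation: since ∇(∇X) is linear in X, the pair (X, ∇X) satisfies a closed linear first-order
system. It vanishes at x together with its first component near x, hence everywhere on the convex
set. -/
theorem killing_eq_zero (hG : IsMetricOn G O) (hconv : Convex ℝ O) (hX : SmoothVec O X)
    (hK : ∀ z ∈ O, ∀ i j, lieDerivMetric G X z i j = 0) {x : E4} (hx : x ∈ O)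
    (h0 : ∀ᶠ z in nhds x, X z = 0) : ∀ z ∈ O, X z = 0 := by
  obtain ⟨V, hV, hVo, hxV⟩ := eventually_nhds_iff.mp h0
  have hA0 : nablaV G X x = 0 := by
    ext i k
    have : covV G k X x = 0 := by
      rw [covV, pdV_congr hVo hxV (Y := fun _ => 0) hV, pdV_const, hV x hxV, mulVec_zero, zero_add]
    exact congrFun this i
  have hA := smoothMat_nablaV hG hX
  have hpA : ∀ z ∈ O, ∀ k, pdM k (nablaV G X) z
      = ∑ l, X z l • curvM G k l z - gam G k z * nablaV G X z + nablaV G X z * gam G k z := by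
    intro z hz k
    rw [← cov_nablaV_of_killing hG hz hX hK, cov]
    abel
  have hpX : ∀ z, ∀ k i, pd k (fun z => X z i) z = nablaV G X z i k - (gam G k z *ᵥ X z) i := by
    intro z k i
    simp [nablaV, covV, pdV]
  -- The unknowns are the 4 components of X and the 16 of ∇X; the coefficients `c` are read off from
  -- `hpX` and `hpA`.
  let u : Fin 4 ⊕ Fin 4 × Fin 4 → E4 → ℝ :=
    Sum.elim (fun i z => X z i) (fun p z => nablaV G X z p.1 p.2)
  let c : Fin 4 → Fin 4 ⊕ Fin 4 × Fin 4 → Fin 4 ⊕ Fin 4 × Fin 4 → E4 → ℝ := fun k =>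
    Sum.elim
      (fun i => Sum.elim (fun j z => -gam G k z i j)
        (fun q _ => (1 : Mat4) i q.1 * (1 : Mat4) k q.2))
      (fun p => Sum.elim (fun l z => curvM G k l z p.1 p.2)
        (fun q z => -gam G k z p.1 q.1 * (1 : Mat4) p.2 q.2
          + (1 : Mat4) p.1 q.1 * gam G k z q.2 p.2))
  have hcurv : ∀ k l, SmoothMat O (curvM G k l) := by
    intro k l
    rw [show curvM G k l = _ from funext fun z => curvM_eq G k l z]
    exact (((hG.smooth_gam l).pdM hG.isOpen k).sub ((hG.smooth_gam k).pdM hG.isOpen l)).add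
      (((hG.smooth_gam k).mul (hG.smooth_gam l)).sub ((hG.smooth_gam l).mul (hG.smooth_gam k)))
  have hc : ∀ k a b, ContinuousOn (c k a b) O := by
    rintro k (i | p) (j | q)
    · exact (hG.smooth_gam k i j).continuousOn.neg
    · exact continuousOn_const
    · exact (hcurv k j p.1 p.2).continuousOn
    · exact ((hG.smooth_gam k p.1 q.1).continuousOn.neg.mul continuousOn_const).add
        (continuousOn_const.mul (hG.smooth_gam k q.2 p.2).continuousOn)
  intro z hz
  ext i
  refine eq_zero_of_linear_system hG.isOpen hconv (u := u) (c := c) ?_ hc ?_ hx hz ?_ (Sum.inl i)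
  · rintro (i | p)
    · exact hX i
    · exact hA p.1 p.2
  · rintro z hz k (i | ⟨i, j⟩)
    · have : pd k (u (Sum.inl i)) z = _ := hpX z k i
      rw [this, Fintype.sum_sum_type, Fintype.sum_prod_type]
      simp [u, c, Matrix.one_apply, mulVec, dotProduct]
      ring
    · have : pd k (u (Sum.inr (i, j))) z = _ := congrFun (congrFun (hpA z hz k) i) j
      rw [this, Fintype.sum_sum_type, Fintype.sum_prod_type]
      simp [u, c, Matrix.one_apply, mul_apply, Matrix.sum_apply, add_mul, Finset.sum_add_distrib]
      simp only [mul_comm (X z _), mul_comm (nablaV G X z i _)]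
      ring
  · rintro (i | p)
    · exact congrFun (hV x hxV) i
    · exact congrFun (congrFun hA0 p.1) p.2

/-- If Φ = 0 on O, the twistor equation gives 2Λ (e_k ∧ X)⁺ = 0 for every k, and this determines X =
0 pointwise. -/
theorem killing_eq_zero_of_sdNabla (hE : IsEinsteinASDOn G O Λ) (hΛ : Λ ≠ 0) (hX : SmoothVec O X)
    (hK : ∀ z ∈ O, ∀ i j, lieDerivMetric G X z i j = 0) (h : ∀ z ∈ O, sdNabla G X z = 0)
    (hy : y ∈ O) : X y = 0 := by
  have hG := hE.toIsMetricOn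
  have hg := hG.posDef y hy
  have h1 : ∀ k, sdPart (G y) (wedge (G y) (Pi.single k 1) (X y)) = 0 := by
    intro k
    have h2 := cov_sdPart_nablaV hE hy hX hK k
    rw [cov_congr hG.isOpen hy (S := fun z => sdPart (G z) (nablaV G X z)) (T := fun _ => 0) h, cov, pdM_const] at h2
    simp only [Matrix.mul_zero, Matrix.zero_mul, add_zero, sub_zero] at h2
    exact (smul_eq_zero.mp h2.symm).resolve_left (mul_ne_zero two_ne_zero hΛ)
  apply eq_zero_of_sdPart_wedge hg
  intro a
  have h3 : ∀ b c, wedge (G y) b c = -wedge (G y) c b := fun b c => by simp [wedge]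
  rw [h3, wedge_sum_right, ← Finset.sum_neg_distrib, sdPart_sum]
  refine Finset.sum_eq_zero fun l _ => ?_
  rw [← smul_neg, ← h3, sdPart_smul, h1, smul_zero]

end

/-! ### Components of tensor fields in charts -/

section
variable {M : Type*} [TopologicalSpace M] [ChartedSpace E4 M]
  {e : OpenPartialHomeomorph M E4} {y : E4}

theorem coordComp_add (v w : TangentSpace (𝓡 4) (e.symm y)) :
    coordComp e y (v + w) = coordComp e y v + coordComp e y w := by
  ext i
  exact congrArg (fun w : E4 => w i) (map_add (mfderiv (𝓡 4) (𝓡 4) e (e.symm y)) v w)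

theorem coordComp_smul (r : ℝ) (v : TangentSpace (𝓡 4) (e.symm y)) :
    coordComp e y (r • v) = r • coordComp e y v := by
  ext i
  exact congrArg (fun w : E4 => w i) (map_smul (mfderiv (𝓡 4) (𝓡 4) e (e.symm y)) r v)

/-- The components of a tangent vector as a linear map. -/
def coordCompL (e : OpenPartialHomeomorph M E4) (y : E4) :
    TangentSpace (𝓡 4) (e.symm y) →ₗ[ℝ] (Fin 4 → ℝ) where
  toFun := coordComp e y
  map_add' := coordComp_add
  map_smul' := coordComp_smul

theorem isOpen_chartDomain {M : Type*} [TopologicalSpace M] (e : OpenPartialHomeomorph M E4)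
    {U : Set M} (hU : IsOpen U) :
    IsOpen (chartDomain e U) := e.isOpen_inter_preimage_symm hU

section mfld
variable [IsManifold (𝓡 4) ∞ M]

theorem mdifferentiable_of_atlas (he : e ∈ atlas E4 M) : e.MDifferentiable (𝓡 4) (𝓡 4) :=
  haveI : IsManifold (𝓡 4) 1 M := IsManifold.of_le (n := ∞) (by simp)
  mdifferentiable_of_mem_atlas he

theorem coordComp_eq_iff (he : e ∈ atlas E4 M) (hy : y ∈ e.target)
    (v : TangentSpace (𝓡 4) (e.symm y)) (w : E4) :
    (show E4 from mfderiv (𝓡 4) (𝓡 4) e (e.symm y) v) = w ↔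
      v = mfderiv (𝓡 4) (𝓡 4) e.symm y w := by
  have hd := mdifferentiable_of_atlas he
  have h1 := hd.comp_symm_deriv hy
  have h2 := hd.symm_comp_deriv (e.map_target hy)
  rw [e.right_inv hy] at h2
  constructor
  · rintro rfl
    exact (DFunLike.congr_fun h2 v).symm
  · rintro rfl
    exact DFunLike.congr_fun h1 w

theorem eq_sum_coordFrame (he : e ∈ atlas E4 M) (hy : y ∈ e.target)
    (v : TangentSpace (𝓡 4) (e.symm y)) : v = ∑ i, coordComp e y v i • coordFrame e y i := by
  have h := (coordComp_eq_iff he hy v _).mp rfl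
  conv_lhs => rw [h]
  have hw : ∀ w : E4, w = ∑ i, w i • EuclideanSpace.single i (1 : ℝ) := by
    intro w
    ext i
    simp [Pi.single_apply]
  conv_lhs => rw [hw (show E4 from mfderiv (𝓡 4) (𝓡 4) e (e.symm y) v)]
  erw [map_sum]
  refine Finset.sum_congr rfl fun i _ => ?_
  erw [map_smul]
  rfl

theorem coordComp_coordFrame (he : e ∈ atlas E4 M) (hy : y ∈ e.target) (i j : Fin 4) :
    coordComp e y (coordFrame e y j) i = (1 : Mat4) i j := by
  have h := (coordComp_eq_iff he hy (coordFrame e y j) (EuclideanSpace.single j 1)).mpr rfl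
  have h2 := congrArg (fun w : E4 => w i) h
  refine h2.trans ?_
  simp [Matrix.one_apply]

theorem coordComp_sum (he : e ∈ atlas E4 M) (hy : y ∈ e.target) (a : Fin 4 → ℝ) :
    coordComp e y (∑ i, a i • coordFrame e y i) = a := by
  have h : coordCompL e y (∑ i, a i • coordFrame e y i) = a := by
    rw [map_sum]
    simp only [map_smul]
    ext j
    rw [Finset.sum_apply]
    simp only [Pi.smul_apply, smul_eq_mul]
    have : ∀ i, coordCompL e y (coordFrame e y i) j = (1 : Mat4) j i :=
      fun i => coordComp_coordFrame he hy j i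
    simp [this, Matrix.one_apply]
  exact h

theorem coordComp_injective (he : e ∈ atlas E4 M) (hy : y ∈ e.target)
    {v w : TangentSpace (𝓡 4) (e.symm y)} (h : coordComp e y v = coordComp e y w) : v = w := by
  rw [eq_sum_coordFrame he hy v, eq_sum_coordFrame he hy w, h]

theorem coordComp_endo (J : EndoField M) (he : e ∈ atlas E4 M) (hy : y ∈ e.target)
    (v : TangentSpace (𝓡 4) (e.symm y)) :
    coordComp e y (J (e.symm y) v) = endoComp J e y *ᵥ coordComp e y v := by
  have h : coordCompL e y (J (e.symm y) v) = endoComp J e y *ᵥ coordComp e y v := by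
    conv_lhs => rw [eq_sum_coordFrame he hy v]
    rw [map_sum, map_sum]
    simp only [map_smul]
    ext j
    rw [Finset.sum_apply]
    exact Finset.sum_congr rfl fun i _ => mul_comm _ _
  exact h

theorem bilin_apply (h : BilinField M) (he : e ∈ atlas E4 M) (hy : y ∈ e.target)
    (v w : TangentSpace (𝓡 4) (e.symm y)) :
    h (e.symm y) v w = coordComp e y v ⬝ᵥ bilinComp h e y *ᵥ coordComp e y w := by
  conv_lhs => rw [eq_sum_coordFrame he hy v, eq_sum_coordFrame he hy w]
  simp only [map_sum, map_smul, _root_.sum_apply, _root_.smul_apply, dotProduct, mulVec,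
    Finset.mul_sum, smul_eq_mul, bilinComp, of_apply]
  refine Finset.sum_comm.trans (Finset.sum_congr rfl fun i _ => Finset.sum_congr rfl fun j _ => ?_)
  ring

theorem bilinComp_comp (h : BilinField M) (J : EndoField M) (he : e ∈ atlas E4 M)
    (hy : y ∈ e.target) :
    bilinComp (fun x => (h x).comp (J x)) e y = (endoComp J e y)ᵀ * bilinComp h e y := by
  ext i j
  have h1 : bilinComp (fun x => (h x).comp (J x)) e y i j
      = h (e.symm y) (J (e.symm y) (coordFrame e y i)) (coordFrame e y j) := rfl
  rw [h1, bilin_apply h he hy]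
  have h2 : coordComp e y (coordFrame e y j) = Pi.single j 1 := by
    ext k
    rw [coordComp_coordFrame he hy, Matrix.one_apply, Pi.single_apply]
  rw [h2, mulVec_single_one]
  rfl

theorem endoComp_mul_self (J : EndoField M) (he : e ∈ atlas E4 M) (hy : y ∈ e.target)
    (h : ∀ v, J (e.symm y) (J (e.symm y) v) = -v) : endoComp J e y * endoComp J e y = -1 := by
  ext i j
  have h1 := congrArg (fun v => coordComp e y v i) (h (coordFrame e y j))
  simp only [coordComp_endo J he hy] at h1
  have h2 : coordComp e y (coordFrame e y j) = Pi.single j 1 := by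
    ext k
    rw [coordComp_coordFrame he hy, Matrix.one_apply, Pi.single_apply]
  rw [h2, mulVec_mulVec, mulVec_single_one] at h1
  refine h1.trans ?_
  rw [← neg_one_smul ℝ (coordFrame e y j), coordComp_smul, h2, Pi.smul_apply, Matrix.neg_apply,
    Matrix.one_apply, Pi.single_apply, smul_eq_mul, neg_one_mul]

theorem orthogonal_endoComp (h : BilinField M) (J : EndoField M) (he : e ∈ atlas E4 M)
    (hy : y ∈ e.target)
    (hJ : ∀ v w, h (e.symm y) (J (e.symm y) v) (J (e.symm y) w) = h (e.symm y) v w) :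
    (endoComp J e y)ᵀ * bilinComp h e y * endoComp J e y = bilinComp h e y := by
  ext i j
  have h1 := hJ (coordFrame e y i) (coordFrame e y j)
  have h2 : ∀ j, coordComp e y (coordFrame e y j) = Pi.single j 1 := by
    intro j
    ext k
    rw [coordComp_coordFrame he hy, Matrix.one_apply, Pi.single_apply]
  rw [bilin_apply h he hy, coordComp_endo J he hy, coordComp_endo J he hy, h2, h2,
    mulVec_single_one, mulVec_single_one] at h1
  refine Eq.trans ?_ h1
  rw [Matrix.mul_assoc]
  rfl

theorem posDef_bilinComp (g : Metric4 M) (he : e ∈ atlas E4 M) (hy : y ∈ e.target) :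
    (bilinComp g.inner e y).PosDef := by
  refine Matrix.PosDef.of_dotProduct_mulVec_pos ?_ fun a ha => ?_
  · ext i j
    exact g.symm _ _ _
  · have h := bilin_apply g.inner he hy (∑ i, a i • coordFrame e y i) (∑ i, a i • coordFrame e y i)
    rw [coordComp_sum he hy] at h
    rw [star_trivial, ← h]
    refine g.pos _ _ fun h0 => ha ?_
    have := coordComp_sum he hy a
    rw [h0] at this
    rw [← this]
    exact map_zero (coordCompL e y)

/-! ### Smoothness of components -/

theorem contMDiffOn_tangentMap_symm (he : e ∈ atlas E4 M) {O : Set E4} (hO : O ⊆ e.target)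
    {V : E4 → E4} (hV : ContDiffOn ℝ ∞ V O) :
    ContMDiffOn (𝓡 4) (𝓡 4).tangent ∞ (fun y => (⟨e.symm y,
      mfderiv (𝓡 4) (𝓡 4) e.symm y (V y)⟩ : TangentBundle (𝓡 4) M)) O := by
  have h1 : ContMDiffOn (𝓡 4) (𝓡 4) ∞ e.symm e.target :=
    contMDiffOn_symm_of_mem_maximalAtlas (IsManifold.subset_maximalAtlas he)
  have h2 := h1.contMDiffOn_tangentMapWithin (m := ∞) (by simp) e.open_target.uniqueMDiffOn
  have h3 : ContMDiffOn (𝓡 4) (𝓡 4).tangent ∞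
      (fun y => (⟨y, V y⟩ : TangentBundle (𝓡 4) E4)) O :=
    contMDiffOn_vectorSpace_iff_contDiffOn.mpr hV
  refine (h2.comp h3 fun y hy => hO hy).congr fun y hy => ?_
  simp only [Function.comp, tangentMapWithin]
  rw [mfderivWithin_of_isOpen e.open_target (hO hy)]

theorem contMDiffOn_coordFrame (he : e ∈ atlas E4 M) (i : Fin 4) :
    ContMDiffOn (𝓡 4) (𝓡 4).tangent ∞ (fun y => (⟨e.symm y, coordFrame e y i⟩ :
      TangentBundle (𝓡 4) M)) e.target :=
  contMDiffOn_tangentMap_symm he le_rfl contDiffOn_const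

theorem smooth_bilinComp (g : Metric4 M) (he : e ∈ atlas E4 M) :
    SmoothMat e.target (bilinComp g.inner e) := by
  intro i j
  have hb : ContMDiffOn (𝓡 4) (𝓡 4) ∞ e.symm e.target :=
    contMDiffOn_symm_of_mem_maximalAtlas (IsManifold.subset_maximalAtlas he)
  have : ContMDiffOn (𝓡 4) ((𝓡 4).prod 𝓘(ℝ)) ∞
      (fun y ↦ Bundle.TotalSpace.mk' ℝ (E := Bundle.Trivial M ℝ) (e.symm y)
        (g.inner (e.symm y) (coordFrame e y i) (coordFrame e y j))) e.target := by
    apply ContMDiffOn.clm_bundle_apply₂ (F₁ := E4) (F₂ := E4)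
    · exact g.contMDiff.comp_contMDiffOn hb
    · exact contMDiffOn_coordFrame he i
    · exact contMDiffOn_coordFrame he j
  intro y hy
  have h2 := this y hy
  simp only [Bundle.contMDiffWithinAt_totalSpace] at h2
  exact h2.2.contDiffWithinAt

theorem smooth_vecComp {X : VField M} {U : Set M}
    (hX : ContMDiffOn (𝓡 4) (𝓡 4).tangent ∞ (fun x => (⟨x, X x⟩ : TangentBundle (𝓡 4) M)) U)
    (he : e ∈ atlas E4 M) : SmoothVec (chartDomain e U) (vecComp X e) := by
  have hb : ContMDiffOn (𝓡 4) (𝓡 4) ∞ e.symm e.target :=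
    contMDiffOn_symm_of_mem_maximalAtlas (IsManifold.subset_maximalAtlas he)
  have h1 : ContMDiffOn (𝓡 4) (𝓡 4) ∞ e e.source :=
    contMDiffOn_of_mem_maximalAtlas (IsManifold.subset_maximalAtlas he)
  have h2 := h1.contMDiffOn_tangentMapWithin (m := ∞) (by simp) e.open_source.uniqueMDiffOn
  have h3 : ContMDiffOn (𝓡 4) (𝓡 4).tangent ∞
      (fun y => (⟨e.symm y, X (e.symm y)⟩ : TangentBundle (𝓡 4) M)) (chartDomain e U) :=
    hX.comp (hb.mono Set.inter_subset_left) fun y hy => hy.2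
  have h4 := h2.comp h3 fun y hy => e.map_target hy.1
  have h5 : ContMDiffOn (𝓡 4) (𝓡 4).tangent ∞ (fun y => (⟨y,
      mfderiv (𝓡 4) (𝓡 4) e (e.symm y) (X (e.symm y))⟩ : TangentBundle (𝓡 4) E4))
      (chartDomain e U) := by
    refine h4.congr fun y hy => ?_
    simp only [Function.comp, tangentMapWithin]
    rw [mfderivWithin_of_isOpen e.open_source (e.map_target hy.1), e.right_inv hy.1]
  have h6 := contMDiffOn_vectorSpace_iff_contDiffOn.mp h5
  intro i
  exact (contDiffOn_euclidean.mp h6) i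

theorem contMDiffOn_of_vecComp {X : VField M} {U : Set M} (hU : IsOpen U)
    (hX : ∀ e ∈ atlas E4 M, SmoothVec (chartDomain e U) (vecComp X e)) :
    ContMDiffOn (𝓡 4) (𝓡 4).tangent ∞ (fun x => (⟨x, X x⟩ : TangentBundle (𝓡 4) M)) U := by
  intro x hx
  have he := chart_mem_atlas E4 x
  have hxs := mem_chart_source E4 x
  set e := chartAt E4 x with hedef
  have h1 := contMDiffOn_tangentMap_symm he (O := chartDomain e U) Set.inter_subset_left
    (V := fun y => mfderiv (𝓡 4) (𝓡 4) e (e.symm y) (X (e.symm y)))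
    (contDiffOn_euclidean.mpr fun i => hX e he i)
  have h2 : ContMDiffOn (𝓡 4) (𝓡 4) ∞ e (e.source ∩ U) :=
    (contMDiffOn_of_mem_maximalAtlas (IsManifold.subset_maximalAtlas he)).mono
      Set.inter_subset_left
  have h3 := h1.comp h2 fun z hz => ⟨e.map_source hz.1, by
    rw [Set.mem_preimage, e.left_inv hz.1]
    exact hz.2⟩
  have h4 : ContMDiffOn (𝓡 4) (𝓡 4).tangent ∞
      (fun x => (⟨x, X x⟩ : TangentBundle (𝓡 4) M)) (e.source ∩ U) := by
    refine h3.congr fun z hz => ?_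
    have h5 : ∀ y ∈ e.target, (⟨e.symm y, X (e.symm y)⟩ : TangentBundle (𝓡 4) M)
        = ⟨e.symm y, mfderiv (𝓡 4) (𝓡 4) e.symm y
          (mfderiv (𝓡 4) (𝓡 4) e (e.symm y) (X (e.symm y)))⟩ := by
      intro y hy
      rw [← (coordComp_eq_iff he hy (X (e.symm y)) _).mp rfl]
    have h6 := h5 (e z) (e.map_source hz.1)
    exact (congrArg (fun x => (⟨x, X x⟩ : TangentBundle (𝓡 4) M)) (e.left_inv hz.1).symm).trans h6
  exact (h4.contMDiffAt ((e.open_source.inter hU).mem_nhds ⟨hxs, hx⟩)).contMDiffWithinAt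

end mfld

end

/-! ### From Kähler metrics to Killing fields on manifolds -/

theorem IsEinsteinASDOn.mono {G : E4 → Mat4} {O O' : Set E4} {Λ : ℝ} (h : IsEinsteinASDOn G O Λ)
    (ho : IsOpen O') (hs : O' ⊆ O) : IsEinsteinASDOn G O' Λ where
  isOpen := ho
  smooth := fun i j => (h.smooth i j).mono hs
  posDef := fun z hz => h.posDef z (hs hz)
  einstein := fun z hz => h.einstein z (hs hz)
  asd := fun z hz => h.asd z (hs hz)

section
variable {M : Type*} [TopologicalSpace M] [ChartedSpace E4 M] [IsManifold (𝓡 4) ∞ M]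
  {e : OpenPartialHomeomorph M E4} {y : E4} {g : Metric4 M} {Λ : ℝ} {U : Set M}

theorem isEinsteinASDOn_chart (hE : IsEinstein g.inner Λ) (hA : IsAntiSelfDual g.inner)
    (he : e ∈ atlas E4 M) : IsEinsteinASDOn (bilinComp g.inner e) e.target Λ where
  isOpen := e.open_target
  smooth := smooth_bilinComp g he
  posDef := fun _ hy => posDef_bilinComp g he hy
  einstein := hE e he
  asd := hA e he

theorem exists_metric_dual (g : Metric4 M) (x : M) (l : TangentSpace (𝓡 4) x →L[ℝ] ℝ) :
    ∃ v, ∀ w, g.inner x v w = l w := by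
  have : FiniteDimensional ℝ (TangentSpace (𝓡 4) x) :=
    inferInstanceAs (FiniteDimensional ℝ E4)
  let f : TangentSpace (𝓡 4) x →ₗ[ℝ] Module.Dual ℝ (TangentSpace (𝓡 4) x) :=
    { toFun := fun v => (g.inner x v).toLinearMap
      map_add' := fun v w => by ext; simp
      map_smul' := fun r v => by ext; simp }
  have hinj : Function.Injective f := by
    rw [injective_iff_map_eq_zero]
    intro v hv
    by_contra h
    exact (g.pos x v h).ne' (LinearMap.congr_fun hv v)
  have hsurj := (LinearMap.injective_iff_surjective_of_finrank_eq_finrank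
    Subspace.dual_finrank_eq.symm).mp hinj
  obtain ⟨v, hv⟩ := hsurj l.toLinearMap
  exact ⟨v, fun w => LinearMap.congr_fun hv w⟩

theorem contDiffOn_comp_symm {Ω : M → ℝ} (hΩ : ContMDiffOn (𝓡 4) 𝓘(ℝ, ℝ) ∞ Ω U)
    (he : e ∈ atlas E4 M) : ContDiffOn ℝ ∞ (fun y => Ω (e.symm y)) (chartDomain e U) := by
  have hb : ContMDiffOn (𝓡 4) (𝓡 4) ∞ e.symm e.target :=
    contMDiffOn_symm_of_mem_maximalAtlas (IsManifold.subset_maximalAtlas he)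
  exact (hΩ.comp (hb.mono Set.inter_subset_left) fun y hy => hy.2).contDiffOn

theorem bilinComp_smul (g : Metric4 M) (Ω : M → ℝ) (e : OpenPartialHomeomorph M E4) :
    bilinComp (fun x => (Ω x) ^ 2 • g.inner x) e
      = conformal (fun y => Ω (e.symm y)) (bilinComp g.inner e) := by
  ext y i j
  rfl

/-- Here v is the gradient of Ω, so the global field Ω⁻² J grad Ω has the local expression ρ⁻¹ J
grad log ρ: one factor ρ⁻¹ comes from the logarithm. It is thereby independent of the chart, and it
inherits smoothness from its components. -/
theorem vecComp_smul_endo {Ω : M → ℝ} {J : EndoField M} {v : VField M} (hU : IsOpen U)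
    (hΩ : ContMDiffOn (𝓡 4) 𝓘(ℝ, ℝ) ∞ Ω U)
    (hv : ∀ x w, g.inner x (v x) w = mfderiv (𝓡 4) 𝓘(ℝ, ℝ) Ω x w)
    (he : e ∈ atlas E4 M) (hy : y ∈ chartDomain e U) :
    vecComp (fun x => (Ω x)⁻¹ ^ 2 • J x (v x)) e y
      = hamiltonianField (bilinComp g.inner e) (fun y => Ω (e.symm y)) (endoComp J e) y := by
  have hG := posDef_bilinComp g he hy.1
  have hgr : bilinComp g.inner e y *ᵥ coordComp e y (v (e.symm y))
      = fun k => pd k (fun y => Ω (e.symm y)) y := by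
    ext k
    have h1 := hv (e.symm y) (coordFrame e y k)
    have h2 : coordComp e y (coordFrame e y k) = Pi.single k 1 := by
      ext l
      rw [coordComp_coordFrame he hy.1, Matrix.one_apply, Pi.single_apply]
    rw [g.symm, bilin_apply g.inner he hy.1, h2, single_one_dotProduct] at h1
    rw [h1]
    have hd : MDifferentiableAt (𝓡 4) 𝓘(ℝ, ℝ) Ω (e.symm y) :=
      (hΩ.contMDiffAt (hU.mem_nhds hy.2)).mdifferentiableAt (by simp)
    have hc := mfderiv_comp y hd ((mdifferentiable_of_atlas he).mdifferentiableAt_symm hy.1)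
    have h3 : pd k (fun y => Ω (e.symm y)) y
        = mfderiv (𝓡 4) 𝓘(ℝ, ℝ) (Ω ∘ e.symm) y (EuclideanSpace.single k (1 : ℝ) : E4) := by
      rw [mfderiv_eq_fderiv]
      rfl
    rw [h3, hc]
    rfl
  have hv' : coordComp e y (v (e.symm y))
      = (bilinComp g.inner e y)⁻¹ *ᵥ fun k => pd k (fun y => Ω (e.symm y)) y := by
    rw [← hgr, mulVec_mulVec, nonsing_inv_mul _ (isUnit_det_of_posDef hG), one_mulVec]
  have h4 : vecComp (fun x => (Ω x)⁻¹ ^ 2 • J x (v x)) e y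
      = (Ω (e.symm y))⁻¹ ^ 2 • (endoComp J e y *ᵥ coordComp e y (v (e.symm y))) := by
    rw [← coordComp_endo J he hy.1, ← coordComp_smul]
    rfl
  have h5 : (fun k => pd k (fun y => Ω (e.symm y)) y / Ω (e.symm y))
      = (Ω (e.symm y))⁻¹ • fun k => pd k (fun y => Ω (e.symm y)) y := by
    ext k
    rw [Pi.smul_apply, smul_eq_mul, div_eq_inv_mul]
  rw [h4, hv', hamiltonianField, gradLog, h5, mulVec_smul, mulVec_smul, smul_smul, ← pow_two]

/-- The Kähler form h(J·,·) has matrix JᵀG = -GJ up to the conformal factor, by orthogonality and J²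
= -1. The star on two-forms is linear and conformally invariant, so self-duality passes to J and to
the original metric. -/
theorem hodgeEndo_of_isKahlerOn {Ω : M → ℝ} {J : EndoField M} (hp : ∀ x ∈ U, 0 < Ω x)
    (hK : IsKahlerOn (fun x => (Ω x) ^ 2 • g.inner x) J U)
    (he : e ∈ atlas E4 M) (hy : y ∈ chartDomain e U) :
    hodgeEndo (bilinComp g.inner e y) (endoComp J e y) = endoComp J e y := by
  have hG := posDef_bilinComp g he hy.1
  have hr : 0 < Ω (e.symm y) ^ 2 := pow_pos (hp _ hy.2) 2
  have h1 := hK.selfDual e he y hy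
  have hsq := endoComp_mul_self J he hy.1 (hK.square _ hy.2)
  have hor : (endoComp J e y)ᵀ * bilinComp g.inner e y * endoComp J e y
      = bilinComp g.inner e y := by
    refine orthogonal_endoComp g.inner J he hy.1 fun v w => ?_
    have := hK.orthogonal _ hy.2 v w
    exact mul_left_cancel₀ hr.ne' this
  have hsk : (endoComp J e y)ᵀ * bilinComp g.inner e y
      = -(bilinComp g.inner e y * endoComp J e y) := by
    have := congrArg (fun Z => Z * endoComp J e y) hor
    simp only [Matrix.mul_assoc, hsq] at this
    rw [← this]
    simp
  rw [bilinComp_comp _ J he hy.1, bilinComp_smul, conformal, Matrix.mul_smul, hsk,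
    hodgeStar_smul_metric _ _ hr, hodgeStar_smul] at h1
  have h2 := smul_right_injective _ hr.ne' h1
  rw [← neg_one_smul ℝ (_ * _), hodgeStar_smul] at h2
  have h3 := smul_right_injective _ (by norm_num : (-1 : ℝ) ≠ 0) h2
  rw [hodgeEndo, h3, nonsing_inv_mul_cancel_left _ _ (isUnit_det_of_posDef hG)]

theorem admitsKilling_of_conformalToKahler (hΛ : Λ ≠ 0) (hE : IsEinstein g.inner Λ)
    (hA : IsAntiSelfDual g.inner) (hU : IsOpen U) (hne : U.Nonempty)
    (h : IsConformalToKahlerOn g.inner U) : AdmitsKilling g.inner U := by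
  obtain ⟨Ω, J, hΩ, hp, hK⟩ := h
  choose v hv using fun x => exists_metric_dual g x (mfderiv (𝓡 4) 𝓘(ℝ, ℝ) Ω x)
  have hloc : ∀ e ∈ atlas E4 M, IsEinsteinASDOn (bilinComp g.inner e) (chartDomain e U) Λ :=
    fun e he => (isEinsteinASDOn_chart hE hA he).mono (isOpen_chartDomain e hU)
      Set.inter_subset_left
  have hsm : ∀ e ∈ atlas E4 M, SmoothMat (chartDomain e U) (endoComp J e) :=
    fun e he i j => hK.smooth e he i j
  have hsd : ∀ e ∈ atlas E4 M, ∀ z ∈ chartDomain e U,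
      hodgeEndo (bilinComp g.inner e z) (endoComp J e z) = endoComp J e z :=
    fun e he z hz => hodgeEndo_of_isKahlerOn hp hK he hz
  have hpar : ∀ e ∈ atlas E4 M, ∀ z ∈ chartDomain e U, ∀ k,
      cov (conformal (fun y => Ω (e.symm y)) (bilinComp g.inner e)) k (endoComp J e) z = 0 := by
    intro e he z hz k
    ext i j
    rw [← covDerivEndo_eq, ← bilinComp_smul]
    exact hK.parallel e he z hz k i j
  have hmain := fun e (he : e ∈ atlas E4 M) y (hy : y ∈ chartDomain e U) =>
    killing_of_kahler (hloc e he) (contDiffOn_comp_symm hΩ he) (fun z hz => hp _ hz.2)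
      (hsm e he) (hsd e he) (hpar e he) hy
  have hvec := fun e (he : e ∈ atlas E4 M) y (hy : y ∈ chartDomain e U) =>
    vecComp_smul_endo (J := J) hU hΩ hv he hy
  -- This field is -J grad (1/Ω), the gradient being taken for g.
  refine ⟨fun x => (Ω x)⁻¹ ^ 2 • J x (v x), ⟨contMDiffOn_of_vecComp hU fun e he i => ?_,
    fun e he y hy i j => ?_⟩, ?_⟩
  · exact (smooth_hamiltonianField (hloc e he).toIsMetricOn (contDiffOn_comp_symm hΩ he)
      (fun z hz => hp _ hz.2) (hsm e he) i).congr fun y hy => congrFun (hvec e he y hy) i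
  · rw [← (hmain e he y hy).1 i j, lieDerivMetric, lieDerivMetric]
    refine Finset.sum_congr rfl fun k _ => ?_
    have ho := isOpen_chartDomain e hU
    rw [hvec e he y hy, pd_congr ho hy fun z hz => congrFun (hvec e he z hz) k,
      pd_congr ho hy fun z hz => congrFun (hvec e he z hz) k]
  · obtain ⟨x, hx⟩ := hne
    have he := chart_mem_atlas E4 x
    have hxs := mem_chart_source E4 x
    set e := chartAt E4 x
    have hy : e x ∈ chartDomain e U := ⟨e.map_source hxs, by
      rw [Set.mem_preimage, e.left_inv hxs]
      exact hx⟩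
    have hJ : endoComp J e (e x) ≠ 0 := by
      intro h0
      have h1 := endoComp_mul_self J he hy.1 (hK.square _ hy.2)
      rw [h0, Matrix.mul_zero] at h1
      exact zero_ne_one (neg_eq_zero.mp h1.symm).symm
    obtain ⟨z, hz, hz0⟩ := (hmain e he _ hy).2 hΛ hJ
    refine ⟨e.symm z, hz.2, fun h0 => hz0 ?_⟩
    rw [← hvec e he z hz]
    have : vecComp (fun x => (Ω x)⁻¹ ^ 2 • J x (v x)) e z = coordCompL e z 0 :=
      congrArg (coordCompL e z) h0
    rw [this, map_zero]

end

/-! ### Changes of coordinates -/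

section
variable {G G' : E4 → Mat4} {O O' : Set E4} {y : E4} {X X' : E4 → Fin 4 → ℝ} {ψ : E4 → E4}

/-- The Jacobian matrix. -/
def jac (ψ : E4 → E4) (z : E4) : Mat4 := of fun a i => pd i (fun z => ψ z a) z

theorem fderiv_single_apply (h : DifferentiableAt ℝ ψ y) (a i : Fin 4) :
    (fderiv ℝ ψ y (EuclideanSpace.single i 1)) a = jac ψ y a i := by
  have h1 : HasFDerivAt (fun z => ψ z a)
      ((EuclideanSpace.proj a : E4 →L[ℝ] ℝ).comp (fderiv ℝ ψ y)) y :=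
    (EuclideanSpace.proj a : E4 →L[ℝ] ℝ).hasFDerivAt.comp y h.hasFDerivAt
  rw [jac, of_apply, pd, h1.fderiv]
  rfl

theorem det_fderiv (h : DifferentiableAt ℝ ψ y) : (fderiv ℝ ψ y).det = (jac ψ y).det := by
  have h1 : LinearMap.toMatrix (EuclideanSpace.basisFun (Fin 4) ℝ).toBasis
      (EuclideanSpace.basisFun (Fin 4) ℝ).toBasis (fderiv ℝ ψ y : E4 →ₗ[ℝ] E4) = jac ψ y := by
    ext a i
    rw [LinearMap.toMatrix_apply, ← fderiv_single_apply h]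
    simp
  rw [← h1, LinearMap.det_toMatrix]

theorem pd_comp {f : E4 → ℝ} (hf : DifferentiableAt ℝ f (ψ y)) (h : DifferentiableAt ℝ ψ y)
    (i : Fin 4) : pd i (fun z => f (ψ z)) y = ∑ a, jac ψ y a i * pd a f (ψ y) := by
  have h1 : HasFDerivAt (fun z => f (ψ z)) ((fderiv ℝ f (ψ y)).comp (fderiv ℝ ψ y)) y :=
    hf.hasFDerivAt.comp y h.hasFDerivAt
  rw [pd, h1.fderiv, ContinuousLinearMap.comp_apply, fderiv_eq_sum_pd]
  simp only [fderiv_single_apply h]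

theorem SmoothMat.jac (hO : IsOpen O) (hψ : ContDiffOn ℝ ∞ ψ O) : SmoothMat O (jac ψ) :=
  fun a i => smooth_pd hO (contDiffOn_euclidean.mp hψ a) i

theorem pd_jac_symm (hO : IsOpen O) (hψ : ContDiffOn ℝ ∞ ψ O) (hy : y ∈ O) (a i j : Fin 4) :
    pd i (fun z => jac ψ z a j) y = pd j (fun z => jac ψ z a i) y :=
  pd_comm hO hy (contDiffOn_euclidean.mp hψ a) i j

/-- The exterior derivative of the one-form dual to a vector field. -/
theorem pd_lower_sub (hG : IsMetricOn G O) (hy : y ∈ O) (hX : SmoothVec O X) (i j : Fin 4) :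
    pd i (fun z => (G z *ᵥ X z) j) y - pd j (fun z => (G z *ᵥ X z) i) y
      = (G y * nablaV G X y) j i - (G y * nablaV G X y) i j := by
  have h1 : ∀ i j, pd i (fun z => (G z *ᵥ X z) j) y
      = (G y * nablaV G X y) j i + ((gam G i y)ᵀ *ᵥ (G y *ᵥ X y)) j := by
    intro i j
    have h2 : (G y * nablaV G X y) j i = (G y *ᵥ covV G i X y) j := rfl
    have h3 := congrFun (pdV_mulVec hG.isOpen hy hG.smooth hX i) j
    rw [pdM_metric hG hy] at h3
    refine h3.trans ?_
    rw [h2, covV]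
    simp only [mulVec_add, add_mulVec, mulVec_mulVec, Pi.add_apply]
    ring
  have h4 : ((gam G i y)ᵀ *ᵥ (G y *ᵥ X y)) j = ((gam G j y)ᵀ *ᵥ (G y *ᵥ X y)) i := by
    simp only [mulVec, dotProduct, transpose_apply]
    exact Finset.sum_congr rfl fun m _ => by rw [gam_symm hG hy]
  rw [h1, h1, h4]
  ring

/-- The covariant derivative of a Killing field transforms as an endomorphism field. -/
theorem nablaV_pullback (hG : IsMetricOn G O) (hG' : IsMetricOn G' O') (hψ : ContDiffOn ℝ ∞ ψ O)
    (hm : ∀ z ∈ O, ψ z ∈ O') (hP : ∀ z ∈ O, IsUnit (jac ψ z).det)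
    (hgg : ∀ z ∈ O, G z = (jac ψ z)ᵀ * G' (ψ z) * jac ψ z)
    (hX : SmoothVec O X) (hX' : SmoothVec O' X') (hXX : ∀ z ∈ O, X' (ψ z) = jac ψ z *ᵥ X z)
    (hK : ∀ z ∈ O, ∀ i j, lieDerivMetric G X z i j = 0)
    (hK' : ∀ z ∈ O', ∀ i j, lieDerivMetric G' X' z i j = 0) (hy : y ∈ O) :
    nablaV G X y = (jac ψ y)⁻¹ * nablaV G' X' (ψ y) * jac ψ y := by
  have hO := hG.isOpen
  have hd := (hψ.contDiffAt (hO.mem_nhds hy)).differentiableAt (by simp)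
  have hJ := SmoothMat.jac hO hψ
  have hθs : SmoothVec O' (fun w => G' w *ᵥ X' w) := hG'.smooth.mulVec hX'
  have hθ : ∀ z ∈ O, G z *ᵥ X z = (jac ψ z)ᵀ *ᵥ (G' (ψ z) *ᵥ X' (ψ z)) := by
    intro z hz
    rw [hgg z hz, hXX z hz]
    simp only [mulVec_mulVec, Matrix.mul_assoc]
  have hθc : ∀ a, ContDiffOn ℝ ∞ (fun z => (G' (ψ z) *ᵥ X' (ψ z)) a) O := fun a =>
    (hθs a).comp hψ hm
  have h1 : ∀ i j, pd i (fun z => (G z *ᵥ X z) j) y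
      = ∑ a, pd i (fun z => jac ψ z a j) y * (G' (ψ y) *ᵥ X' (ψ y)) a
        + ∑ a, ∑ b, jac ψ y a j * jac ψ y b i * pd b (fun w => (G' w *ᵥ X' w) a) (ψ y) := by
    intro i j
    rw [pd_congr hO hy (h := fun z => ∑ a, jac ψ z a j * (G' (ψ z) *ᵥ X' (ψ z)) a)
      (fun z hz => congrFun (hθ z hz) j), pd_sum _ hO hy fun a _ => (hJ a j).mul (hθc a),
      ← Finset.sum_add_distrib]
    refine Finset.sum_congr rfl fun a _ => ?_
    rw [pd_mul hO hy (hJ a j) (hθc a), pd_comp (f := fun w => (G' w *ᵥ X' w) a)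
      (differentiableAt_of_smooth hG'.isOpen (hm y hy) (hθs a)) hd, Finset.mul_sum]
    congr 1
    exact Finset.sum_congr rfl fun b _ => by ring
  -- The exterior derivative commutes with pullback: the second derivatives of ψ are symmetric and
  -- cancel, so no transformation law for Christoffel symbols is needed.
  have h2 : ∀ i j, pd i (fun z => (G z *ᵥ X z) j) y - pd j (fun z => (G z *ᵥ X z) i) y
      = ∑ a, ∑ b, jac ψ y a j * jac ψ y b i * (pd b (fun w => (G' w *ᵥ X' w) a) (ψ y)
        - pd a (fun w => (G' w *ᵥ X' w) b) (ψ y)) := by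
    intro i j
    have h3 : ∑ a, ∑ b, jac ψ y a i * jac ψ y b j * pd b (fun w => (G' w *ᵥ X' w) a) (ψ y)
        = ∑ a, ∑ b, jac ψ y a j * jac ψ y b i * pd a (fun w => (G' w *ᵥ X' w) b) (ψ y) := by
      rw [Finset.sum_comm]
      exact Finset.sum_congr rfl fun a _ => Finset.sum_congr rfl fun b _ => by ring
    rw [h1, h1, h3]
    simp only [pd_jac_symm hO hψ hy _ i j, mul_sub, Finset.sum_sub_distrib]
    ring
  have hs := (isKilling_iff hG hy).mp (hK y hy)
  have hs' := (isKilling_iff hG' (hm y hy)).mp (hK' _ (hm y hy))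
  have hb : ∀ i j, (G y * nablaV G X y) i j = -(G y * nablaV G X y) j i :=
    fun i j => congrFun (congrFun hs j) i
  have hb' : ∀ i j, (G' (ψ y) * nablaV G' X' (ψ y)) i j
      = -(G' (ψ y) * nablaV G' X' (ψ y)) j i := fun i j => congrFun (congrFun hs' j) i
  -- For a Killing field the lowered ∇X is skew, hence up to sign half the exterior derivative of
  -- X♭, and it pulls back as a two-form.
  have h4 : G y * nablaV G X y
      = (jac ψ y)ᵀ * (G' (ψ y) * nablaV G' X' (ψ y)) * jac ψ y := by
    ext j i
    have h5 := h2 i j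
    simp only [pd_lower_sub hG hy hX, pd_lower_sub hG' (hm y hy) hX'] at h5
    rw [hb i j] at h5
    have h6 : ∀ a b, (G' (ψ y) * nablaV G' X' (ψ y)) a b - (G' (ψ y) * nablaV G' X' (ψ y)) b a
        = 2 * (G' (ψ y) * nablaV G' X' (ψ y)) a b := by
      intro a b
      rw [hb' b a]
      ring
    simp only [h6] at h5
    have h7 : ((jac ψ y)ᵀ * (G' (ψ y) * nablaV G' X' (ψ y)) * jac ψ y) j i
        = ∑ a, ∑ b, jac ψ y a j * jac ψ y b i * (G' (ψ y) * nablaV G' X' (ψ y)) a b := by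
      rw [mul_apply, Finset.sum_comm]
      refine Finset.sum_congr rfl fun b _ => ?_
      rw [mul_apply, Finset.sum_mul]
      exact Finset.sum_congr rfl fun a _ => by rw [transpose_apply]; ring
    rw [h7]
    have h8 : ∀ a b, jac ψ y a j * jac ψ y b i * (2 * (G' (ψ y) * nablaV G' X' (ψ y)) a b)
        = 2 * (jac ψ y a j * jac ψ y b i * (G' (ψ y) * nablaV G' X' (ψ y)) a b) :=
      fun a b => by ring
    simp only [h8, ← Finset.mul_sum] at h5
    linarith
  have hu := isUnit_det_of_posDef (hG.posDef y hy)
  rw [← mul_conj_inv _ _ (hP y hy), ← hgg y hy] at h4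
  have h9 := congrArg (fun Z => (G y)⁻¹ * Z) h4
  simpa only [nonsing_inv_mul_cancel_left _ _ hu] using h9

theorem sdNabla_pullback (hG : IsMetricOn G O) (hG' : IsMetricOn G' O') (hψ : ContDiffOn ℝ ∞ ψ O)
    (hm : ∀ z ∈ O, ψ z ∈ O') (hP : ∀ z ∈ O, 0 < (jac ψ z).det)
    (hgg : ∀ z ∈ O, G z = (jac ψ z)ᵀ * G' (ψ z) * jac ψ z)
    (hX : SmoothVec O X) (hX' : SmoothVec O' X') (hXX : ∀ z ∈ O, X' (ψ z) = jac ψ z *ᵥ X z)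
    (hK : ∀ z ∈ O, ∀ i j, lieDerivMetric G X z i j = 0)
    (hK' : ∀ z ∈ O', ∀ i j, lieDerivMetric G' X' z i j = 0) (hy : y ∈ O) :
    sdNabla G X y = (jac ψ y)⁻¹ * sdNabla G' X' (ψ y) * jac ψ y := by
  rw [sdNabla, nablaV_pullback hG hG' hψ hm (fun z hz => (hP z hz).ne'.isUnit) hgg hX hX' hXX hK
    hK' hy, hgg y hy, sdPart_conj _ _ _ (hP y hy), sdNabla]

theorem normSqEndo_conj {P : Mat4} (hP : IsUnit P.det) (T : Mat4) :
    normSqEndo (P⁻¹ * T * P) = normSqEndo T := by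
  rw [normSqEndo, ← conj_mul hP, trace_conj hP, normSqEndo]

end

/-! ### The self-dual part of the covariant derivative of a Killing field on a manifold -/

section
variable {M : Type*} [TopologicalSpace M] [ChartedSpace E4 M]
  {e e' : OpenPartialHomeomorph M E4} {x : M} {y : E4}

/-- The components of a tangent vector at a given point. -/
def tangentComp (e : OpenPartialHomeomorph M E4) (x : M) (v : TangentSpace (𝓡 4) x) (i : Fin 4) :
    ℝ := (show E4 from mfderiv (𝓡 4) (𝓡 4) e x v) i

theorem tangentComp_symm (v : TangentSpace (𝓡 4) (e.symm y)) :
    tangentComp e (e.symm y) v = coordComp e y v := rfl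

theorem exists_eq_symm {M : Type*} [TopologicalSpace M] {e : OpenPartialHomeomorph M E4} {x : M}
    (hx : x ∈ e.source) : ∃ y ∈ e.target, e.symm y = x :=
  ⟨e x, e.map_source hx, e.left_inv hx⟩

theorem vecComp_apply (X : VField M) (hx : x ∈ e.source) :
    vecComp X e (e x) = tangentComp e x (X x) := by
  obtain ⟨y, hy, rfl⟩ := exists_eq_symm hx
  rw [e.right_inv hy]
  rfl

variable [IsManifold (𝓡 4) ∞ M]

theorem bilin_tangentComp (h : BilinField M) (he : e ∈ atlas E4 M) (hx : x ∈ e.source)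
    (v w : TangentSpace (𝓡 4) x) :
    h x v w = tangentComp e x v ⬝ᵥ bilinComp h e (e x) *ᵥ tangentComp e x w := by
  obtain ⟨y, hy, rfl⟩ := exists_eq_symm hx
  rw [e.right_inv hy]
  exact bilin_apply h he hy v w

theorem tangentComp_trans (he : e ∈ atlas E4 M) (he' : e' ∈ atlas E4 M) (hx : x ∈ e.source)
    (hx' : x ∈ e'.source) (v : TangentSpace (𝓡 4) x) :
    tangentComp e' x v = jac (e.symm.trans e') (e x) *ᵥ tangentComp e x v := by
  obtain ⟨y, hy, rfl⟩ := exists_eq_symm hx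
  rw [e.right_inv hy]
  have hd1 := (mdifferentiable_of_atlas he).mdifferentiableAt_symm hy
  have hd2 := (mdifferentiable_of_atlas he').mdifferentiableAt hx'
  have hc := mfderiv_comp y hd2 hd1
  have hd3 : DifferentiableAt ℝ (e.symm.trans e') y :=
    mdifferentiableAt_iff_differentiableAt.mp (hd2.comp y hd1)
  have h1 : ∀ j, tangentComp e' (e.symm y) (coordFrame e y j)
      = fun a => jac (e.symm.trans e') y a j := by
    intro j
    ext a
    rw [← fderiv_single_apply hd3, ← mfderiv_eq_fderiv]
    change _ = (show E4 from mfderiv (𝓡 4) (𝓡 4) (e' ∘ e.symm) y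
      (EuclideanSpace.single j 1 : E4)) a
    rw [hc]
    rfl
  let l : TangentSpace (𝓡 4) (e.symm y) →ₗ[ℝ] (Fin 4 → ℝ) :=
    { toFun := tangentComp e' (e.symm y)
      map_add' := fun v w => by
        ext i
        exact congrArg (fun w : E4 => w i) (map_add (mfderiv (𝓡 4) (𝓡 4) e' (e.symm y)) v w)
      map_smul' := fun r v => by
        ext i
        exact congrArg (fun w : E4 => w i) (map_smul (mfderiv (𝓡 4) (𝓡 4) e' (e.symm y)) r v) }
  have h2 : l v = ∑ i, coordComp e y v i • l (coordFrame e y i) := by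
    conv_lhs => rw [eq_sum_coordFrame he hy v, map_sum]
    simp only [map_smul]
  refine h2.trans ?_
  ext a
  rw [Finset.sum_apply]
  change ∑ i, (coordComp e y v i • l (coordFrame e y i)) a = ∑ i, _ * coordComp e y v i
  refine Finset.sum_congr rfl fun i _ => ?_
  rw [Pi.smul_apply, smul_eq_mul, mul_comm]
  exact congrArg (fun f => f a * coordComp e y v i) (h1 i)

theorem smooth_trans (he : e ∈ atlas E4 M) (he' : e' ∈ atlas E4 M) :
    ContDiffOn ℝ ∞ (e.symm.trans e') (e.symm.trans e').source := by
  have h1 : ContMDiffOn (𝓡 4) (𝓡 4) ∞ e.symm e.target :=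
    contMDiffOn_symm_of_mem_maximalAtlas (IsManifold.subset_maximalAtlas he)
  have h2 : ContMDiffOn (𝓡 4) (𝓡 4) ∞ e' e'.source :=
    contMDiffOn_of_mem_maximalAtlas (IsManifold.subset_maximalAtlas he')
  have hs : (e.symm.trans e').source ⊆ e.target := fun y hy => hy.1
  have h3 := h2.comp (h1.mono hs) fun y hy => hy.2
  exact h3.contDiffOn

theorem det_jac_trans_pos (hM : IsOrientedAtlas M) (he : e ∈ atlas E4 M) (he' : e' ∈ atlas E4 M)
    (hy : y ∈ (e.symm.trans e').source) : 0 < (jac (e.symm.trans e') y).det := by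
  have h := hM e he e' he' y hy
  rwa [det_fderiv] at h
  exact ((smooth_trans he he').contDiffAt
    ((e.symm.trans e').open_source.mem_nhds hy)).differentiableAt (by simp)

theorem bilinComp_trans (h : BilinField M) (he : e ∈ atlas E4 M)
    (he' : e' ∈ atlas E4 M) (hy : y ∈ (e.symm.trans e').source) :
    bilinComp h e y = (jac (e.symm.trans e') y)ᵀ * bilinComp h e' (e.symm.trans e' y)
      * jac (e.symm.trans e') y := by
  have hy1 : y ∈ e.target := hy.1
  have hx := e.map_target hy1
  have hx' : e.symm y ∈ e'.source := hy.2
  ext i j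
  have h1 := bilin_tangentComp h he' hx' (coordFrame e y i) (coordFrame e y j)
  have h2 : ∀ j, tangentComp e (e.symm y) (coordFrame e y j) = Pi.single j 1 := by
    intro j
    ext k
    rw [tangentComp_symm, coordComp_coordFrame he hy1, Matrix.one_apply, Pi.single_apply]
  rw [tangentComp_trans he he' hx hx', tangentComp_trans he he' hx hx', h2, h2,
    e.right_inv hy1, mulVec_single_one, mulVec_single_one] at h1
  refine h1.trans ?_
  rw [Matrix.mul_assoc]
  rfl

/-- On the overlap of two charts, the metric and X are related by the Jacobian of the transition
map. The oriented atlas makes its determinant positive, without which self-dual and anti-self-dual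
parts could be exchanged. -/
theorem sdNabla_trans {g : Metric4 M} {X : VField M} {U : Set M} (hM : IsOrientedAtlas M)
    (hU : IsOpen U) (hX : IsKillingOn g.inner X U) (he : e ∈ atlas E4 M) (he' : e' ∈ atlas E4 M)
    (hx : x ∈ e.source) (hx' : x ∈ e'.source) (hxU : x ∈ U) :
    sdNabla (bilinComp g.inner e) (vecComp X e) (e x)
      = (jac (e.symm.trans e') (e x))⁻¹ * sdNabla (bilinComp g.inner e') (vecComp X e') (e' x)
        * jac (e.symm.trans e') (e x) := by
  have hmet : ∀ e ∈ atlas E4 M, IsMetricOn (bilinComp g.inner e) e.target := fun e he =>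
    ⟨e.open_target, smooth_bilinComp g he, fun _ hy => posDef_bilinComp g he hy⟩
  set O : Set E4 := (e.symm.trans e').source ∩ chartDomain e U with hO
  have hOo : IsOpen O := (e.symm.trans e').open_source.inter (isOpen_chartDomain e hU)
  have hG : IsMetricOn (bilinComp g.inner e) O := ⟨hOo,
    fun i j => ((hmet e he).smooth i j).mono fun y hy => hy.2.1,
    fun y hy => (hmet e he).posDef y hy.2.1⟩
  have hG' : IsMetricOn (bilinComp g.inner e') (chartDomain e' U) := ⟨isOpen_chartDomain e' hU,
    fun i j => ((hmet e' he').smooth i j).mono fun y hy => hy.1,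
    fun y hy => (hmet e' he').posDef y hy.1⟩
  have hy : e x ∈ O := ⟨⟨e.map_source hx, by simpa [e.left_inv hx] using hx'⟩,
    e.map_source hx, by simpa [e.left_inv hx] using hxU⟩
  have h := sdNabla_pullback (X := vecComp X e) (X' := vecComp X e') hG hG'
    ((smooth_trans he he').mono fun y hy => hy.1)
    (fun y hy => ⟨e'.map_source hy.1.2, by
      have h1 : e'.symm (e' (e.symm y)) = e.symm y := e'.left_inv hy.1.2
      change e'.symm (e' (e.symm y)) ∈ U
      rw [h1]
      exact hy.2.2⟩)
    (fun y hy => det_jac_trans_pos hM he he' hy.1)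
    (fun y hy => bilinComp_trans g.inner he he' hy.1)
    (fun i => (smooth_vecComp hX.1 he i).mono fun y hy => hy.2) (smooth_vecComp hX.1 he')
    (fun y hy => by
      have h1 := vecComp_apply X (e := e') (x := e.symm y) hy.1.2
      have h2 := tangentComp_trans he he' (e.map_target hy.2.1) hy.1.2 (X (e.symm y))
      rw [e.right_inv hy.2.1] at h2
      exact h1.trans h2)
    (fun y hy => hX.2 e he y hy.2) (fun y hy => hX.2 e' he' y hy) hy
  have h1 : (e.symm.trans e') (e x) = e' x := congrArg e' (e.left_inv hx)
  rwa [h1] at h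

/-- The self-dual part of the covariant derivative of a Killing field and its squared norm. -/
theorem exists_sdNabla_field {g : Metric4 M} {X : VField M} {U : Set M} (hM : IsOrientedAtlas M)
    (hU : IsOpen U) (hX : IsKillingOn g.inner X U) : ∃ (Φ : EndoField M) (s : M → ℝ),
    ∀ e ∈ atlas E4 M, ∀ y ∈ chartDomain e U,
      endoComp Φ e y = sdNabla (bilinComp g.inner e) (vecComp X e) y ∧
      s (e.symm y) = normSqEndo (sdNabla (bilinComp g.inner e) (vecComp X e) y) := by
  have hpt : ∀ x : M, ∃ (Φ : TangentSpace (𝓡 4) x →L[ℝ] TangentSpace (𝓡 4) x) (s : ℝ),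
      x ∈ U → ∀ e ∈ atlas E4 M, x ∈ e.source →
        (∀ v, tangentComp e x (Φ v)
          = sdNabla (bilinComp g.inner e) (vecComp X e) (e x) *ᵥ tangentComp e x v) ∧
        s = normSqEndo (sdNabla (bilinComp g.inner e) (vecComp X e) (e x)) := by
    intro x
    have he0 := chart_mem_atlas E4 x
    have hx0 := mem_chart_source E4 x
    set e0 := chartAt E4 x
    -- At each point the endomorphism is built from the preferred chart there; `sdNabla_trans` gives
    -- its components in all other charts.
    set S := sdNabla (bilinComp g.inner e0) (vecComp X e0) (e0 x)
    let F : E4 →L[ℝ] E4 := Matrix.toEuclideanCLM (𝕜 := ℝ) S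
    let A : E4 →L[ℝ] E4 := mfderiv (𝓡 4) (𝓡 4) e0 x
    let B : E4 →L[ℝ] E4 := mfderiv (𝓡 4) (𝓡 4) e0.symm (e0 x)
    refine ⟨B.comp (F.comp A), normSqEndo S, fun hxU e he hx => ?_⟩
    have h0 : ∀ v : TangentSpace (𝓡 4) x,
        tangentComp e0 x (B (F (A v))) = S *ᵥ tangentComp e0 x v := by
      intro v
      have h1 := (mdifferentiable_of_atlas he0).comp_symm_deriv (e0.map_source hx0)
      rw [e0.left_inv hx0] at h1
      have h2 : A (B (F (A v))) = F (A v) := DFunLike.congr_fun h1 (F (A v))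
      ext i
      refine (congrArg (fun w : E4 => w i) h2).trans ?_
      rfl
    have ht := sdNabla_trans hM hU hX he0 he hx0 hx hxU
    have hu : IsUnit (jac (e0.symm.trans e) (e0 x)).det :=
      (det_jac_trans_pos hM he0 he ⟨e0.map_source hx0, by simpa [e0.left_inv hx0] using hx⟩).ne'.isUnit
    refine ⟨fun v => ?_, ?_⟩
    · refine (tangentComp_trans he0 he hx0 hx (B (F (A v)))).trans ?_
      refine (congrArg (_ *ᵥ ·) (h0 v)).trans ?_
      rw [tangentComp_trans he0 he hx0 hx v]
      simp only [S]
      rw [ht]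
      simp only [mulVec_mulVec, Matrix.mul_assoc, mul_nonsing_inv_cancel_left _ _ hu]
    · simp only [S]
      rw [ht, normSqEndo_conj hu]
  choose Φ s h using hpt
  refine ⟨Φ, s, fun e he y hy => ?_⟩
  obtain ⟨h1, h2⟩ := h (e.symm y) hy.2 e he (e.map_target hy.1)
  rw [e.right_inv hy.1] at h1 h2
  refine ⟨?_, h2⟩
  ext i j
  have h3 := congrFun (h1 (coordFrame e y j)) i
  have h4 : tangentComp e (e.symm y) (coordFrame e y j) = Pi.single j 1 := by
    ext k
    rw [tangentComp_symm, coordComp_coordFrame he hy.1, Matrix.one_apply, Pi.single_apply]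
  rw [h4, mulVec_single_one] at h3
  exact h3

end

/-! ### From Killing fields to Kähler metrics on manifolds -/

theorem transpose_mul_mul_of_sd {G T : Mat4} (hG : G.PosDef) (hT : hodgeEndo G T = T)
    (h : T * T = -1) : Tᵀ * G = -(G * T) ∧ Tᵀ * G * T = G := by
  have h1 := skew_of_sd hG hT
  rw [transpose_mul, transpose_eq_of_posDef hG] at h1
  refine ⟨h1, ?_⟩
  rw [h1, Matrix.neg_mul, Matrix.mul_assoc, h, Matrix.mul_neg, neg_neg, Matrix.mul_one]

section
variable {M : Type*} [TopologicalSpace M] [ChartedSpace E4 M] {x : M} {U : Set M}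

theorem exists_chart_point (x : M) : ∃ e ∈ atlas E4 M, ∃ y ∈ e.target, e.symm y = x :=
  ⟨_, chart_mem_atlas E4 x, exists_eq_symm (mem_chart_source E4 x)⟩

theorem exists_ball_subset_chartDomain (hU : IsOpen U) (hx : x ∈ U) : ∃ r > 0,
    Metric.ball (chartAt E4 x x) r ⊆ chartDomain (chartAt E4 x) U := by
  have hxs := mem_chart_source E4 x
  refine Metric.isOpen_iff.mp (isOpen_chartDomain _ hU) _ ⟨(chartAt E4 x).map_source hxs, ?_⟩
  rw [Set.mem_preimage, (chartAt E4 x).left_inv hxs]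
  exact hx

end

section
variable {M : Type*} [TopologicalSpace M] [ChartedSpace E4 M] [IsManifold (𝓡 4) ∞ M]
  {e : OpenPartialHomeomorph M E4} {x : M} {y : E4} {g : Metric4 M} {Λ : ℝ} {U V : Set M}
  {X : VField M}

theorem IsKillingOn.mono {h : BilinField M} (hX : IsKillingOn h X U) (hV : V ⊆ U) :
    IsKillingOn h X V :=
  ⟨hX.1.mono hV, fun e he y hy => hX.2 e he y ⟨hy.1, hV hy.2⟩⟩

theorem contMDiffOn_of_comp_symm {f : M → ℝ} (hU : IsOpen U)
    (hf : ∀ e ∈ atlas E4 M, ContDiffOn ℝ ∞ (fun y => f (e.symm y)) (chartDomain e U)) :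
    ContMDiffOn (𝓡 4) 𝓘(ℝ, ℝ) ∞ f U := by
  intro x hx
  have he := chart_mem_atlas E4 x
  have hxs := mem_chart_source E4 x
  set e := chartAt E4 x
  have h1 : ContMDiffOn (𝓡 4) (𝓡 4) ∞ e (e.source ∩ U) :=
    (contMDiffOn_of_mem_maximalAtlas (IsManifold.subset_maximalAtlas he)).mono
      Set.inter_subset_left
  have h2 := (hf e he).contMDiffOn.comp h1 fun z hz => ⟨e.map_source hz.1, by
    rw [Set.mem_preimage, e.left_inv hz.1]
    exact hz.2⟩
  have h3 : ContMDiffOn (𝓡 4) 𝓘(ℝ, ℝ) ∞ f (e.source ∩ U) :=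
    h2.congr fun z hz => (congrArg f (e.left_inv hz.1)).symm
  exact (h3.contMDiffAt ((e.open_source.inter hU).mem_nhds ⟨hxs, hx⟩)).contMDiffWithinAt

theorem eq_zero_iff_vecComp (he : e ∈ atlas E4 M) (hy : y ∈ e.target) :
    X (e.symm y) = 0 ↔ vecComp X e y = 0 := by
  have h0 : coordComp e y 0 = 0 := map_zero (coordCompL e y)
  constructor
  · intro h
    rw [← h0, ← h]
    rfl
  · intro h
    exact coordComp_injective he hy (h.trans h0.symm)

/-- Unique continuation for Killing fields. -/
theorem IsKillingOn.eq_zero (hX : IsKillingOn g.inner X U) (hU : IsOpen U) (hUc : IsPreconnected U)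
    (hx : x ∈ U) (h0 : ∀ᶠ z in nhds x, X z = 0) : ∀ z ∈ U, X z = 0 := by
  -- The points near which X vanishes form an open set. It is also closed relative to U: a limit
  -- point lies in a coordinate ball, where `killing_eq_zero` propagates the zeros.
  have hsub : U ⊆ {x | ∀ᶠ z in nhds x, X z = 0} := by
    refine hUc.subset_of_closure_inter_subset isOpen_setOfPred_eventually_nhds ⟨x, hx, h0⟩ ?_
    rintro w ⟨hw, hwU⟩
    have he := chart_mem_atlas E4 w
    have hws := mem_chart_source E4 w
    obtain ⟨r, hr, hB⟩ := exists_ball_subset_chartDomain hU hwU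
    set e := chartAt E4 w
    have hN : IsOpen (e.source ∩ e ⁻¹' Metric.ball (e w) r) :=
      e.isOpen_inter_preimage Metric.isOpen_ball
    have hwN : w ∈ e.source ∩ e ⁻¹' Metric.ball (e w) r := ⟨hws, Metric.mem_ball_self hr⟩
    obtain ⟨v, hvN, hv⟩ := mem_closure_iff.mp hw _ hN hwN
    have hG : IsMetricOn (bilinComp g.inner e) (Metric.ball (e w) r) := ⟨Metric.isOpen_ball,
      fun i j => (smooth_bilinComp g he i j).mono fun y hy => (hB hy).1,
      fun y hy => posDef_bilinComp g he (hB hy).1⟩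
    have hv' : ∀ᶠ z in nhds (e v), vecComp X e z = 0 := by
      have h1 := (e.eventually_nhds' (fun z => X z = 0) hvN.1).mpr hv
      filter_upwards [h1, e.open_target.mem_nhds (e.map_source hvN.1)] with z hz hzt
      exact (eq_zero_iff_vecComp he hzt).mp hz
    have h2 := killing_eq_zero hG (convex_ball _ _)
      (fun i => (smooth_vecComp hX.1 he i).mono hB) (fun y hy => hX.2 e he y (hB hy)) hvN.2 hv'
    filter_upwards [hN.mem_nhds hwN] with z hz
    have h3 := (eq_zero_iff_vecComp he (e.map_source hz.1)).mpr (h2 _ hz.2)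
    rwa [e.left_inv hz.1] at h3
  exact fun z hz => (hsub hz).self_of_nhds

/-- An arbitrary open V need not be connected, and X may vanish identically on some components. A
coordinate ball around a point where X ≠ 0 avoids both difficulties. -/
theorem exists_isConnected_isKillingOn {h : BilinField M} (hV : IsOpen V)
    (hX : AdmitsKilling h V) :
    ∃ W, IsOpen W ∧ W ⊆ V ∧ IsConnected W ∧ AdmitsKilling h W := by
  obtain ⟨X, hK, x, hx, hX0⟩ := hX
  have hxs := mem_chart_source E4 x
  obtain ⟨r, hr, hB⟩ := exists_ball_subset_chartDomain hV hx
  set e := chartAt E4 x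
  have hxW : x ∈ e.symm '' Metric.ball (e x) r :=
    ⟨e x, Metric.mem_ball_self hr, e.left_inv hxs⟩
  have hBt : Metric.ball (e x) r ⊆ e.target := fun y hy => (hB hy).1
  have hWV : e.symm '' Metric.ball (e x) r ⊆ V := by
    rintro _ ⟨y, hy, rfl⟩
    exact (hB hy).2
  exact ⟨_, e.isOpen_image_symm_of_subset_target Metric.isOpen_ball hBt, hWV,
    ⟨⟨x, hxW⟩, (convex_ball _ _).isPreconnected.image _ (e.continuousOn_symm.mono hBt)⟩,
    X, hK.mono hWV, x, hxW, hX0⟩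

/-- V is the set where s = |(∇X)⁺|² is nonzero, with Ω = s^(-1/2) and J = ΩΦ there. Away from V
nothing can be divided by s, and unique continuation shows that little is lost. -/
theorem conformalToKahler_of_killing (hM : IsOrientedAtlas M) (hΛ : Λ ≠ 0)
    (hE : IsEinstein g.inner Λ) (hA : IsAntiSelfDual g.inner) (hU : IsOpen U)
    (hUc : IsPreconnected U) (h : AdmitsKilling g.inner U) :
    ∃ V : Set M, IsOpen V ∧ V ⊆ U ∧ U ⊆ closure V ∧ IsConformalToKahlerOn g.inner V := by
  obtain ⟨X, hX, x₀, hx₀, hX0⟩ := h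
  obtain ⟨Φ, s, hΦ⟩ := exists_sdNabla_field hM hU hX
  have hloc : ∀ e ∈ atlas E4 M, ∀ W, IsOpen W →
      IsEinsteinASDOn (bilinComp g.inner e) (chartDomain e W) Λ := fun e he W hW =>
    (isEinsteinASDOn_chart hE hA he).mono (isOpen_chartDomain e hW) Set.inter_subset_left
  have hsm : ∀ e ∈ atlas E4 M, SmoothMat (chartDomain e U)
      (sdNabla (bilinComp g.inner e) (vecComp X e)) := fun e he =>
    smooth_sdNabla (hloc e he U hU).toIsMetricOn (smooth_vecComp hX.1 he)
  have hsd : ∀ e ∈ atlas E4 M, ∀ y ∈ chartDomain e U,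
      hodgeEndo (bilinComp g.inner e y) (sdNabla (bilinComp g.inner e) (vecComp X e) y)
        = sdNabla (bilinComp g.inner e) (vecComp X e) y := fun e he y hy =>
    hodgeEndo_sdNabla (hloc e he U hU).toIsMetricOn hy (hX.2 e he y hy)
  have hss : ∀ e ∈ atlas E4 M, ContDiffOn ℝ ∞ (fun y => s (e.symm y)) (chartDomain e U) :=
    fun e he => (smooth_normSqEndo (hsm e he)).congr fun y hy => (hΦ e he y hy).2
  have hs0 : ∀ x ∈ U, 0 ≤ s x := by
    intro x hx
    obtain ⟨e, he, y, hy, rfl⟩ := exists_chart_point x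
    rw [(hΦ _ he y ⟨hy, hx⟩).2]
    exact (sd_mul_self_eq (posDef_bilinComp g he hy) (hsd _ he y ⟨hy, hx⟩)).2.1
  set V : Set M := U ∩ {x | s x ≠ 0} with hVdef
  have hVo : IsOpen V :=
    (contMDiffOn_of_comp_symm hU hss).continuousOn.isOpen_inter_preimage hU isOpen_ne
  have hdom : ∀ e : OpenPartialHomeomorph M E4, chartDomain e V ⊆ chartDomain e U :=
    fun e y hy => ⟨hy.1, hy.2.1⟩
  have hsp : ∀ x ∈ V, 0 < s x := fun x hx => lt_of_le_of_ne (hs0 x hx.1) hx.2.symm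
  refine ⟨V, hVo, Set.inter_subset_left, fun x hx => ?_, fun x => (Real.sqrt (s x))⁻¹,
    fun x => (Real.sqrt (s x))⁻¹ • Φ x, ?_, fun x hx => inv_pos.mpr (Real.sqrt_pos.mpr (hsp x hx)),
    ?_⟩
  -- Off the closure of V, s vanishes on an open set, so (∇X)⁺ = 0 and X = 0 there; connectedness of
  -- U would then give X = 0 at `x₀`.
  · by_contra hxc
    have hWo : IsOpen (U ∩ (closure V)ᶜ) := hU.inter isClosed_closure.isOpen_compl
    have hs : ∀ z ∈ U ∩ (closure V)ᶜ, s z = 0 := fun z hz =>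
      by_contra fun h => hz.2 (subset_closure ⟨hz.1, h⟩)
    have he := chart_mem_atlas E4 x
    have hxs := mem_chart_source E4 x
    set e := chartAt E4 x
    refine hX0 (hX.eq_zero hU hUc hx ?_ x₀ hx₀)
    filter_upwards [(e.open_source.inter hWo).mem_nhds ⟨hxs, hx, hxc⟩] with z hz
    have hzd : e z ∈ chartDomain e (U ∩ (closure V)ᶜ) := ⟨e.map_source hz.1, by
      rw [Set.mem_preimage, e.left_inv hz.1]
      exact hz.2⟩
    have hd : chartDomain e (U ∩ (closure V)ᶜ) ⊆ chartDomain e U := fun y hy => ⟨hy.1, hy.2.1⟩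
    have h1 := killing_eq_zero_of_sdNabla (hloc e he _ hWo) hΛ
      (fun i => (smooth_vecComp hX.1 he i).mono hd) (fun y hy => hX.2 e he y (hd hy))
      (fun y hy => (sd_mul_self_eq (posDef_bilinComp g he hy.1) (hsd e he y (hd hy))).2.2
        ((hΦ e he y (hd hy)).2.symm.trans (hs _ hy.2))) hzd
    have h2 := (eq_zero_iff_vecComp he hzd.1).mpr h1
    rwa [e.left_inv hz.1] at h2
  · refine contMDiffOn_of_comp_symm hVo fun e he => ?_
    exact (((hss e he).mono (hdom e)).sqrt fun y hy => (hsp _ hy.2).ne').inv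
      fun y hy => (Real.sqrt_pos.mpr (hsp _ hy.2)).ne'
  · set Ω : M → ℝ := fun x => (Real.sqrt (s x))⁻¹ with hΩ
    set J : EndoField M := fun x => Ω x • Φ x with hJ
    have hΩp : ∀ x ∈ V, 0 < Ω x := fun x hx => inv_pos.mpr (Real.sqrt_pos.mpr (hsp x hx))
    have hΩs : ∀ x ∈ V, Ω x ^ 2 * s x = 1 := by
      intro x hx
      rw [hΩ, inv_pow, Real.sq_sqrt (hsp x hx).le, inv_mul_cancel₀ (hsp x hx).ne']
    have hΩc : ∀ e ∈ atlas E4 M, ContDiffOn ℝ ∞ (fun y => Ω (e.symm y)) (chartDomain e V) :=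
      fun e he => (((hss e he).mono (hdom e)).sqrt fun y hy => (hsp _ hy.2).ne').inv
        fun y hy => (Real.sqrt_pos.mpr (hsp _ hy.2)).ne'
    have hcomp : ∀ e ∈ atlas E4 M, ∀ y ∈ chartDomain e V, endoComp J e y
        = Ω (e.symm y) • sdNabla (bilinComp g.inner e) (vecComp X e) y := by
      intro e he y hy
      rw [← (hΦ e he y (hdom e hy)).1]
      ext i j
      exact congrFun (coordComp_smul (Ω (e.symm y)) (Φ (e.symm y) (coordFrame e y j))) i
    have hsd' : ∀ e ∈ atlas E4 M, ∀ y ∈ chartDomain e V,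
        hodgeEndo (bilinComp g.inner e y) (endoComp J e y) = endoComp J e y := by
      intro e he y hy
      rw [hcomp e he y hy, hodgeEndo_smul, hsd e he y (hdom e hy)]
    have hsq : ∀ e ∈ atlas E4 M, ∀ y ∈ chartDomain e V,
        endoComp J e y * endoComp J e y = -1 := by
      intro e he y hy
      have h1 := hΩs _ hy.2
      rw [(hΦ e he y (hdom e hy)).2] at h1
      rw [hcomp e he y hy, Matrix.smul_mul, Matrix.mul_smul, smul_smul,
        (sd_mul_self_eq (posDef_bilinComp g he hy.1) (hsd e he y (hdom e hy))).1, smul_smul,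
        mul_neg, ← pow_two, h1, neg_one_smul]
    refine ⟨fun e he i j => ?_, fun x hx v => ?_, fun x hx v w => ?_, fun e he y hy k i j => ?_,
      fun e he y hy => ?_⟩
    · have h1 : SmoothMat (chartDomain e V)
          (fun y => Ω (e.symm y) • sdNabla (bilinComp g.inner e) (vecComp X e) y) :=
        .smul (hΩc e he) fun i j => (hsm e he i j).mono (hdom e)
      exact (h1 i j).congr fun y hy => congrFun (congrFun (hcomp e he y hy) i) j
    · obtain ⟨e, he, y, hy, rfl⟩ := exists_chart_point x
      refine coordComp_injective he hy ?_
      rw [coordComp_endo J he hy, coordComp_endo J he hy, mulVec_mulVec, hsq _ he y ⟨hy, hx⟩,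
        ← neg_one_smul ℝ v, coordComp_smul, neg_one_smul, neg_mulVec, one_mulVec]
    · obtain ⟨e, he, y, hy, rfl⟩ := exists_chart_point x
      have h1 := (transpose_mul_mul_of_sd (posDef_bilinComp g he hy) (hsd' _ he y ⟨hy, hx⟩)
        (hsq _ he y ⟨hy, hx⟩)).2
      have h2 : g.inner (e.symm y) (J (e.symm y) v) (J (e.symm y) w)
          = g.inner (e.symm y) v w := by
        rw [bilin_apply g.inner he hy, bilin_apply g.inner he hy, coordComp_endo J he hy,
          coordComp_endo J he hy]
        conv_rhs => rw [← h1]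
        rw [← vecMul_transpose, ← dotProduct_mulVec]
        simp only [mulVec_mulVec, Matrix.mul_assoc]
      exact congrArg (fun t : ℝ => Ω (e.symm y) ^ 2 * t) h2
    · rw [covDerivEndo_eq, bilinComp_smul, cov_congr (isOpen_chartDomain e hVo) hy (hcomp e he)]
      have h1 := kahler_of_killing (hloc e he V hVo)
        (fun i => (smooth_vecComp hX.1 he i).mono (hdom e))
        (fun y hy => hX.2 e he y (hdom e hy)) (hΩc e he) (fun y hy => hΩp _ hy.2)
        (fun y hy => by rw [← (hΦ e he y (hdom e hy)).2]; exact hΩs _ hy.2) hy k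
      exact congrFun (congrFun h1 i) j
    · have hG := posDef_bilinComp g he hy.1
      have h1 := (transpose_mul_mul_of_sd hG (hsd' e he y hy) (hsq e he y hy)).1
      rw [bilinComp_comp _ J he hy.1, bilinComp_smul, conformal, Matrix.mul_smul, h1,
        hodgeStar_smul_metric _ _ (pow_pos (hΩp _ hy.2) 2), hodgeStar_smul,
        ← neg_one_smul ℝ (_ * _), hodgeStar_smul, ← mul_hodgeEndo hG, hsd' e he y hy]

end

end ConfKahler

end

/-! ### Assembly of the equivalence -/

theorem mainTheorem3 {M : Type*} [TopologicalSpace M] [ChartedSpace ConfKahler.E4 M]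
    [IsManifold (𝓡 4) ∞ M] (hM : ConfKahler.IsOrientedAtlas M)
    (g : ConfKahler.Metric4 M) (Λ : ℝ) (hΛ : Λ ≠ 0)
    (hE : ConfKahler.IsEinstein g.inner Λ) (hA : ConfKahler.IsAntiSelfDual g.inner)
    (U : Set M) (hU : IsOpen U) (hUc : IsConnected U) :
    ((∃ V : Set M, IsOpen V ∧ V.Nonempty ∧ V ⊆ U ∧
        ConfKahler.IsConformalToKahlerOn g.inner V) ↔
      ∃ V : Set M, IsOpen V ∧ V.Nonempty ∧ V ⊆ U ∧ ConfKahler.AdmitsKilling g.inner V) ∧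
    (ConfKahler.IsConformalToKahlerOn g.inner U → ConfKahler.AdmitsKilling g.inner U) ∧
    (ConfKahler.AdmitsKilling g.inner U →
      ∃ V : Set M, IsOpen V ∧ V ⊆ U ∧ U ⊆ closure V ∧
        ConfKahler.IsConformalToKahlerOn g.inner V) := by
  refine ⟨⟨?_, ?_⟩, ?_, ?_⟩
  · rintro ⟨V, hV, hne, hVU, h⟩
    exact ⟨V, hV, hne, hVU,
      ConfKahler.admitsKilling_of_conformalToKahler hΛ hE hA hV hne h⟩
  · rintro ⟨V, hV, -, hVU, h⟩
    obtain ⟨W, hW, hWV, hWc, hK⟩ := ConfKahler.exists_isConnected_isKillingOn hV h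
    obtain ⟨V', hV', hVW, hd, hc⟩ :=
      ConfKahler.conformalToKahler_of_killing hM hΛ hE hA hW hWc.isPreconnected hK
    -- The dense subset is nonempty because its closure contains the nonempty set W.
    exact ⟨V', hV', closure_nonempty_iff.mp (hWc.nonempty.mono hd),
      (hVW.trans hWV).trans hVU, hc⟩
  · exact ConfKahler.admitsKilling_of_conformalToKahler hΛ hE hA hU hUc.nonempty
  · exact ConfKahler.conformalToKahler_of_killing hM hΛ hE hA hU hUc.isPreconnected
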